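/- \textbf{Setting.} On $L^2(\mathbb R)$ consider the plant $\frac{d\psi}{dt}=\mathcal A\psi+\mathcal B w$, $y=\mathcal C\psi+\mathcal G v$. Write $\hat f(\lambda)=(2\pi)^{-1/2}\int f(x)e^{-i\lambda x}\,dx$, and say that an operator $\mathcal T$ has Fourier symbol $\hat{\mathcal T}_\lambda$ if $\widehat{\mathcal T f}(\lambda)=\hat{\mathcal T}_\lambda\hat f(\lambda)$ for a.e. $\lambda$, for all $f\in\mathcal D(\mathcal T)$. Assume: (A1) all fields are real and scalar, so that $\mathcal A,\mathcal B,\mathcal C,\mathcal G$ are real operators; (A2) $w,v$ are Gaussian white noises with identity covariance, $\psi(0)$ is a standard (identity covariance) Gaussian, and $\psi(0),w,v$ are independent; (A3) $\mathcal A$ is a densely defined constant-coefficient differential operator that generates a $C_0$-semigroup on $L^2(\mathbb R)$ and has a continuous Fourier symbol $\hat{\mathcal A}_\lambda$; (A4) $\mathcal B,\mathcal C,\mathcal G$ are bounded translation-invariant operators on $L^2(\mathbb R)$ whose Fourier symbols are proper rational functions of $\lambda$ without real zeros or real poles; $\mathcal G\mathcal G^*$ and $\mathcal B\mathcal B^*$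 are positive definite (so $\mathcal G\mathcal G^*$ has a densely defined, possibly unbounded, inverse); (A5) $(\mathcal A,\mathcal B)$ and $(\mathcal A^*,\mathcal C^*)$ are exponentially stabilizable (by bounded feedback). Let $\tilde\psi(t)=\mathbb E[\psi(t)\mid y(\tau),\tau\le t]$. The steady-state error covariance is the real bounded self-adjoint operator $\mathcal P$ with $\langle \mathcal Pf,f\rangle=\lim_{t\to\infty}\mathbb E\langle\psi(t)-\tilde\psi(t),f\rangle^2$ for all real $f\in L^2(\mathbb R)$. The algebraic Riccati equation (ARE) is $$\langle(\mathcal A\mathcal P+\mathcal P\mathcal A^*+\mathcal B\mathcal B^*-\mathcal P\mathcal C^*(\mathcal G\mathcal G^*)^{-1}\mathcal C\mathcal P)h,f\rangle=0\qquad(h,f\in\mathcal D(\mathcal A^*)),$$ read weakly: $\langle\mathcal A\mathcal Ph,f\rangle:=\langle\mathcal Ph,\mathcal A^*f\rangle$ and $\langle\mathcal P\mathcal C^*(\mathcal G\mathcal G^*)^{-1}\mathcal C\mathcal Ph,f\rangle:=\langle\mathcal G^{-1}\mathcal C\mathcal Ph,\mathcal G^{-1}\mathcal C\mathcal Pf\rangle$,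 where $\mathcal C\mathcal Ph$ is required to lie in the range of $\mathcal G$ for all $h\in\mathcal D(\mathcal A^*)$. A bounded self-adjoint solution is stabilizing if the closure of $\mathcal A-\mathcal P\mathcal C^*(\mathcal G\mathcal G^*)^{-1}\mathcal C$ (on its natural domain) generates an exponentially stable $C_0$-semigroup and its adjoint is the closure of $\mathcal A^*-\mathcal C^*(\mathcal G\mathcal G^*)^{-1}\mathcal C\mathcal P$ (on its natural domain); if $(\mathcal G\mathcal G^*)^{-1}$ is bounded, the closures and the condition on the adjoint are superfluous. \textbf{Theorem.} Under (A1)--(A5): (i) The ARE has a unique stabilizing bounded self-adjoint solution $\mathcal P$. The steady-state error covariance exists and equals $\mathcal P$, and $\mathcal P$ is translation invariant. (ii) A bounded operator with real Fourier symbol $q_\lambda$ is a self-adjoint solution of the ARE if and only if, for a.e. $\lambda$, $q_\lambda$ solves the scalar equation $$2\,\mathrm{Re}(\hat{\mathcal A}_\lambda)\,q_\lambda+|\hat{\mathcal B}_\lambda|^2-|\hat{\mathcal C}_\lambda|^2\,|\hat{\mathcal G}_\lambda|^{-2}\,q_\lambda^2=0 .$$ The operator $\mathcal P$ has a continuous Fourier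 symbol $\hat{\mathcal P}_\lambda$, and for every $\lambda\in\mathbb R$ the number $\hat{\mathcal P}_\lambda$ is the unique nonnegative solution of this equation. (iii) The Kalman gain $\mathcal L=\mathcal P\mathcal C^*(\mathcal G\mathcal G^*)^{-1}$, on the dense domain of $(\mathcal G\mathcal G^*)^{-1}$, is translation invariant with Fourier symbol $\hat{\mathcal L}_\lambda=\hat{\mathcal P}_\lambda\hat{\mathcal C}_\lambda^*/|\hat{\mathcal G}_\lambda|^2$, and it is a spatial convolution: there is a real tempered distribution $L$ with $\int L(x)e^{-i\lambda x}dx=\hat{\mathcal L}_\lambda$ in the sense of distributions and $\mathcal L\varphi=L*\varphi$ for all Schwartz functions $\varphi$. (iv) The Kalman filter $\frac{d\tilde\psi}{dt}=(\mathcal A-\mathcal L\mathcal C)\tilde\psi+\mathcal L y$, $\tilde\psi(0)=0$, is spatially invariant: $\mathcal A-\mathcal L\mathcal C$ and its closure are translation invariant, the latter with Fourier symbol $\hat{\mathcal A}_\lambda-\hat{\mathcal L}_\lambda\hat{\mathcal C}_\lambda$, and translating the measurement $y$ of a (classical) filter trajectory in space translates the estimate by the same amount. -/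

import Mathlib

open MeasureTheory ProbabilityTheory Filter Topology
open scoped ENNReal FourierTransform SchwartzMap

noncomputable section

namespace KalmanSIS

/-- The complex Hilbert space `L²(ℝ)`. -/
abbrev L2 : Type := Lp ℂ 2 (volume : Measure ℝ)

/-! ### Translations, Fourier symbols, real operators -/

/-- The translation `(T_z f)(x) = f (x - z)` on `L²(ℝ)`. -/
def translation (z : ℝ) : L2 →ₗᵢ[ℂ] L2 :=
  Lp.compMeasurePreservingₗᵢ ℂ (fun x : ℝ => x - z) (measurePreserving_sub_right volume z)

/-- A bounded everywhere defined operator, regarded as a partially defined one. -/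
def toPartial (T : L2 →L[ℂ] L2) : L2 →ₗ.[ℂ] L2 :=
  (T : L2 →ₗ[ℂ] L2).toPMap ⊤

/-- `A` is translation invariant: every translation maps the domain of `A` to itself and commutes
with `A` there. -/
def TranslationInvariant (A : L2 →ₗ.[ℂ] L2) : Prop :=
  ∀ (z : ℝ) (f : A.domain), ∃ h : translation z f ∈ A.domain,
    A ⟨translation z f, h⟩ = translation z (A f)

/-- `A` has Fourier symbol `a`. With the unitary transform
`f̂(λ) = (2π)^(-1/2) ∫ f(x) exp(-iλx) dx` this says `(A f)^(λ) = a(λ) f̂(λ)` for almost every `λ`;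
here it is written with `𝓕 f (ξ) = ∫ f(x) exp(-2πixξ) dx`, so that `λ = 2πξ`. -/
def HasFourierSymbol (A : L2 →ₗ.[ℂ] L2) (a : ℝ → ℂ) : Prop :=
  ∀ f : A.domain, ∀ᵐ ξ : ℝ,
    (𝓕 (A f) : L2) ξ = a (2 * Real.pi * ξ) * (𝓕 (f : L2) : L2) ξ

/-- `A` is a real operator: it commutes with complex conjugation, that is, it is the
complexification of an operator on real-valued fields. -/
def IsRealOperator (A : L2 →ₗ.[ℂ] L2) : Prop :=
  ∀ f : A.domain, ∃ h : star (f : L2) ∈ A.domain, A ⟨star (f : L2), h⟩ = star (A f)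

/-- `A` acts as a constant-coefficient differential operator `∑ qₖ ∂ˣᵏ`, with derivatives in the
sense of distributions. -/
def IsDifferentialOperator (A : L2 →ₗ.[ℂ] L2) : Prop :=
  ∃ q : Polynomial ℂ, ∀ f : A.domain,
    (Lp.toTemperedDistribution (A f) : 𝓢'(ℝ, ℂ)) =
      ∑ k ∈ Finset.range (q.natDegree + 1),
        q.coeff k • ((TemperedDistribution.derivCLM ℂ)^[k]
          (Lp.toTemperedDistribution (f : L2) : 𝓢'(ℝ, ℂ)))

/-- A proper rational function of `λ ∈ ℝ` that has neither zeros nor poles on the real line. -/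
def IsProperRational (φ : ℝ → ℂ) : Prop :=
  ∃ num den : Polynomial ℂ, num.natDegree ≤ den.natDegree ∧
    (∀ x : ℝ, num.eval (x : ℂ) ≠ 0) ∧ (∀ x : ℝ, den.eval (x : ℂ) ≠ 0) ∧
    ∀ x : ℝ, φ x = num.eval (x : ℂ) / den.eval (x : ℂ)

/-- Positive definiteness of a bounded operator. -/
def IsPositiveDefinite (T : L2 →L[ℂ] L2) : Prop :=
  IsSelfAdjoint T ∧ ∀ f : L2, f ≠ 0 → 0 < (inner ℂ f (T f)).re

/-! ### Strongly continuous semigroups -/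

/-- `S` (only its values at times `t ≥ 0` matter) is a strongly continuous semigroup. -/
structure IsC0Semigroup (S : ℝ → L2 →L[ℂ] L2) : Prop where
  zero : S 0 = ContinuousLinearMap.id ℂ L2
  add : ∀ s t : ℝ, 0 ≤ s → 0 ≤ t → S (s + t) = (S s).comp (S t)
  tendsto : ∀ f : L2, Tendsto (fun t => S t f) (𝓝[>] 0) (𝓝 f)

/-- `A`, with exactly its domain, is the infinitesimal generator of `S`. -/
def IsGenerator (S : ℝ → L2 →L[ℂ] L2) (A : L2 →ₗ.[ℂ] L2) : Prop :=
  ∀ f h : L2, (f, h) ∈ A.graph ↔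
    Tendsto (fun t : ℝ => ((t⁻¹ : ℝ) : ℂ) • (S t f - f)) (𝓝[>] 0) (𝓝 h)

/-- Exponential stability of a semigroup. -/
def IsExponentiallyStable (S : ℝ → L2 →L[ℂ] L2) : Prop :=
  ∃ M ω : ℝ, 0 < ω ∧ ∀ t : ℝ, 0 ≤ t → ‖S t‖ ≤ M * Real.exp (-(ω * t))

/-- `A` generates an exponentially stable strongly continuous semigroup. -/
def GeneratesStable (A : L2 →ₗ.[ℂ] L2) : Prop :=
  ∃ S : ℝ → L2 →L[ℂ] L2, IsC0Semigroup S ∧ IsGenerator S A ∧ IsExponentiallyStable S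

/-- The pair `(A, B)` is exponentially stabilizable: `A + B F`, on the domain of `A`, generates an
exponentially stable semigroup for some bounded feedback `F`. -/
def IsStabilizable (A : L2 →ₗ.[ℂ] L2) (B : L2 →L[ℂ] L2) : Prop :=
  ∃ F : L2 →L[ℂ] L2, GeneratesStable (((B.comp F : L2 →L[ℂ] L2) : L2 →ₗ[ℂ] L2) +ᵥ A)

/-! ### The plant -/

/-- The data of the plant `dψ/dt = A ψ + B w`, `y = C ψ + G v`: its operators, the semigroup
generated by `A`, and the Fourier symbols. -/
structure Plant where
  A : L2 →ₗ.[ℂ] L2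
  S : ℝ → L2 →L[ℂ] L2
  B : L2 →L[ℂ] L2
  C : L2 →L[ℂ] L2
  G : L2 →L[ℂ] L2
  symA : ℝ → ℂ
  symB : ℝ → ℂ
  symC : ℝ → ℂ
  symG : ℝ → ℂ

namespace Plant

variable (p : Plant)

/-- The standing assumptions on the operators of the plant. -/
structure Admissible : Prop where
  real_A : IsRealOperator p.A
  real_B : IsRealOperator (toPartial p.B)
  real_C : IsRealOperator (toPartial p.C)
  real_G : IsRealOperator (toPartial p.G)
  dense_A : Dense (p.A.domain : Set L2)
  differential_A : IsDifferentialOperator p.A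
  semigroup : IsC0Semigroup p.S
  generator : IsGenerator p.S p.A
  continuous_symA : Continuous p.symA
  symbol_A : HasFourierSymbol p.A p.symA
  invariant_B : TranslationInvariant (toPartial p.B)
  invariant_C : TranslationInvariant (toPartial p.C)
  invariant_G : TranslationInvariant (toPartial p.G)
  symbol_B : HasFourierSymbol (toPartial p.B) p.symB
  symbol_C : HasFourierSymbol (toPartial p.C) p.symC
  symbol_G : HasFourierSymbol (toPartial p.G) p.symG
  rational_B : IsProperRational p.symB
  rational_C : IsProperRational p.symC
  rational_G : IsProperRational p.symG
  posDef_GG : IsPositiveDefinite (p.G.comp (ContinuousLinearMap.adjoint p.G))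
  posDef_BB : IsPositiveDefinite (p.B.comp (ContinuousLinearMap.adjoint p.B))
  stabilizable_AB : IsStabilizable p.A p.B
  stabilizable_AC : IsStabilizable p.A.adjoint (ContinuousLinearMap.adjoint p.C)

/-! ### Riccati equation, gain, closed loop -/

/-- `(G G*)⁻¹`, defined on the range of `G G*`; it is unbounded if the measurement noise is
spatially correlated with a spectral density that decays at infinity. -/
def invGG : L2 →ₗ.[ℂ] L2 :=
  (toPartial (p.G.comp (ContinuousLinearMap.adjoint p.G))).inverse

/-- The gain `L = P C* (G G*)⁻¹`, on the domain of `(G G*)⁻¹`. -/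
def gain (P : L2 →L[ℂ] L2) : L2 →ₗ.[ℂ] L2 :=
  ((P.comp (ContinuousLinearMap.adjoint p.C) : L2 →L[ℂ] L2) : L2 →ₗ[ℂ] L2).compPMap p.invGG

end Plant

/-- The operator `A - R T` on its natural domain `{f ∈ D(A) : T f ∈ D(R)}`. -/
def subComp (A R : L2 →ₗ.[ℂ] L2) (T : L2 →L[ℂ] L2) : L2 →ₗ.[ℂ] L2 where
  domain := A.domain ⊓ R.domain.comap (T : L2 →ₗ[ℂ] L2)
  toFun :=
    { toFun := fun f => A ⟨f, f.2.1⟩ - R ⟨T f, f.2.2⟩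
      map_add' := by
        intro f h
        have h1 : (⟨((f + h : ↥(A.domain ⊓ R.domain.comap (T : L2 →ₗ[ℂ] L2))) : L2),
            (f + h).2.1⟩ : A.domain) = ⟨f, f.2.1⟩ + ⟨h, h.2.1⟩ := rfl
        have h2 : (⟨T ((f + h : ↥(A.domain ⊓ R.domain.comap (T : L2 →ₗ[ℂ] L2))) : L2),
            (f + h).2.2⟩ : R.domain) = ⟨T f, f.2.2⟩ + ⟨T h, h.2.2⟩ :=
          Subtype.ext (map_add T (f : L2) (h : L2))
        rw [h1, h2, A.map_add, R.map_add]
        abel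
      map_smul' := by
        intro c f
        have h1 : (⟨((c • f : ↥(A.domain ⊓ R.domain.comap (T : L2 →ₗ[ℂ] L2))) : L2),
            (c • f).2.1⟩ : A.domain) = c • ⟨f, f.2.1⟩ := rfl
        have h2 : (⟨T ((c • f : ↥(A.domain ⊓ R.domain.comap (T : L2 →ₗ[ℂ] L2))) : L2),
            (c • f).2.2⟩ : R.domain) = c • ⟨T f, f.2.2⟩ :=
          Subtype.ext (map_smul T c (f : L2))
        rw [h1, h2, A.map_smul, R.map_smul, RingHom.id_apply, smul_sub] }

namespace Plant

variable (p : Plant)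

/-- The filter operator `A - L C = A - P C* (G G*)⁻¹ C`, on its natural domain. -/
def closedLoop (P : L2 →L[ℂ] L2) : L2 →ₗ.[ℂ] L2 :=
  subComp p.A (p.gain P) p.C

/-- The formal adjoint `A* - C* (G G*)⁻¹ C P` of the filter operator, on its natural domain. -/
def dualClosedLoop (P : L2 →L[ℂ] L2) : L2 →ₗ.[ℂ] L2 :=
  subComp p.A.adjoint
    ((ContinuousLinearMap.adjoint p.C : L2 →ₗ[ℂ] L2).compPMap p.invGG) (p.C.comp P)

/-- `P` is a bounded self-adjoint solution of the Riccati equation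
`⟨(A P + P A* + B B* - P C* (G G*)⁻¹ C P) h, f⟩ = 0` for all `h, f ∈ D(A*)`.
The term with `A P` is read as `⟨P h, A* f⟩`, and the quadratic term as
`⟨G⁻¹ C P h, G⁻¹ C P f⟩`, which requires `C P h` to lie in the range of the injective operator `G`;
the latter is `⟨P C* (G G*)⁻¹ C P h, f⟩` whenever `C P h` is in the domain of `(G G*)⁻¹`.
(Mathlib's inner product is conjugate linear in its first variable.) -/
def SolvesARE (P : L2 →L[ℂ] L2) : Prop :=
  IsSelfAdjoint P ∧
  ∀ h f : p.A.adjoint.domain, ∃ u v : L2,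
    p.G u = p.C (P h) ∧ p.G v = p.C (P f) ∧
    inner ℂ (p.A.adjoint f) (P h) + inner ℂ (f : L2) (P (p.A.adjoint h))
      + inner ℂ (f : L2) (p.B (ContinuousLinearMap.adjoint p.B h)) - inner ℂ v u = 0

/-- `P` is stabilizing: the (closure of the) filter operator `A - P C* (G G*)⁻¹ C` generates an
exponentially stable semigroup, and its adjoint is the (closure of the) formal adjoint.
If `(G G*)⁻¹` is bounded, both operators are closed already and the last requirement
always holds. -/
def IsStabilizing (P : L2 →L[ℂ] L2) : Prop :=
  (p.closedLoop P).IsClosable ∧ GeneratesStable (p.closedLoop P).closure ∧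
  (p.dualClosedLoop P).IsClosable ∧
  (p.closedLoop P).closure.adjoint = (p.dualClosedLoop P).closure

/-- The scalar Riccati equation at the spatial frequency `x`, for the unknown `r`. -/
def ScalarARE (x r : ℝ) : Prop :=
  2 * (p.symA x).re * r + ‖p.symB x‖ ^ 2
    - ‖p.symC x‖ ^ 2 * (‖p.symG x‖ ^ 2)⁻¹ * r ^ 2 = 0

/-- `est` is a (classical) trajectory of the filter
`dψ̃/dt = (A - L C) ψ̃ + L y`, `ψ̃(0) = 0`, driven by the measurement `y`. -/
def IsFilterTrajectory (P : L2 →L[ℂ] L2) (y est : ℝ → L2) : Prop :=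
  est 0 = 0 ∧ ∀ t : ℝ, 0 ≤ t → ∃ u v : L2,
    (est t, u) ∈ (p.closedLoop P).closure.graph ∧ (y t, v) ∈ (p.gain P).graph ∧
    HasDerivWithinAt est (u + v) (Set.Ici 0) t

end Plant

/-! ### Spatial convolutions -/

/-- The Schwartz function `y ↦ φ (x - y)`. -/
def reflectAt (x : ℝ) (φ : 𝓢(ℝ, ℂ)) : 𝓢(ℝ, ℂ) :=
  SchwartzMap.compSubConstCLM ℂ x
    (SchwartzMap.compCLMOfContinuousLinearEquiv ℂ (ContinuousLinearEquiv.neg ℝ) φ)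

/-- `L` is the spatial convolution with the real kernel `K`, a tempered distribution (which may have
point-supported parts): every Schwartz function `φ` is in the domain of `L`, and
`(L φ)(x) = K (φ (x - ·))`, that is `∫ K(x - ξ) φ(ξ) dξ` if `K` is a function. -/
def IsSpatialConvolution (L : L2 →ₗ.[ℂ] L2) (K : 𝓢'(ℝ, ℂ)) : Prop :=
  (∀ φ : 𝓢(ℝ, ℂ), (∀ x, (φ x).im = 0) → (K φ).im = 0) ∧
  ∀ φ : 𝓢(ℝ, ℂ), ∃ h : φ.toLp 2 volume ∈ L.domain,
    ∀ᵐ x : ℝ, (L ⟨φ.toLp 2 volume, h⟩ : L2) x = K (reflectAt x φ)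

/-- The tempered distribution `K` has the (locally integrable) Fourier transform
`∫ K(x) exp(-iλx) dx = l(λ)`. -/
def KernelHasSymbol (K : 𝓢'(ℝ, ℂ)) (l : ℝ → ℂ) : Prop :=
  ∀ φ : 𝓢(ℝ, ℂ), Integrable (fun ξ : ℝ => φ ξ * l (2 * Real.pi * ξ)) ∧
    (𝓕 K : 𝓢'(ℝ, ℂ)) φ = ∫ ξ : ℝ, φ ξ * l (2 * Real.pi * ξ)

/-! ### The filtering problem -/

/-- Real-valued elements of `L²(ℝ)`. -/
def RealField : Type := {f : L2 // star f = f}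

/-- Square integrable signals on `[0, ∞)` with values in the real-valued elements of `L²(ℝ)`. -/
def RealSignal : Type :=
  {k : ℝ → L2 // MemLp k 2 (volume.restrict (Set.Ici (0 : ℝ))) ∧ ∀ t, star (k t) = k t}

/-- `X` is a centred Gaussian family of real random variables with covariance `cov`. -/
structure IsCenteredGaussian {T Ω : Type*} [MeasurableSpace Ω] (μ : Measure Ω)
    (X : T → Ω → ℝ) (cov : T → T → ℝ) : Prop where
  measurable : ∀ i, Measurable (X i)
  gaussian : IsGaussianProcess X μ
  mean : ∀ i, ∫ ω, X i ω ∂μ = 0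
  covariance : ∀ i j, ∫ ω, X i ω * X j ω ∂μ = cov i j

/-- The σ-algebra generated by a family of real random variables. -/
abbrev generatedBy {T Ω : Type*} (X : T → Ω → ℝ) : MeasurableSpace Ω :=
  ⨆ i, MeasurableSpace.comap (X i) inferInstance

/-- The random inputs of the plant, given by their integrals against real test functions:
`init f = ⟨ψ(0), f⟩`, `w k = ∫ ⟨w(t), k(t)⟩ dt` and `v k = ∫ ⟨v(t), k(t)⟩ dt`
(only the values at real fields and real signals matter). -/
structure Inputs (Ω : Type*) where
  init : L2 → Ω → ℝ
  w : (ℝ → L2) → Ω → ℝ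
  v : (ℝ → L2) → Ω → ℝ

namespace Inputs

variable {Ω : Type*} [MeasurableSpace Ω] (μ : Measure Ω) (N : Inputs Ω)

/-- The initial state is standard Gaussian, `w` and `v` are Gaussian white noises with identity
covariance, and the three are independent. -/
structure IsWhite : Prop where
  init : IsCenteredGaussian μ (fun f : RealField => N.init f.1)
    (fun f h => (inner ℂ f.1 h.1).re)
  w : IsCenteredGaussian μ (fun k : RealSignal => N.w k.1)
    (fun k l => ∫ t in Set.Ici (0 : ℝ), (inner ℂ (k.1 t) (l.1 t)).re)
  v : IsCenteredGaussian μ (fun k : RealSignal => N.v k.1)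
    (fun k l => ∫ t in Set.Ici (0 : ℝ), (inner ℂ (k.1 t) (l.1 t)).re)
  indep : iIndep ![generatedBy (fun f : RealField => N.init f.1),
    generatedBy (fun k : RealSignal => N.w k.1),
    generatedBy (fun k : RealSignal => N.v k.1)] μ

end Inputs

namespace Plant

variable (p : Plant)

/-- The mild solution `ψ(T) = S(T) ψ(0) + ∫₀ᵀ S(T - s) B w(s) ds` of the state equation, tested
against `f`. -/
def state {Ω : Type*} (N : Inputs Ω) (T : ℝ) (f : L2) (ω : Ω) : ℝ :=
  N.init (ContinuousLinearMap.adjoint (p.S T) f) ω +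
  N.w (Set.indicator (Set.Icc 0 T) fun s =>
    ContinuousLinearMap.adjoint p.B (ContinuousLinearMap.adjoint (p.S (T - s)) f)) ω

/-- The measurement on `[0, T]` tested against the signal `k`:
`∫₀ᵀ ⟨y(τ), k(τ)⟩ dτ = ∫₀ᵀ ⟨C ψ(τ) + G v(τ), k(τ)⟩ dτ`, where `ψ` is the mild solution and all
operators have been moved onto `k`. -/
def measurement {Ω : Type*} (N : Inputs Ω) (T : ℝ) (k : ℝ → L2) (ω : Ω) : ℝ :=
  N.init (∫ τ in Set.Icc 0 T,
    ContinuousLinearMap.adjoint (p.S τ) (ContinuousLinearMap.adjoint p.C (k τ))) ω +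
  N.w (Set.indicator (Set.Icc 0 T) fun s =>
    ContinuousLinearMap.adjoint p.B (∫ τ in Set.Icc s T,
      ContinuousLinearMap.adjoint (p.S (τ - s)) (ContinuousLinearMap.adjoint p.C (k τ)))) ω +
  N.v (Set.indicator (Set.Icc 0 T) fun s => ContinuousLinearMap.adjoint p.G (k s)) ω

/-- The information in the measurements up to time `T`. -/
abbrev observations {Ω : Type*} (N : Inputs Ω) (T : ℝ) : MeasurableSpace Ω :=
  generatedBy (fun k : RealSignal => p.measurement N T k.1)

/-- The variance, in the direction `f`, of the error at time `T` of the optimal causal estimate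
`ψ̃(T) = E[ψ(T) | y(τ), τ ≤ T]`. -/
def errorVariance {Ω : Type*} [MeasurableSpace Ω] (μ : Measure Ω) (N : Inputs Ω)
    (T : ℝ) (f : L2) : ℝ :=
  ∫ ω, (p.state N T f ω - (μ[p.state N T f | p.observations N T]) ω) ^ 2 ∂μ

/-- `P` is the steady-state covariance operator of the optimal estimation error: a real bounded
self-adjoint operator with `⟨P f, f⟩ = lim_{T → ∞} E ⟨ψ(T) - ψ̃(T), f⟩²` for every real field `f`. -/
def IsSteadyStateErrorCovariance {Ω : Type*} [MeasurableSpace Ω] (μ : Measure Ω) (N : Inputs Ω)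
    (P : L2 →L[ℂ] L2) : Prop :=
  IsSelfAdjoint P ∧ IsRealOperator (toPartial P) ∧
  ∀ f : L2, star f = f →
    Tendsto (fun T : ℝ => p.errorVariance μ N T f) atTop (𝓝 (inner ℂ f (P f)).re)

end Plant

end KalmanSIS

end

noncomputable section

namespace KalmanSIS

/-! ### Multiplication by bounded functions, conjugation, translation -/

/-! On the Fourier side every operator of the plant is multiplication by a continuous function, so
the filtering problem splits into scalar problems, one for each frequency `x`. Put α = Re A, b = |B|
and q = |C|²/|G|² at `x`. Since b and q do not vanish, 2αr + b² - qr² = 0 has one positive and one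
negative root. The positive root is r = (α + σ)/q with σ = √(α² + b²q), and the closed loop decays
at the rate σ. What remains is to return from symbols to operators, uniformly in `x` and with a
possibly unbounded inverse of G.

Uniformity comes from stabilizability. Wave packets concentrated near a frequency turn it into a
Hautus test (`GeneratesStable.symbol_dichotomy`): for some δ > 0, either α ≤ -δ or |B| ≥ δ, and
likewise for C. Hence σ is bounded below and r above (`exists_decayRate_ge_and_riccatiSymbol_le`),
so `riccatiOp` is bounded and its closed loop is exponentially stable. Domains are controlled by
band-limited functions: a continuous symbol is bounded on a band, so they lie in every domain that
occurs and form a core (`closure_eq_maxMul`, `maxMul_adjoint`).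

Uniqueness is operator-theoretic, because a competing solution Q is not assumed translation
invariant. Subtracting the two Riccati equations shows that D = Q - P intertwines the closed loop of
Q with minus the adjoint closed loop of P (`inner_dualClosedLoop_add`). Therefore D = S(t) D exp(t
A_P*) on band-limited functions, where S is the stable semigroup of Q, and t → ∞ gives D = 0
(`eq_riccatiOp`).

For the error covariance, Gaussian regression (`condExp_eq`) replaces conditional expectation by a
linear estimate with uncorrelated error. For a band-limited field the optimal weight solves a
Hamiltonian two-point system, explicit in cosh(σs) and sinh(σs) at each frequency. The error
variance is then the quadratic form of an operator with symbol `covarianceSymbol`. Density extends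
this to all real fields, and dominated convergence as T → ∞ yields r.

The gain symbol has at most polynomial growth, since 1/|G|² is bounded by a constant times the
squared modulus of the denominator of G. Its inverse Fourier transform is therefore a tempered
distribution, the convolution kernel; the kernel is real because symbols of real operators are
Hermitian. -/

/-- Measurable bounded functions on the line. -/
def BoundedSymbol (m : ℝ → ℂ) : Prop := Measurable m ∧ ∃ c : ℝ, ∀ x, ‖m x‖ ≤ c

lemma BoundedSymbol.memLp {m : ℝ → ℂ} (hm : BoundedSymbol m) (f : L2) :
    MemLp (fun x => m x * f x) 2 volume := by
  obtain ⟨c, hc⟩ := hm.2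
  refine MemLp.of_le_mul (c := c) (Lp.memLp f)
    (hm.1.aestronglyMeasurable.mul (Lp.aestronglyMeasurable f)) (ae_of_all _ fun x => ?_)
  rw [norm_mul]
  exact mul_le_mul_of_nonneg_right (hc x) (norm_nonneg _)

lemma norm_le_of_ae_le {f g : L2} {c : ℝ} (h : ∀ᵐ x, ‖f x‖ ≤ c * ‖g x‖) :
    ‖f‖ ≤ c * ‖g‖ := Lp.norm_le_mul_norm_of_ae_le_mul h

open Classical in
/-- The operator of multiplication by a bounded measurable function. -/
def pointwiseMul (m : ℝ → ℂ) : L2 →L[ℂ] L2 :=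
  if hm : BoundedSymbol m then
    LinearMap.mkContinuousOfExistsBound
      { toFun := fun f => (hm.memLp f).toLp _
        map_add' := fun f g => by
          ext1
          filter_upwards [(hm.memLp (f + g)).coeFn_toLp, (hm.memLp f).coeFn_toLp,
            (hm.memLp g).coeFn_toLp, Lp.coeFn_add f g,
            Lp.coeFn_add ((hm.memLp f).toLp _) ((hm.memLp g).toLp _)] with x h1 h2 h3 h4 h5
          rw [h1, h5, Pi.add_apply, h2, h3, h4, Pi.add_apply, mul_add]
        map_smul' := fun c f => by
          ext1
          filter_upwards [(hm.memLp (c • f)).coeFn_toLp, (hm.memLp f).coeFn_toLp,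
            Lp.coeFn_smul c f, Lp.coeFn_smul c ((hm.memLp f).toLp _)] with x h1 h2 h3 h4
          rw [h1, RingHom.id_apply, h4, Pi.smul_apply, h2, h3, Pi.smul_apply]
          simp only [smul_eq_mul]; ring }
      (by
        obtain ⟨c, hc⟩ := hm.2
        refine ⟨c, fun f => norm_le_of_ae_le ?_⟩
        filter_upwards [(hm.memLp f).coeFn_toLp] with x h1
        simp only [LinearMap.coe_mk, AddHom.coe_mk]
        rw [h1, norm_mul]
        exact mul_le_mul_of_nonneg_right (hc x) (norm_nonneg _))
  -- The default value makes the operator total in `m`, so it can be written down before boundedness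
  -- of the symbol is proved.
  else 0

lemma pointwiseMul_ae {m : ℝ → ℂ} (hm : BoundedSymbol m) (f : L2) :
    ∀ᵐ x, pointwiseMul m f x = m x * f x := by
  rw [pointwiseMul, dif_pos hm]
  exact (hm.memLp f).coeFn_toLp

/-- Complex conjugation on `L²(ℝ)`, as a real-linear isometry. -/
def conjL : L2 →ₗᵢ[ℝ] L2 where
  toFun f := star f
  map_add' f g := by
    ext1
    filter_upwards [Lp.coeFn_star (f + g), Lp.coeFn_star f, Lp.coeFn_star g, Lp.coeFn_add f g,
      Lp.coeFn_add (star f) (star g)] with x h1 h2 h3 h4 h5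
    rw [h1, h5, Pi.star_apply, h4, Pi.add_apply, Pi.add_apply, h2, h3, Pi.star_apply,
      Pi.star_apply, star_add]
  map_smul' c f := by
    ext1
    filter_upwards [Lp.coeFn_star (c • f), Lp.coeFn_star f, Lp.coeFn_smul c f,
      Lp.coeFn_smul c (star f)] with x h1 h2 h3 h4
    simp [h1, h2, h3, h4]
  norm_map' f := by
    refine le_antisymm ?_ ?_
    · refine Lp.norm_le_norm_of_ae_le ?_
      filter_upwards [Lp.coeFn_star f] with x h1
      simp [h1]
    · refine Lp.norm_le_norm_of_ae_le ?_
      filter_upwards [Lp.coeFn_star f] with x h1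
      simp [h1]

lemma conjL_apply (f : L2) : conjL f = star f := rfl

lemma star_ae (f : L2) : ∀ᵐ x, (star f : L2) x = star (f x) := Lp.coeFn_star f

lemma inner_eq_integral (f g : L2) : inner ℂ f g = ∫ x, star (f x) * g x := by
  rw [L2.inner_def]
  refine integral_congr_ae (ae_of_all _ fun x => ?_)
  simp [mul_comm]

lemma star_smul_L2 (c : ℂ) (f : L2) : (star (c • f) : L2) = star c • star f := by
  ext1
  filter_upwards [star_ae (c • f), star_ae f, Lp.coeFn_smul c f,
    Lp.coeFn_smul (star c) (star f)] with x h1 h2 h3 h4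
  rw [h1, h4, h3, Pi.smul_apply, Pi.smul_apply, h2, star_smul]

lemma star_add_L2 (f g : L2) : (star (f + g) : L2) = star f + star g := conjL.map_add f g

lemma star_sub_L2 (f g : L2) : (star (f - g) : L2) = star f - star g := conjL.map_sub f g

lemma star_zero_L2 : (star (0 : L2) : L2) = 0 := conjL.map_zero

lemma inner_star_star (f g : L2) : inner ℂ (star f : L2) (star g) = star (inner ℂ f g) := by
  rw [inner_eq_integral, inner_eq_integral, RCLike.star_def, ← integral_conj]
  refine integral_congr_ae ?_
  filter_upwards [star_ae f, star_ae g] with x h1 h2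
  simp [h1, h2]

lemma translation_ae (z : ℝ) (f : L2) : ∀ᵐ x, translation z f x = f (x - z) :=
  Lp.coeFn_compMeasurePreserving f (measurePreserving_sub_right volume z)

/-- Reflection of the line. -/
def reflection : L2 →ₗᵢ[ℂ] L2 :=
  Lp.compMeasurePreservingₗᵢ ℂ (fun x : ℝ => -x) (Measure.measurePreserving_neg volume)

lemma reflection_ae (f : L2) : ∀ᵐ x, reflection f x = f (-x) :=
  Lp.coeFn_compMeasurePreserving f (Measure.measurePreserving_neg volume)

lemma denseRange_toLp : DenseRange (fun φ : 𝓢(ℝ, ℂ) => (φ.toLp 2 volume : L2)) :=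
  SchwartzMap.denseRange_toLpCLM (F := ℂ) (p := 2) ENNReal.ofNat_ne_top

lemma fourier_toLp (φ : 𝓢(ℝ, ℂ)) : (𝓕 (φ.toLp 2 volume : L2) : L2) = (𝓕 φ).toLp 2 volume :=
  SchwartzMap.toLp_fourier_eq φ

lemma fourier_schwartz_apply (φ : 𝓢(ℝ, ℂ)) (x : ℝ) :
    𝓕 φ x = ∫ v : ℝ, Complex.exp (-(2 * Real.pi * v * x * Complex.I)) * φ v := by
  rw [SchwartzMap.fourier_coe, Real.fourier_eq']
  refine integral_congr_ae (ae_of_all _ fun v => ?_)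
  simp only [RCLike.inner_apply, conj_trivial, smul_eq_mul]
  congr 2
  push_cast; ring

lemma boundedSymbol_exp (z : ℝ) :
    BoundedSymbol (fun ξ : ℝ => Complex.exp (-(2 * Real.pi * z * ξ * Complex.I))) := by
  refine ⟨by fun_prop, 1, fun ξ => ?_⟩
  rw [Complex.norm_exp]
  simp

/-- A translation acts on the Fourier side as the multiplication by a character. -/
lemma fourier_translation (z : ℝ) (f : L2) :
    ∀ᵐ ξ, (𝓕 (translation z f) : L2) ξ =
      Complex.exp (-(2 * Real.pi * z * ξ * Complex.I)) * (𝓕 f : L2) ξ := by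
  have key : (fun f : L2 => (𝓕 (translation z f) : L2)) = fun f : L2 =>
      pointwiseMul (fun ξ : ℝ => Complex.exp (-(2 * Real.pi * z * ξ * Complex.I))) (𝓕 f) := by
    refine denseRange_toLp.equalizer ?_ ?_ ?_
    · exact (Lp.fourierTransformₗᵢ ℝ ℂ).continuous.comp (translation z).continuous
    · exact (pointwiseMul _).continuous.comp (Lp.fourierTransformₗᵢ ℝ ℂ).continuous
    · funext φ
      have h1 : translation z (φ.toLp 2 volume) =
          ((SchwartzMap.compSubConstCLM ℂ z φ).toLp 2 volume : L2) := by
        ext1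
        have h2 := (measurePreserving_sub_right volume z).quasiMeasurePreserving.ae
          (SchwartzMap.coeFn_toLp φ 2 volume)
        filter_upwards [translation_ae z (φ.toLp 2 volume), h2,
          SchwartzMap.coeFn_toLp (SchwartzMap.compSubConstCLM ℂ z φ) 2 volume] with x h3 h4 h5
        rw [h3, h4, h5, SchwartzMap.compSubConstCLM_apply]
      simp only [Function.comp_apply]
      rw [h1, fourier_toLp, fourier_toLp]
      ext1
      filter_upwards [SchwartzMap.coeFn_toLp (𝓕 (SchwartzMap.compSubConstCLM ℂ z φ)) 2 volume,
        SchwartzMap.coeFn_toLp (𝓕 φ) 2 volume,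
        pointwiseMul_ae (boundedSymbol_exp z) ((𝓕 φ).toLp 2 volume)] with ξ h3 h4 h5
      rw [h3, h5, h4, fourier_schwartz_apply, fourier_schwartz_apply,
        ← integral_const_mul,
        ← integral_add_right_eq_self _ z]
      refine integral_congr_ae (ae_of_all _ fun v => ?_)
      simp only [SchwartzMap.compSubConstCLM_apply, add_sub_cancel_right]
      rw [← mul_assoc, ← Complex.exp_add]
      congr 2
      push_cast; ring
  rw [show (𝓕 (translation z f) : L2) = _ from congrFun key f]
  exact pointwiseMul_ae (boundedSymbol_exp z) _

lemma fourier_conj_integral (φ ψ : 𝓢(ℝ, ℂ)) (h : ∀ x, ψ x = star (φ x)) (ξ : ℝ) :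
    𝓕 ψ ξ = star (𝓕 φ (-ξ)) := by
  rw [fourier_schwartz_apply, fourier_schwartz_apply, RCLike.star_def, ← integral_conj]
  refine integral_congr_ae (ae_of_all _ fun v => ?_)
  simp only [h, map_mul, RCLike.star_def, ← Complex.exp_conj, map_neg, Complex.conj_I,
    Complex.conj_ofReal, Complex.ofReal_neg, map_ofNat]
  congr 2
  ring

/-- Conjugating the kernel exp(-2πivξ) reverses the frequency; the identity extends from Schwartz
functions by density. It converts reality of an operator into the Hermitian symmetry of its symbol.
-/
lemma fourier_star (f : L2) : ∀ᵐ ξ, (𝓕 (star f : L2) : L2) ξ = star ((𝓕 f : L2) (-ξ)) := by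
  have key : (fun f : L2 => (𝓕 (conjL f) : L2)) = fun f : L2 => conjL (reflection (𝓕 f)) := by
    refine denseRange_toLp.equalizer ?_ ?_ ?_
    · exact (Lp.fourierTransformₗᵢ ℝ ℂ).continuous.comp conjL.continuous
    · exact conjL.continuous.comp
        (reflection.continuous.comp (Lp.fourierTransformₗᵢ ℝ ℂ).continuous)
    · funext φ
      set ψ : 𝓢(ℝ, ℂ) := SchwartzMap.postcompCLM Complex.conjCLE.toContinuousLinearMap φ with hψ
      have hψ' : ∀ x, ψ x = star (φ x) := fun x => rfl
      have h1 : conjL (φ.toLp 2 volume) = (ψ.toLp 2 volume : L2) := by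
        ext1
        filter_upwards [star_ae (φ.toLp 2 volume), SchwartzMap.coeFn_toLp φ 2 volume,
          SchwartzMap.coeFn_toLp ψ 2 volume] with x h3 h4 h5
        rw [conjL_apply, h3, h4, h5, hψ']
      simp only [Function.comp_apply]
      rw [h1, fourier_toLp, fourier_toLp]
      ext1
      have h2 := (Measure.measurePreserving_neg (volume : Measure ℝ)).quasiMeasurePreserving.ae
          (SchwartzMap.coeFn_toLp (𝓕 φ) 2 volume)
      filter_upwards [SchwartzMap.coeFn_toLp (𝓕 ψ) 2 volume, h2,
        star_ae (reflection ((𝓕 φ).toLp 2 volume)),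
        reflection_ae ((𝓕 φ).toLp 2 volume)] with ξ h3 h4 h5 h6
      rw [h3, conjL_apply, h5, h6, h4, fourier_conj_integral φ ψ hψ']
  have h := congrFun key f
  simp only [conjL_apply] at h
  rw [h]
  filter_upwards [star_ae (reflection (𝓕 f)), reflection_ae (𝓕 f)] with ξ h5 h6
  rw [h5, h6]

/-! ### The calculus of Fourier symbols -/

/-- `g` is obtained from `f` by multiplying the Fourier transform with the symbol `m`. -/
def Sym (m : ℝ → ℂ) (f g : L2) : Prop :=
  ∀ᵐ ξ : ℝ, (𝓕 g : L2) ξ = m (2 * Real.pi * ξ) * (𝓕 f : L2) ξ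

lemma hasFourierSymbol_toPartial_iff {T : L2 →L[ℂ] L2} {a : ℝ → ℂ} :
    HasFourierSymbol (toPartial T) a ↔ ∀ f : L2, Sym a f (T f) :=
  ⟨fun h f => h ⟨f, Submodule.mem_top⟩, fun h f => h f⟩

lemma fourier_injective {f g : L2} (h : (𝓕 f : L2) = 𝓕 g) : f = g :=
  (Lp.fourierTransformₗᵢ ℝ ℂ).injective h

lemma fourier_add_L2 (f g : L2) : (𝓕 (f + g) : L2) = 𝓕 f + 𝓕 g :=
  (Lp.fourierTransformₗᵢ ℝ ℂ).map_add f g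

lemma fourier_sub_L2 (f g : L2) : (𝓕 (f - g) : L2) = 𝓕 f - 𝓕 g :=
  (Lp.fourierTransformₗᵢ ℝ ℂ).map_sub f g

lemma fourier_smul_L2 (c : ℂ) (f : L2) : (𝓕 (c • f) : L2) = c • 𝓕 f :=
  (Lp.fourierTransformₗᵢ ℝ ℂ).map_smul c f

lemma norm_fourier_L2 (f : L2) : ‖(𝓕 f : L2)‖ = ‖f‖ := Lp.norm_fourier_eq f

lemma inner_fourier_L2 (f g : L2) : inner ℂ (𝓕 f : L2) (𝓕 g) = inner ℂ f g :=
  Lp.inner_fourier_eq f g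

lemma fourier_fourierInv_L2 (f : L2) : (𝓕 (𝓕⁻ f : L2) : L2) = f :=
  (Lp.fourierTransformₗᵢ ℝ ℂ).apply_symm_apply f

lemma quasiMeasurePreserving_mul {c : ℝ} (hc : c ≠ 0) :
    Measure.QuasiMeasurePreserving (fun x : ℝ => c * x) volume volume := by
  refine ⟨by fun_prop, ?_⟩
  rw [Real.map_volume_mul_left hc]
  exact Measure.smul_absolutelyContinuous

/-- Dilations by a nonzero factor preserve null sets in both directions, so the normalization λ =
2πξ does not affect almost-everywhere statements. -/
lemma ae_frequency_iff {P : ℝ → Prop} :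
    (∀ᵐ ξ : ℝ, P (2 * Real.pi * ξ)) ↔ ∀ᵐ x : ℝ, P x := by
  have h2 : (2 * Real.pi) ≠ 0 := by positivity
  refine ⟨fun h => ?_, fun h => (quasiMeasurePreserving_mul h2).ae h⟩
  filter_upwards [(quasiMeasurePreserving_mul (inv_ne_zero h2)).ae h] with x hx
  rwa [mul_inv_cancel_left₀ h2] at hx

namespace Sym

variable {m m' : ℝ → ℂ} {f f' g g' k : L2}

/-- The symbol determines the transform of the image. Most operator identities below are proved by
giving both sides the same symbol. -/
lemma unique (h : Sym m f g) (h' : Sym m f g') : g = g' := by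
  refine fourier_injective ?_
  ext1
  filter_upwards [h, h'] with ξ h1 h2
  rw [h1, h2]

lemma congr_ae (h : Sym m f g) (hm : ∀ᵐ x, m x = m' x) : Sym m' f g := by
  filter_upwards [h, ae_frequency_iff.2 hm] with ξ h1 h2
  rw [h1, h2]

lemma congr (h : Sym m f g) (hm : ∀ x, m x = m' x) : Sym m' f g :=
  h.congr_ae (ae_of_all _ hm)

lemma add (h : Sym m f g) (h' : Sym m f' g') : Sym m (f + f') (g + g') := by
  rw [Sym, fourier_add_L2, fourier_add_L2]
  filter_upwards [h, h', Lp.coeFn_add (𝓕 f : L2) (𝓕 f'), Lp.coeFn_add (𝓕 g : L2) (𝓕 g')]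
    with ξ h1 h2 h3 h4
  rw [h3, h4, Pi.add_apply, Pi.add_apply, h1, h2, mul_add]

lemma smul (h : Sym m f g) (c : ℂ) : Sym m (c • f) (c • g) := by
  rw [Sym, fourier_smul_L2, fourier_smul_L2]
  filter_upwards [h, Lp.coeFn_smul c (𝓕 f : L2), Lp.coeFn_smul c (𝓕 g : L2)] with ξ h1 h3 h4
  rw [h3, h4, Pi.smul_apply, Pi.smul_apply, h1]
  simp only [smul_eq_mul]; ring

lemma add_symbol (h : Sym m f g) (h' : Sym m' f g') : Sym (fun x => m x + m' x) f (g + g') := by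
  rw [Sym, fourier_add_L2]
  filter_upwards [h, h', Lp.coeFn_add (𝓕 g : L2) (𝓕 g')] with ξ h1 h2 h4
  rw [h4, Pi.add_apply, h1, h2, add_mul]

lemma sub_symbol (h : Sym m f g) (h' : Sym m' f g') : Sym (fun x => m x - m' x) f (g - g') := by
  rw [Sym, fourier_sub_L2]
  filter_upwards [h, h', Lp.coeFn_sub (𝓕 g : L2) (𝓕 g')] with ξ h1 h2 h4
  rw [h4, Pi.sub_apply, h1, h2, sub_mul]

lemma smul_symbol (h : Sym m f g) (c : ℂ) : Sym (fun x => c * m x) f (c • g) := by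
  rw [Sym, fourier_smul_L2]
  filter_upwards [h, Lp.coeFn_smul c (𝓕 g : L2)] with ξ h1 h4
  rw [h4, Pi.smul_apply, h1, smul_eq_mul]; ring

lemma one (f : L2) : Sym (fun _ => 1) f f := ae_of_all _ fun _ => (one_mul _).symm

lemma comp (h' : Sym m' g k) (h : Sym m f g) : Sym (fun x => m' x * m x) f k := by
  filter_upwards [h, h'] with ξ h1 h2
  rw [h2, h1]; ring

/-- The transform of `g` already contains the factor `m`, so cancelling it needs no division and
zeros of `m` are harmless. -/
lemma of_comp (h' : Sym (fun x => m' x * m x) f k) (h : Sym m f g) : Sym m' g k := by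
  filter_upwards [h, h'] with ξ h1 h2
  rw [h2, h1]; ring

/-- Plancherel moves the multiplier to the other factor as its conjugate. No boundedness is
involved, so this serves unbounded operators too. -/
lemma inner_eq (h : Sym m f g) (h' : Sym (fun x => star (m x)) f' g') :
    inner ℂ f' g = inner ℂ g' f := by
  rw [← inner_fourier_L2, ← inner_fourier_L2 g' f, inner_eq_integral, inner_eq_integral]
  refine integral_congr_ae ?_
  filter_upwards [h, h'] with ξ h1 h2
  rw [h1, h2, star_mul', star_star]
  ring

lemma translation (h : Sym m f g) (z : ℝ) :
    Sym m (KalmanSIS.translation z f) (KalmanSIS.translation z g) := by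
  filter_upwards [h, fourier_translation z f, fourier_translation z g] with ξ h1 h2 h3
  rw [h2, h3, h1]; ring

lemma star (h : Sym m f g) : Sym (fun x => star (m (-x))) (star f) (star g) := by
  have h0 := (Measure.measurePreserving_neg (volume : Measure ℝ)).quasiMeasurePreserving.ae h
  filter_upwards [h0, fourier_star f, fourier_star g] with ξ h1 h2 h3
  rw [h2, h3, h1, star_mul', mul_neg]

/-- Convergence in L² gives almost everywhere convergence of the transforms along a common
subsequence, and the relation is pointwise in frequency. No regularity of `m` is required. -/
lemma of_tendsto {F G : ℕ → L2} (h : ∀ i, Sym m (F i) (G i)) (hF : Tendsto F atTop (𝓝 f))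
    (hG : Tendsto G atTop (𝓝 g)) : Sym m f g := by
  have hF' : Tendsto (fun i => (𝓕 (F i) : L2)) atTop (𝓝 (𝓕 f)) :=
    ((Lp.fourierTransformₗᵢ ℝ ℂ).continuous.tendsto f).comp hF
  have hG' : Tendsto (fun i => (𝓕 (G i) : L2)) atTop (𝓝 (𝓕 g)) :=
    ((Lp.fourierTransformₗᵢ ℝ ℂ).continuous.tendsto g).comp hG
  obtain ⟨n1, hn1, hF1⟩ := (tendstoInMeasure_of_tendsto_Lp hF').exists_seq_tendsto_ae
  obtain ⟨n2, hn2, hG1⟩ := (tendstoInMeasure_of_tendsto_Lp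
    (hG'.comp hn1.tendsto_atTop)).exists_seq_tendsto_ae
  filter_upwards [hF1, hG1, ae_all_iff.2 h] with ξ h1 h2 h3
  refine tendsto_nhds_unique h2 ?_
  simp only [Function.comp_apply, h3]
  exact (h1.comp hn2.tendsto_atTop).const_mul _

lemma norm_le {c : ℝ} (h : Sym m f g) (hm : ∀ x, ‖m x‖ ≤ c) : ‖g‖ ≤ c * ‖f‖ := by
  rw [← norm_fourier_L2 g, ← norm_fourier_L2 f]
  refine norm_le_of_ae_le ?_
  filter_upwards [h] with ξ h1
  rw [h1, norm_mul]
  exact mul_le_mul_of_nonneg_right (hm _) (norm_nonneg _)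

end Sym

/-- Membership in the domain of a multiplication operator only requires a square integrable majorant
of the product. This gives the preimages under `G` in the Riccati equation and places Schwartz
functions in the domain of the gain. -/
lemma exists_sym_of_le {m : ℝ → ℂ} (hm : Measurable m) {f : L2} {u : ℝ → ℝ}
    (hu : MemLp u 2 volume) (h : ∀ᵐ ξ : ℝ, ‖m (2 * Real.pi * ξ) * (𝓕 f : L2) ξ‖ ≤ u ξ) :
    ∃ g, Sym m f g := by
  have hm' : Measurable fun ξ : ℝ => m (2 * Real.pi * ξ) := hm.comp (by fun_prop)
  have h1 : MemLp (fun ξ : ℝ => m (2 * Real.pi * ξ) * (𝓕 f : L2) ξ) 2 volume := by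
    refine MemLp.of_le_mul (c := 1) hu
      (hm'.aestronglyMeasurable.mul (Lp.aestronglyMeasurable _)) ?_
    filter_upwards [h] with ξ h2
    rw [one_mul]
    exact h2.trans (le_abs_self _)
  refine ⟨𝓕⁻ (h1.toLp _ : L2), ?_⟩
  rw [Sym, fourier_fourierInv_L2]
  exact h1.coeFn_toLp

/-- The bounded operator with the given bounded symbol. -/
def mul (m : ℝ → ℂ) : L2 →L[ℂ] L2 :=
  ((Lp.fourierTransformₗᵢ ℝ ℂ).symm.toContinuousLinearEquiv.toContinuousLinearMap).comp
    ((pointwiseMul fun ξ => m (2 * Real.pi * ξ)).comp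
      (Lp.fourierTransformₗᵢ ℝ ℂ).toContinuousLinearEquiv.toContinuousLinearMap)

lemma BoundedSymbol.scale {m : ℝ → ℂ} (hm : BoundedSymbol m) :
    BoundedSymbol fun ξ => m (2 * Real.pi * ξ) :=
  ⟨hm.1.comp (by fun_prop), hm.2.imp fun _ h x => h _⟩

lemma mul_sym {m : ℝ → ℂ} (hm : BoundedSymbol m) (f : L2) : Sym m f (mul m f) := by
  have h : (𝓕 (mul m f) : L2) = pointwiseMul (fun ξ => m (2 * Real.pi * ξ)) (𝓕 f) :=
    (Lp.fourierTransformₗᵢ ℝ ℂ).apply_symm_apply _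
  rw [Sym, h]
  exact pointwiseMul_ae hm.scale _

lemma Sym.mul_eq {m : ℝ → ℂ} (hm : BoundedSymbol m) {f g : L2} (h : Sym m f g) : mul m f = g :=
  (mul_sym hm f).unique h

lemma adjoint_sym {T : L2 →L[ℂ] L2} {m : ℝ → ℂ} (hT : ∀ f, Sym m f (T f)) (hm : BoundedSymbol m)
    (f : L2) : Sym (fun x => star (m x)) f (ContinuousLinearMap.adjoint T f) := by
  have hm' : BoundedSymbol fun x => star (m x) :=
    ⟨continuous_star.measurable.comp hm.1, hm.2.imp fun c h x => by simpa using h x⟩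
  have : ContinuousLinearMap.adjoint T f = mul (fun x => star (m x)) f := by
    refine ext_inner_right ℂ fun g => ?_
    rw [ContinuousLinearMap.adjoint_inner_left]
    exact (hT g).inner_eq (mul_sym hm' f)
  rw [this]
  exact mul_sym hm' f

/-! ### Norms and dominated convergence on the Fourier side -/

lemma norm_sq_eq_integral (f : L2) : ‖f‖ ^ 2 = ∫ x, ‖f x‖ ^ 2 := by
  have h := inner_eq_integral f f
  rw [inner_self_eq_norm_sq_to_K] at h
  have h2 : (∫ x, star (f x) * f x) = ((∫ x, ‖f x‖ ^ 2 : ℝ) : ℂ) := by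
    rw [← integral_complex_ofReal]
    refine integral_congr_ae (ae_of_all _ fun x => ?_)
    simp only [RCLike.star_def]
    rw [mul_comm, Complex.mul_conj, Complex.normSq_eq_norm_sq]
  rw [h2] at h
  exact Complex.ofReal_injective (by simpa using h)

/-- Dominated convergence for symbols. -/
lemma tendsto_of_symbols {ι : Type*} {l : Filter ι} [l.IsCountablyGenerated]
    {M : ι → ℝ → ℂ} {m d : ℝ → ℂ} {f g k : L2} {F : ι → L2} (hF : ∀ᶠ i in l, Sym (M i) f (F i))
    (hg : Sym m f g) (hk : Sym d f k) (c : ℝ)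
    (hle : ∀ᶠ i in l, ∀ x, ‖M i x - m x‖ ≤ c * (1 + ‖d x‖))
    (hlim : ∀ x, Tendsto (fun i => M i x) l (𝓝 (m x))) : Tendsto F l (𝓝 g) := by
  rw [tendsto_iff_norm_sub_tendsto_zero]
  have h0 : Tendsto (fun i => ‖F i - g‖ ^ 2) l (𝓝 0) := by
    have h1 : ∀ᶠ i in l, ∫ ξ : ℝ, ‖(M i (2 * Real.pi * ξ) - m (2 * Real.pi * ξ)) * (𝓕 f : L2) ξ‖ ^ 2
        = ‖F i - g‖ ^ 2 := by
      filter_upwards [hF] with i hi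
      rw [← norm_fourier_L2, norm_sq_eq_integral]
      refine integral_congr_ae ?_
      filter_upwards [hi.sub_symbol hg] with ξ h2
      rw [h2]
    refine Tendsto.congr' h1 ?_
    rw [show (0 : ℝ) = ∫ _ : ℝ, (0 : ℝ) by simp]
    -- The majorant may grow like `d`: a constant `d` treats bounded families, and `d` equal to the
    -- generator's symbol treats difference quotients of a semigroup.
    refine tendsto_integral_filter_of_dominated_convergence
      (fun ξ => (c * (‖(𝓕 f : L2) ξ‖ + ‖(𝓕 k : L2) ξ‖)) ^ 2) ?_ ?_ ?_ ?_
    · filter_upwards [hF] with i hi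
      have h3 : AEStronglyMeasurable (fun ξ => ‖(𝓕 (F i - g) : L2) ξ‖ ^ 2) volume :=
        (Lp.aestronglyMeasurable _).norm.pow 2
      refine h3.congr ?_
      filter_upwards [hi.sub_symbol hg] with ξ h2
      rw [h2]
    · filter_upwards [hle] with i hi
      filter_upwards [hk] with ξ h2
      rw [Real.norm_of_nonneg (by positivity), norm_mul, h2, norm_mul]
      refine pow_le_pow_left₀ (by positivity) ?_ 2
      refine (mul_le_mul_of_nonneg_right (hi _) (norm_nonneg _)).trans (le_of_eq ?_)
      ring
    · exact (((Lp.memLp (𝓕 f : L2)).norm.add (Lp.memLp (𝓕 k : L2)).norm).const_mul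
        c).integrable_sq
    · refine ae_of_all _ fun ξ => ?_
      have h4 := (((hlim (2 * Real.pi * ξ)).sub_const (m (2 * Real.pi * ξ))).mul_const
        ((𝓕 f : L2) ξ)).norm.pow 2
      simpa using h4
  have h5 := h0.sqrt
  simpa using h5

/-! ### Band-limited functions -/

/-- The indicator of the frequency band `[-n, n]`. -/
def cut (n : ℕ) : ℝ → ℂ := (Set.Icc (-(n : ℝ)) n).indicator 1

lemma cut_of_mem {n : ℕ} {x : ℝ} (h : |x| ≤ n) : cut n x = 1 :=
  Set.indicator_of_mem (Set.mem_Icc.2 (abs_le.1 h)) _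

lemma cut_of_notMem {n : ℕ} {x : ℝ} (h : (n : ℝ) < |x|) : cut n x = 0 :=
  Set.indicator_of_notMem (fun h' => absurd (abs_le.2 (Set.mem_Icc.1 h')) (not_le.2 h)) _

lemma cut_eq (n : ℕ) (x : ℝ) : cut n x = 0 ∧ (n : ℝ) < |x| ∨ cut n x = 1 ∧ |x| ≤ n := by
  rcases le_or_gt |x| n with h | h
  · exact Or.inr ⟨cut_of_mem h, h⟩
  · exact Or.inl ⟨cut_of_notMem h, h⟩

lemma cut_neg (n : ℕ) (x : ℝ) : cut n (-x) = cut n x := by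
  rcases le_or_gt |x| n with h | h
  · rw [cut_of_mem h, cut_of_mem (by rwa [abs_neg])]
  · rw [cut_of_notMem h, cut_of_notMem (by rwa [abs_neg])]

lemma star_cut (n : ℕ) (x : ℝ) : star (cut n x) = cut n x := by
  rcases cut_eq n x with ⟨h, -⟩ | ⟨h, -⟩ <;> simp [h]

lemma cut_mul_cut (n : ℕ) (x : ℝ) : cut n x * cut n x = cut n x := by
  rcases cut_eq n x with ⟨h, -⟩ | ⟨h, -⟩ <;> simp [h]

lemma norm_cut_le (n : ℕ) (x : ℝ) : ‖cut n x‖ ≤ 1 := by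
  rcases cut_eq n x with ⟨h, -⟩ | ⟨h, -⟩ <;> simp [h]

lemma measurable_cut (n : ℕ) : Measurable (cut n) := measurable_one.indicator measurableSet_Icc

lemma tendsto_cut (x : ℝ) : Tendsto (fun n => cut n x) atTop (𝓝 1) := by
  refine tendsto_const_nhds.congr' ?_
  filter_upwards [eventually_ge_atTop ⌈|x|⌉₊] with n hn
  exact (cut_of_mem ((Nat.le_ceil _).trans (Nat.cast_le.2 hn))).symm

lemma boundedSymbol_cut (n : ℕ) : BoundedSymbol (cut n) :=
  ⟨measurable_cut n, 1, norm_cut_le n⟩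

lemma boundedSymbol_cut_mul {m : ℝ → ℂ} (hm : Continuous m) (n : ℕ) :
    BoundedSymbol fun x => cut n x * m x := by
  refine ⟨(measurable_cut n).mul hm.measurable, ?_⟩
  obtain ⟨c, hc⟩ := (isCompact_Icc (a := -(n : ℝ)) (b := n)).exists_bound_of_continuousOn
    hm.continuousOn
  refine ⟨max c 0, fun x => ?_⟩
  rcases cut_eq n x with ⟨h, -⟩ | ⟨h, h'⟩
  · simp [h]
  · simp only [h, one_mul]
    exact (hc x (abs_le.1 h')).trans (le_max_left _ _)

/-- The spectral projection on the frequency band `[-n, n]`. -/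
def band (n : ℕ) : L2 →L[ℂ] L2 := mul (cut n)

/-- The operator with the symbol `m`, restricted to the frequency band `[-n, n]`. -/
def bandMul (n : ℕ) (m : ℝ → ℂ) : L2 →L[ℂ] L2 := mul fun x => cut n x * m x

lemma band_sym (n : ℕ) (f : L2) : Sym (cut n) f (band n f) := mul_sym (boundedSymbol_cut n) f

lemma bandMul_sym {m : ℝ → ℂ} (hm : Continuous m) (n : ℕ) (f : L2) :
    Sym (fun x => cut n x * m x) f (bandMul n m f) := mul_sym (boundedSymbol_cut_mul hm n) f

lemma sym_band_bandMul {m : ℝ → ℂ} (hm : Continuous m) (n : ℕ) (f : L2) :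
    Sym m (band n f) (bandMul n m f) :=
  ((bandMul_sym hm n f).congr fun _ => mul_comm _ _).of_comp (band_sym n f)

/-- `f` is band-limited to the frequencies in `[-n, n]`. -/
def BandLimited (n : ℕ) (f : L2) : Prop := Sym (cut n) f f

lemma bandLimited_band (n : ℕ) (f : L2) : BandLimited n (band n f) :=
  ((band_sym n f).congr fun x => (cut_mul_cut n x).symm).of_comp (band_sym n f)

lemma BandLimited.band_eq {n : ℕ} {f : L2} (h : BandLimited n f) : band n f = f :=
  Sym.mul_eq (boundedSymbol_cut n) h

lemma BandLimited.sym {n : ℕ} {f : L2} (h : BandLimited n f) {m : ℝ → ℂ} (hm : Continuous m) :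
    Sym m f (bandMul n m f) := by
  have := sym_band_bandMul hm n f
  rwa [h.band_eq] at this

lemma Sym.bandLimited {n : ℕ} {f g : L2} {m : ℝ → ℂ} (h : Sym m f g) (hf : BandLimited n f) :
    BandLimited n g :=
  ((h.comp hf).congr fun _ => mul_comm _ _).of_comp h

lemma Sym.band {m : ℝ → ℂ} {f g : L2} (h : Sym m f g) (n : ℕ) :
    Sym m (band n f) (band n g) :=
  (((band_sym n g).comp h).congr fun _ => mul_comm _ _).of_comp (band_sym n f)

/-- Band-limited functions are dense, and truncation commutes with every symbol. This is the
approximation behind all density and core arguments below. -/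
lemma tendsto_band (f : L2) : Tendsto (fun n => band n f) atTop (𝓝 f) := by
  refine tendsto_of_symbols (Eventually.of_forall fun n => band_sym n f) (Sym.one f) (Sym.one f) 1
    (Eventually.of_forall fun n x => ?_) tendsto_cut
  rcases cut_eq n x with ⟨h, -⟩ | ⟨h, -⟩ <;> norm_num [h]

lemma star_band (n : ℕ) (f : L2) : star (band n f) = band n (star f) := by
  refine (Sym.mul_eq (boundedSymbol_cut n) ((band_sym n f).star.congr fun x => ?_)).symm
  rw [cut_neg, star_cut]

/-! ### Integration of families of symbols -/

section integration

variable (n : ℕ)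

lemma neg_le_cast : -(n : ℝ) ≤ n := by
  have : (0 : ℝ) ≤ n := n.cast_nonneg
  linarith

lemma cut_mul_projIcc (u : ℝ → ℂ) (x : ℝ) :
    cut n x * u (Set.projIcc (-(n : ℝ)) n (neg_le_cast n) x) = cut n x * u x := by
  rcases cut_eq n x with ⟨h, -⟩ | ⟨h, h'⟩
  · simp [h]
  · rw [Set.projIcc_of_mem _ (abs_le.1 h')]

/-- A continuous symbol on a frequency band, applied to a fixed element of `L²(ℝ)`. -/
def bandApply (f : L2) : C(Set.Icc (-(n : ℝ)) n, ℂ) →L[ℂ] L2 :=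
  LinearMap.mkContinuous
    -- `Set.projIcc` extends `u` constantly outside the band, and `cut` erases the extension.
    { toFun := fun u => bandMul n (fun x => u (Set.projIcc _ _ (neg_le_cast n) x)) f
      map_add' := fun u v => by
        have h (w : C(Set.Icc (-(n : ℝ)) n, ℂ)) :
          Continuous fun x => w (Set.projIcc _ _ (neg_le_cast n) x) :=
          w.continuous.comp continuous_projIcc
        refine Sym.mul_eq (boundedSymbol_cut_mul (h (u + v)) n)
          (((bandMul_sym (h u) n f).add_symbol (bandMul_sym (h v) n f)).congr fun x => ?_)
        simp [mul_add]
      map_smul' := fun c u => by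
        have h (w : C(Set.Icc (-(n : ℝ)) n, ℂ)) :
          Continuous fun x => w (Set.projIcc _ _ (neg_le_cast n) x) :=
          w.continuous.comp continuous_projIcc
        refine Sym.mul_eq (boundedSymbol_cut_mul (h (c • u)) n)
          (((bandMul_sym (h u) n f).smul_symbol c).congr fun x => ?_)
        simp only [ContinuousMap.smul_apply, smul_eq_mul]
        ring }
    ‖f‖ fun u => by
      have h : Continuous fun x => u (Set.projIcc _ _ (neg_le_cast n) x) :=
          u.continuous.comp continuous_projIcc
      refine le_of_le_of_eq ((bandMul_sym h n f).norm_le (c := ‖u‖) fun x => ?_) (mul_comm _ _)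
      rw [norm_mul]
      exact (mul_le_of_le_one_left (norm_nonneg _) (norm_cut_le n x)).trans (u.norm_coe_le_norm _)

lemma bandApply_apply (f : L2) (m : ℝ → ℂ) (hm : Continuous m) :
    bandApply n f ⟨fun x => m x, hm.comp continuous_subtype_val⟩ = bandMul n m f := by
  refine (Sym.mul_eq (boundedSymbol_cut_mul (hm.comp
    (continuous_subtype_val.comp continuous_projIcc)) n) ?_)
  exact (bandMul_sym hm n f).congr fun x => (cut_mul_projIcc n m x).symm

/-- Joint continuity of a family of symbols. -/
lemma continuous_bandMul_apply {X : Type*} [TopologicalSpace X] {m : X → ℝ → ℂ}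
    (hm : Continuous fun p : X × ℝ => m p.1 p.2) (f : L2) :
    Continuous fun s => bandMul n (m s) f := by
  -- Because the band is compact, currying turns joint continuity into continuity for the sup norm,
  -- which dominates the L² norm of the result.
  let w : C(X × Set.Icc (-(n : ℝ)) n, ℂ) :=
    ⟨fun p => m p.1 p.2, hm.comp (by fun_prop : Continuous fun p : X × Set.Icc (-(n : ℝ)) n =>
      (p.1, (p.2 : ℝ)))⟩
  have h : (fun s => bandMul n (m s) f) = fun s => bandApply n f (w.curry s) := by
    funext s
    exact (bandApply_apply n f (m s) (hm.comp (by fun_prop : Continuous fun x : ℝ => (s, x)))).symm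
  rw [h]
  exact (bandApply n f).continuous.comp w.curry.continuous

/-- The fundamental theorem of calculus for a family of symbols. -/
lemma integral_bandMul_deriv {m m' : ℝ → ℝ → ℂ} (hd : ∀ s x, HasDerivAt (fun s => m s x) (m' s x) s)
    (hm : ∀ s, Continuous (m s)) (hm' : Continuous fun p : ℝ × ℝ => m' p.1 p.2) (f : L2) (a b : ℝ) :
    ∫ s in a..b, bandMul n (m' s) f = bandMul n (m b) f - bandMul n (m a) f := by
  let w : C(ℝ × Set.Icc (-(n : ℝ)) n, ℂ) :=
    ⟨fun p => m' p.1 p.2, hm'.comp (by fun_prop : Continuous fun p : ℝ × Set.Icc (-(n : ℝ)) n =>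
      (p.1, (p.2 : ℝ)))⟩
  let v (s : ℝ) : C(Set.Icc (-(n : ℝ)) n, ℂ) := ⟨fun x => m s x, (hm s).comp continuous_subtype_val⟩
  have h (s : ℝ) : bandMul n (m' s) f = bandApply n f (w.curry s) :=
    (bandApply_apply n f (m' s) (hm'.comp (by fun_prop : Continuous fun x : ℝ => (s, x)))).symm
  -- The integral takes place in the Banach space of continuous functions on the band. Evaluation at
  -- a frequency is continuous and linear, so the scalar fundamental theorem applies there.
  have h2 : ∫ s in a..b, w.curry s = v b - v a := by
    ext x
    have h3 := (ContinuousMap.evalCLM ℂ x).intervalIntegral_comp_comm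
      (w.curry.continuous.intervalIntegrable (μ := volume) a b)
    simp only [ContinuousMap.evalCLM_apply] at h3
    rw [← h3]
    refine intervalIntegral.integral_eq_sub_of_hasDerivAt (fun s _ => hd s x) ?_
    exact (hm'.comp (by fun_prop : Continuous fun s : ℝ => (s, (x : ℝ)))).intervalIntegrable _ _
  simp_rw [h]
  rw [(bandApply n f).intervalIntegral_comp_comm
      (w.curry.continuous.intervalIntegrable (μ := volume) a b), h2, map_sub,
    ← bandApply_apply n f (m b) (hm b), ← bandApply_apply n f (m a) (hm a)]

/-- Differentiation of a family of symbols. -/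
lemma hasDerivAt_bandMul {m m' : ℝ → ℝ → ℂ} (hd : ∀ s x, HasDerivAt (fun s => m s x) (m' s x) s)
    (hm : ∀ s, Continuous (m s)) (hm' : Continuous fun p : ℝ × ℝ => m' p.1 p.2) (f : L2) (s : ℝ) :
    HasDerivAt (fun s => bandMul n (m s) f) (bandMul n (m' s) f) s := by
  have hc := continuous_bandMul_apply n hm' f
  -- Differentiating the integral representation avoids estimating difference quotients uniformly in
  -- the frequency.
  have h1 := (hc.integral_hasStrictDerivAt 0 s).hasDerivAt.add_const (bandMul n (m 0) f)
  refine h1.congr_of_eventuallyEq (Eventually.of_forall fun t => ?_)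
  simp only
  rw [integral_bandMul_deriv n hd hm hm' f 0 t, sub_add_cancel]

end integration

/-! ### Maximal multiplication operators -/

lemma Sym.zero (m : ℝ → ℂ) : Sym m 0 0 := by
  have h : (𝓕 (0 : L2) : L2) = 0 := (Lp.fourierTransformₗᵢ ℝ ℂ).map_zero
  rw [Sym, h]
  exact ae_of_all _ fun ξ => by simp

/-- The (unbounded) operator with the symbol `m` and the largest possible domain. -/
def maxMul (m : ℝ → ℂ) : L2 →ₗ.[ℂ] L2 where
  domain :=
    { carrier := {f | ∃ g, Sym m f g}
      add_mem' := fun ⟨g, h⟩ ⟨g', h'⟩ => ⟨g + g', h.add h'⟩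
      zero_mem' := ⟨0, by simpa using (Sym.zero m)⟩
      smul_mem' := fun c _ ⟨g, h⟩ => ⟨c • g, h.smul c⟩ }
  toFun :=
    { toFun := fun f => f.2.choose
      map_add' := fun f g => (f + g).2.choose_spec.unique
        (f.2.choose_spec.add g.2.choose_spec)
      map_smul' := fun c f => (c • f).2.choose_spec.unique (f.2.choose_spec.smul c) }

lemma maxMul_sym (m : ℝ → ℂ) (f : (maxMul m).domain) : Sym m f (maxMul m f) :=
  Exists.choose_spec (p := fun g => Sym m f g) f.2

lemma mem_maxMul_graph {m : ℝ → ℂ} {f g : L2} : (f, g) ∈ (maxMul m).graph ↔ Sym m f g := by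
  rw [LinearPMap.mem_graph_iff]
  constructor
  · rintro ⟨x, rfl, h⟩
    rw [← show maxMul m x = g from h]
    exact maxMul_sym m x
  · intro h
    exact ⟨⟨f, g, h⟩, rfl, (maxMul_sym m ⟨f, g, h⟩).unique h⟩

lemma maxMul_isClosed (m : ℝ → ℂ) : (maxMul m).IsClosed := by
  refine IsSeqClosed.isClosed fun u x hu hx => ?_
  have hu' : ∀ i, Sym m (u i).1 (u i).2 := fun i => mem_maxMul_graph.1 (hu i)
  exact mem_maxMul_graph.2 (Sym.of_tendsto hu' ((continuous_fst.tendsto x).comp hx)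
    ((continuous_snd.tendsto x).comp hx))

/-- A restriction of `maxMul m` whose domain contains the band-limited functions has the closure
`maxMul m`. -/
lemma closure_eq_maxMul {T : L2 →ₗ.[ℂ] L2} {m : ℝ → ℂ}
    (hT : ∀ f : T.domain, Sym m f (T f)) (hd : ∀ n f, BandLimited n f → f ∈ T.domain) :
    T.IsClosable ∧ T.closure = maxMul m := by
  have hle : T ≤ maxMul m := by
    refine LinearPMap.le_of_le_graph ?_
    rintro ⟨f, g⟩ h
    obtain ⟨x, rfl, h⟩ := LinearPMap.mem_graph_iff _ |>.1 h
    rw [← show T x = g from h]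
    exact mem_maxMul_graph.2 (hT x)
  have hc : T.IsClosable := (maxMul_isClosed m).isClosable.leIsClosable hle
  refine ⟨hc, LinearPMap.eq_of_eq_graph (le_antisymm ?_ ?_)⟩
  · rw [← hc.graph_closure_eq_closure_graph]
    exact Submodule.topologicalClosure_minimal _ (LinearPMap.le_graph_of_le hle)
      (maxMul_isClosed m)
  · rintro ⟨f, g⟩ h
    have h := mem_maxMul_graph.1 h
    rw [← hc.graph_closure_eq_closure_graph]
    -- Truncating `f` and `g` to the same band keeps the pair on the graph of `T`, so band-limited
    -- functions form a core.
    refine mem_closure_of_tendsto ((tendsto_band f).prodMk_nhds (tendsto_band g))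
      (Eventually.of_forall fun n => ?_)
    have hb := hd n _ (bandLimited_band n f)
    have : T ⟨band n f, hb⟩ = band n g := (hT ⟨band n f, hb⟩).unique (h.band n)
    rw [← this]
    exact T.mem_graph ⟨band n f, hb⟩

lemma dense_of_bandLimited {s : Set L2} (hd : ∀ n f, BandLimited n f → f ∈ s) : Dense s :=
  fun f => mem_closure_of_tendsto (tendsto_band f)
    (Eventually.of_forall fun n => hd n _ (bandLimited_band n f))

lemma dense_maxMul_domain {m : ℝ → ℂ} (hm : Continuous m) :
    Dense ((maxMul m).domain : Set L2) :=
  dense_of_bandLimited fun _ _ h => ⟨_, h.sym hm⟩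

/-- Band-limited test functions identify each truncation of `g` with a bounded operator applied to
`f`; closedness of the symbol relation then removes the truncation. -/
lemma sym_of_weak {m : ℝ → ℂ} (hm : Continuous m) {f g : L2}
    (h : ∀ n w w', BandLimited n w → Sym (fun x => star (m x)) w w' →
      inner ℂ w g = inner ℂ w' f) : Sym m f g := by
  have key (n : ℕ) : Sym m (band n f) (band n g) := by
    have : band n g = bandMul n m f := by
      refine ext_inner_left ℂ fun w => ?_
      have h1 : Sym (fun x => star (m x)) (band n w)
          (bandMul n (fun x => star (m x)) w) := sym_band_bandMul (continuous_star.comp hm) n w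
      rw [(band_sym n g).inner_eq ((band_sym n w).congr fun x => (star_cut n x).symm),
        h n _ _ (bandLimited_band n w) h1]
      refine ((bandMul_sym hm n f).inner_eq (((bandMul_sym (continuous_star.comp hm) n w)).congr
        fun x => ?_)).symm
      simp [star_cut]
    rw [this]
    exact sym_band_bandMul hm n f
  exact Sym.of_tendsto key (tendsto_band f) (tendsto_band g)

/-- The adjoint of a maximal multiplication operator. -/
lemma maxMul_adjoint {m : ℝ → ℂ} (hm : Continuous m) :
    (maxMul m).adjoint = maxMul fun x => star (m x) := by
  have hdense := dense_maxMul_domain hm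
  refine LinearPMap.eq_of_eq_graph (Submodule.ext fun ⟨f, g⟩ => ?_)
  rw [LinearPMap.adjoint_graph_eq_graph_adjoint hdense, Submodule.mem_adjoint_iff,
    mem_maxMul_graph]
  constructor
  · intro h
    refine sym_of_weak (continuous_star.comp hm) fun n w w' hw hw' => ?_
    have := h w w' (mem_maxMul_graph.2 (hw'.congr fun x => star_star _))
    exact (sub_eq_zero.1 this).symm
  · intro h a b hab
    rw [mem_maxMul_graph] at hab
    exact sub_eq_zero.2 (h.inner_eq (hab.congr fun x => (star_star _).symm)).symm

/-! ### Functions with localized spectrum -/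

/-- A nonzero band-limited function whose spectrum is close to a given frequency: all symbols
that are small near this frequency are small on it. -/
lemma exists_localized (x₀ : ℝ) {U : Set ℝ} (hU : U ∈ 𝓝 x₀) :
    ∃ (n : ℕ) (f : L2), f ≠ 0 ∧ BandLimited n f ∧
      ∀ (m : ℝ → ℂ) (ε : ℝ) (g : L2), (∀ x ∈ U, ‖m x‖ ≤ ε) → Sym m f g → ‖g‖ ≤ ε * ‖f‖ := by
  obtain ⟨δ, hδ, hball⟩ := Metric.mem_nhds_iff.1 hU
  -- The transform of the packet is the indicator of this small interval. It stands in for the plane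
  -- wave of frequency `x₀`, which is not square integrable.
  set E : Set ℝ := (fun ξ => 2 * Real.pi * ξ) ⁻¹' Metric.ball x₀ δ with hE
  have hπ : 0 < 2 * Real.pi := by positivity
  have hEo : IsOpen E := Metric.isOpen_ball.preimage (by fun_prop)
  have hEne : E.Nonempty := ⟨x₀ / (2 * Real.pi), by
    simp only [hE, Set.mem_preimage]
    rw [mul_div_cancel₀ _ hπ.ne']
    exact Metric.mem_ball_self hδ⟩
  have hEsub : E ⊆ Metric.closedBall (x₀ / (2 * Real.pi)) (δ / (2 * Real.pi)) := by
    intro ξ hξ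
    simp only [hE, Set.mem_preimage, Metric.mem_ball, Real.dist_eq] at hξ
    rw [Metric.mem_closedBall, Real.dist_eq, le_div_iff₀ hπ]
    have h1 : ξ - x₀ / (2 * Real.pi) = (2 * Real.pi * ξ - x₀) / (2 * Real.pi) := by
      field_simp
    rw [h1, abs_div, abs_of_pos hπ, div_mul_cancel₀ _ hπ.ne']
    exact hξ.le
  have hEfin : volume E ≠ ∞ :=
    ((measure_mono hEsub).trans_lt (isCompact_closedBall _ _).measure_lt_top).ne
  have hEm : MeasurableSet E := hEo.measurableSet
  set u : L2 := indicatorConstLp 2 hEm hEfin (1 : ℂ) with hu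
  set f : L2 := 𝓕⁻ u with hf
  have hfu : (𝓕 f : L2) = u := fourier_fourierInv_L2 u
  have hae : ∀ᵐ ξ, (𝓕 f : L2) ξ = E.indicator (fun _ => (1 : ℂ)) ξ := by
    rw [hfu]; exact indicatorConstLp_coeFn
  obtain ⟨n, hn⟩ := exists_nat_ge (|x₀| + δ)
  refine ⟨n, f, ?_, ?_, ?_⟩
  · intro h0
    have h1 : ‖u‖ = 0 := by rw [← hfu, norm_fourier_L2, h0, norm_zero]
    rw [hu, norm_indicatorConstLp (by norm_num) (by norm_num)] at h1
    simp only [norm_one, one_mul] at h1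
    have h2 : volume.real E ≠ 0 := by
      rw [Measure.real, ENNReal.toReal_ne_zero]
      exact ⟨(hEo.measure_pos volume hEne).ne', hEfin⟩
    exact h2 ((Real.rpow_eq_zero measureReal_nonneg (by norm_num)).1 h1)
  · filter_upwards [hae] with ξ h1
    rw [h1]
    by_cases hξ : ξ ∈ E
    · have h2 : |2 * Real.pi * ξ| ≤ n := by
        have h3 : |2 * Real.pi * ξ - x₀| < δ := hξ
        have h4 := abs_sub_abs_le_abs_sub (2 * Real.pi * ξ) x₀
        linarith
      rw [cut_of_mem h2, one_mul]
    · simp [hξ]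
  · intro m ε g hε hg
    rw [← norm_fourier_L2 g, ← norm_fourier_L2 f]
    refine norm_le_of_ae_le ?_
    filter_upwards [hae, hg] with ξ h1 h2
    rw [h2, h1]
    by_cases hξ : ξ ∈ E
    · rw [norm_mul]
      exact mul_le_mul_of_nonneg_right (hε _ (hball hξ)) (norm_nonneg _)
    · simp [hξ]

/-- A symbol is bounded by the norm of the operator. -/
lemma norm_symbol_le {T : L2 →L[ℂ] L2} {m : ℝ → ℂ} (hm : Continuous m)
    (h : ∀ n f, BandLimited n f → Sym m f (T f)) (x : ℝ) : ‖m x‖ ≤ ‖T‖ := by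
  refine le_of_forall_pos_le_add fun ε hε => ?_
  have hU : {y | ‖m y - m x‖ ≤ ε} ∈ 𝓝 x := by
    have := (hm.tendsto x).sub_const (m x) |>.norm
    simp only [sub_self, norm_zero] at this
    filter_upwards [this.eventually (gt_mem_nhds hε)] with y hy using le_of_lt hy
  -- By continuity of `m`, the operator acts on this packet as the scalar `m x` up to a relative
  -- error ε.
  obtain ⟨n, f, hf0, hfn, hf⟩ := exists_localized x hU
  have h1 : Sym (fun y => m y - m x * 1) f (T f - m x • f) :=
    (h n f hfn).sub_symbol ((Sym.one f).smul_symbol (m x))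
  have h2 := hf _ ε _ (fun y hy => by simpa using hy) h1
  have h3 : ‖m x • f‖ ≤ ‖T f‖ + ‖T f - m x • f‖ := by
    have := norm_sub_norm_le (m x • f) (T f)
    rw [norm_sub_rev] at this; linarith
  rw [norm_smul] at h3
  have h4 := T.le_opNorm f
  have h5 : 0 < ‖f‖ := norm_pos_iff.2 hf0
  nlinarith

/-- Continuous symbols are unique. -/
lemma symbol_unique {m m' : ℝ → ℂ} (hm : Continuous m) (hm' : Continuous m')
    (h : ∀ n f, BandLimited n f → ∃ g, Sym m f g ∧ Sym m' f g) : m = m' := by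
  funext x
  have h0 : ‖m x - m' x‖ ≤ ‖(0 : L2 →L[ℂ] L2)‖ := by
    refine norm_symbol_le (m := fun x => m x - m' x) (hm.sub hm') (fun n f hf => ?_) x
    obtain ⟨g, h1, h2⟩ := h n f hf
    simpa using h1.sub_symbol h2
  rw [norm_zero] at h0
  exact sub_eq_zero.1 (norm_le_zero_iff.1 h0)

/-! ### Strongly continuous semigroups -/

lemma real_smul_eq (r : ℝ) (f : L2) : r • f = (r : ℂ) • f :=
  RCLike.real_smul_eq_coe_smul (K := ℂ) r f

namespace IsC0Semigroup

variable {S : ℝ → L2 →L[ℂ] L2} (hS : IsC0Semigroup S)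
include hS

/-- If the norms were unbounded near zero, there would be times tending to zero with norms tending
to infinity, although `S t f` converges for each `f` along them. This contradicts uniform
boundedness. -/
lemma exists_bound_near_zero : ∃ δ > 0, ∃ c, ∀ t, 0 ≤ t → t ≤ δ → ‖S t‖ ≤ c := by
  by_contra! h
  have h' (k : ℕ) : ∃ t : ℝ, 0 ≤ t ∧ t ≤ 1 / ((k : ℝ) + 1) ∧ (k : ℝ) < ‖S t‖ := by
    obtain ⟨t, h1, h2, h3⟩ := h (1 / ((k : ℝ) + 1)) (by positivity) k
    exact ⟨t, h1, h2, h3⟩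
  choose t ht0 ht1 ht2 using h'
  have htend : Tendsto t atTop (𝓝 0) :=
    squeeze_zero ht0 ht1 tendsto_one_div_add_atTop_nhds_zero_nat
  have hlim (f : L2) : Tendsto (fun k => S (t k) f) atTop (𝓝 f) := by
    have h0 : Tendsto (fun t => S t f) (𝓝[≥] 0) (𝓝 f) := by
      rw [← Set.Ioi_insert, nhdsWithin_insert]
      refine Tendsto.sup ?_ (hS.tendsto f)
      rw [tendsto_pure_left]
      intro s hs
      have : S 0 f = f := by rw [hS.zero]; rfl
      rw [this]
      exact mem_of_mem_nhds hs
    exact h0.comp (tendsto_nhdsWithin_iff.2 ⟨htend, Eventually.of_forall ht0⟩)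
  obtain ⟨c, hc⟩ := banach_steinhaus (g := fun k => S (t k)) fun f => by
    obtain ⟨c, hc⟩ := (Metric.isBounded_range_of_tendsto _ (hlim f)).exists_norm_le
    exact ⟨c, fun k => hc _ ⟨k, rfl⟩⟩
  obtain ⟨k, hk⟩ := exists_nat_gt c
  exact absurd ((ht2 k).trans_le (hc k)) (not_lt.2 hk.le)

lemma exists_bound (T : ℝ) : ∃ c, ∀ t, 0 ≤ t → t ≤ T → ‖S t‖ ≤ c := by
  obtain ⟨δ, hδ, c, hc⟩ := hS.exists_bound_near_zero
  have key (k : ℕ) : ∃ c, ∀ t, 0 ≤ t → t ≤ k * δ → ‖S t‖ ≤ c := by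
    induction k with
    | zero => exact ⟨c, fun t h1 h2 => hc t h1 (by simp at h2; linarith)⟩
    | succ k ih =>
      obtain ⟨c', hc'⟩ := ih
      refine ⟨max c (c' * c), fun t h1 h2 => ?_⟩
      rcases le_total t δ with h3 | h3
      · exact (hc t h1 h3).trans (le_max_left _ _)
      · have h4 : S t = (S (t - δ)).comp (S δ) := by
          rw [← hS.add _ _ (by linarith) hδ.le, sub_add_cancel]
        have h5 : t - δ ≤ k * δ := by push_cast at h2; linarith
        rw [h4]
        refine ((S (t - δ)).opNorm_comp_le _).trans (le_trans ?_ (le_max_right _ _))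
        have h6 := hc' _ (by linarith) h5
        exact mul_le_mul h6 (hc δ hδ.le le_rfl) (norm_nonneg _) ((norm_nonneg _).trans h6)
  obtain ⟨k, hk⟩ := exists_nat_ge (T / δ)
  obtain ⟨c, hc⟩ := key k
  exact ⟨c, fun t h1 h2 => hc t h1 (h2.trans ((div_le_iff₀ hδ).1 hk))⟩

lemma add_apply {s t : ℝ} (hs : 0 ≤ s) (ht : 0 ≤ t) (f : L2) : S (s + t) f = S s (S t f) := by
  rw [hS.add s t hs ht]; rfl

lemma zero_apply (f : L2) : S 0 f = f := by rw [hS.zero]; rfl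

lemma tendsto_Ici (f : L2) : Tendsto (fun t => S t f) (𝓝[≥] 0) (𝓝 f) := by
  rw [← Set.Ioi_insert, nhdsWithin_insert]
  refine Tendsto.sup ?_ (hS.tendsto f)
  rw [tendsto_pure_left]
  intro s hs
  rw [hS.zero_apply]
  exact mem_of_mem_nhds hs

lemma continuousOn_apply (f : L2) : ContinuousOn (fun t => S t f) (Set.Ici 0) := by
  intro t₀ ht₀
  rw [Metric.continuousWithinAt_iff]
  intro ε hε
  obtain ⟨c, hc⟩ := hS.exists_bound (t₀ + 1)
  have hc0 : 0 ≤ c := (norm_nonneg _).trans (hc 0 le_rfl (by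
    have : (0 : ℝ) ≤ t₀ := ht₀
    linarith))
  have h1 := Metric.tendsto_nhdsWithin_nhds.1 (hS.tendsto_Ici f) (ε / (c + 1)) (by positivity)
  obtain ⟨δ, hδ, h1⟩ := h1
  have key : ∀ s t : ℝ, 0 ≤ s → s ≤ t → s ≤ t₀ + 1 → t - s < δ → dist (S t f) (S s f) < ε := by
    intro s t hs hst hs1 hd
    have h2 : S t f = S s (S (t - s) f) := by
      rw [← hS.add_apply hs (by linarith)]
      congr 2
      ring
    have h3 := h1 (show t - s ∈ Set.Ici 0 by simpa using hst)
      (by rw [Real.dist_eq, sub_zero, abs_of_nonneg (by linarith)]; exact hd)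
    rw [h2, dist_eq_norm, ← map_sub]
    refine ((S s).le_opNorm _).trans_lt ?_
    rw [dist_eq_norm] at h3
    have h4 := mul_le_mul (hc s hs hs1) h3.le (norm_nonneg _) hc0
    refine h4.trans_lt ?_
    rw [mul_div_assoc', div_lt_iff₀ (by positivity)]
    nlinarith
  refine ⟨min δ 1, by positivity, fun t ht hd => ?_⟩
  have ht : 0 ≤ t := ht
  have ht₀ : 0 ≤ t₀ := ht₀
  rw [Real.dist_eq] at hd
  have hd1 := abs_lt.1 (hd.trans_le (min_le_left _ _))
  have hd2 := abs_lt.1 (hd.trans_le (min_le_right _ _))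
  rcases le_total t t₀ with h | h
  · rw [dist_comm]
    exact key t t₀ ht h (by linarith) (by linarith)
  · exact key t₀ t ht₀ h (by linarith) (by linarith)

/-- Joint continuity. -/
lemma continuousOn_uncurry :
    ContinuousOn (fun p : ℝ × L2 => S p.1 p.2) (Set.Ici 0 ×ˢ Set.univ) := by
  rintro ⟨t₀, f₀⟩ ⟨ht₀, -⟩
  obtain ⟨c, hc⟩ := hS.exists_bound (t₀ + 1)
  have h1 : Tendsto (fun p : ℝ × L2 => S p.1 f₀) (𝓝[Set.Ici 0 ×ˢ Set.univ] (t₀, f₀))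
      (𝓝 (S t₀ f₀)) := by
    refine Tendsto.comp (hS.continuousOn_apply f₀ t₀ ht₀)
      (tendsto_nhdsWithin_iff.2 ⟨?_, ?_⟩)
    · exact (continuous_fst.tendsto _).mono_left nhdsWithin_le_nhds
    · filter_upwards [self_mem_nhdsWithin] with p hp using hp.1
  have h2 : Tendsto (fun p : ℝ × L2 => S p.1 (p.2 - f₀)) (𝓝[Set.Ici 0 ×ˢ Set.univ] (t₀, f₀))
      (𝓝 0) := by
    have h3 : Tendsto (fun p : ℝ × L2 => c * ‖p.2 - f₀‖) (𝓝[Set.Ici 0 ×ˢ Set.univ] (t₀, f₀))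
        (𝓝 0) := by
      have h4 : Continuous fun p : ℝ × L2 => c * ‖p.2 - f₀‖ := by fun_prop
      have := h4.tendsto (t₀, f₀)
      simp only [sub_self, norm_zero, mul_zero] at this
      exact this.mono_left nhdsWithin_le_nhds
    refine squeeze_zero_norm' ?_ h3
    have h5 : ∀ᶠ p : ℝ × L2 in 𝓝[Set.Ici 0 ×ˢ Set.univ] (t₀, f₀), p.1 < t₀ + 1 :=
      ((continuous_fst.tendsto (t₀, f₀)).mono_left nhdsWithin_le_nhds).eventually_lt_const
        (by simp)
    filter_upwards [self_mem_nhdsWithin, h5] with p hp hp'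
    exact (S p.1).le_of_opNorm_le (hc _ hp.1 hp'.le) _
  have h6 := h1.add h2
  rw [add_zero] at h6
  refine h6.congr fun p => ?_
  rw [← map_add, add_sub_cancel]

variable {A : L2 →ₗ.[ℂ] L2} (hA : IsGenerator S A)
include hA

lemma mem_graph_apply {f h : L2} (hf : (f, h) ∈ A.graph) {t : ℝ} (ht : 0 ≤ t) :
    (S t f, S t h) ∈ A.graph := by
  rw [hA] at hf ⊢
  refine (((S t).continuous.tendsto h).comp hf).congr' ?_
  filter_upwards [self_mem_nhdsWithin] with s hs
  have hs : (0 : ℝ) ≤ s := le_of_lt hs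
  rw [Function.comp_apply, map_smul, map_sub, ← hS.add_apply ht hs, ← hS.add_apply hs ht,
    add_comm t s]

/-- The semigroup law moves the derivative at zero to time `t`. The right derivative suffices,
because a continuous function with vanishing right derivative is constant. -/
lemma hasDerivWithinAt {f h : L2} (hf : (f, h) ∈ A.graph) {t : ℝ} (ht : 0 ≤ t) :
    HasDerivWithinAt (fun t => S t f) (S t h) (Set.Ici t) t := by
  have h1 := hS.mem_graph_apply hA hf ht
  rw [hA] at h1
  rw [← hasDerivWithinAt_Ioi_iff_Ici, hasDerivWithinAt_iff_tendsto_slope' (by simp)]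
  have h2 : Tendsto (fun s : ℝ => s - t) (𝓝[>] t) (𝓝[>] 0) := by
    refine tendsto_nhdsWithin_iff.2 ⟨?_, ?_⟩
    · have : Continuous fun s : ℝ => s - t := by fun_prop
      have := this.tendsto t
      rw [sub_self] at this
      exact this.mono_left nhdsWithin_le_nhds
    · filter_upwards [self_mem_nhdsWithin] with s hs
      simpa using hs
  refine (h1.comp h2).congr' ?_
  filter_upwards [self_mem_nhdsWithin] with s hs
  have hs : t < s := hs
  rw [Function.comp_apply, ← hS.add_apply (by linarith) ht, sub_add_cancel, slope_def_module]
  exact (RCLike.real_smul_eq_coe_smul (K := ℂ) _ _).symm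

/-- Classical solutions of the evolution equation are given by the semigroup. -/
lemma eq_of_classical {y : ℝ → L2} {T : ℝ} (hT : 0 ≤ T) (hy : ContinuousOn y (Set.Icc 0 T))
    (hd : ∀ s ∈ Set.Ico 0 T, ∃ h, (y s, h) ∈ A.graph ∧ HasDerivWithinAt y h (Set.Ici s) s) :
    y T = S T (y 0) := by
  have hcont : ContinuousOn (fun s => S (T - s) (y s)) (Set.Icc 0 T) := by
    have h1 : ContinuousOn (fun s => (T - s, y s)) (Set.Icc 0 T) :=
      (by fun_prop : Continuous fun s : ℝ => T - s).continuousOn.prodMk hy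
    exact hS.continuousOn_uncurry.comp h1 fun s hs => ⟨by simpa using hs.2, trivial⟩
  -- Along a solution, propagating `y s` up to the fixed time `T` gives the same vector for every
  -- `s`.
  have hder : ∀ s ∈ Set.Ico 0 T,
      HasDerivWithinAt (fun s => S (T - s) (y s)) 0 (Set.Ici s) s := by
    intro s hs
    obtain ⟨h, hg, hdy⟩ := hd s hs
    have hg := (hA _ _).1 hg
    rw [← hasDerivWithinAt_Ioi_iff_Ici, hasDerivWithinAt_iff_tendsto_slope' (by simp)] at hdy ⊢
    have h2 : Tendsto (fun r : ℝ => r - s) (𝓝[>] s) (𝓝[>] 0) := by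
      refine tendsto_nhdsWithin_iff.2 ⟨?_, ?_⟩
      · have : Continuous fun r : ℝ => r - s := by fun_prop
        have := this.tendsto s
        rw [sub_self] at this
        exact this.mono_left nhdsWithin_le_nhds
      · filter_upwards [self_mem_nhdsWithin] with r hr
        simpa using hr
    have h3 := (hdy.sub (hg.comp h2)).norm
    rw [sub_self, norm_zero] at h3
    obtain ⟨c, hc⟩ := hS.exists_bound T
    have h3' := h3.const_mul c
    rw [mul_zero] at h3'
    refine squeeze_zero_norm' ?_ h3'
    filter_upwards [self_mem_nhdsWithin,
      nhdsWithin_le_nhds (eventually_lt_nhds hs.2 : ∀ᶠ r in 𝓝 s, r < T)] with r hr hrT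
    have hr : s < r := hr
    have h4 : S (T - s) (y s) = S (T - r) (S (r - s) (y s)) := by
      rw [← hS.add_apply (by linarith) (by linarith)]
      congr 2
      ring
    -- Factoring out `S (T - r)` leaves only difference quotients based at `y s`. The uniform norm
    -- bound handles the moving factor, so no differentiability of the semigroup at `y r` is needed.
    have h5 : slope (fun s => S (T - s) (y s)) s r = S (T - r) (slope y s r -
        (((r - s)⁻¹ : ℝ) : ℂ) • (S (r - s) (y s) - y s)) := by
      rw [slope_def_module, slope_def_module, h4, real_smul_eq, real_smul_eq, ← smul_sub, map_smul,
        map_sub, map_sub, map_sub]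
      congr 1
      abel
    rw [h5]
    exact (S (T - r)).le_of_opNorm_le (hc _ (by linarith) (by linarith [hs.1])) _
  have h6 := constant_of_has_deriv_right_zero hcont hder T ⟨hT, le_rfl⟩
  simpa [hS.zero_apply] using h6

end IsC0Semigroup

/-! ### Semigroups of multiplication operators -/

/-- The semigroup with the symbol `exp (t a)`. -/
def mulSemigroup (a : ℝ → ℂ) (t : ℝ) : L2 →L[ℂ] L2 :=
  -- The real part of `a` is only bounded above, so the exponential at a negative time could be
  -- unbounded; such times are replaced by zero.
  mul fun x => Complex.exp ((max t 0 : ℝ) * a x)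

section mulSemigroup

variable {a : ℝ → ℂ} (ha : Continuous a) {ω : ℝ} (hω : ∀ x, (a x).re ≤ ω)
include ha hω

omit ha in
lemma norm_exp_mul_le {t : ℝ} (ht : 0 ≤ t) (x : ℝ) :
    ‖Complex.exp (t * a x)‖ ≤ Real.exp (ω * t) := by
  rw [Complex.norm_exp, Complex.re_ofReal_mul, mul_comm]
  exact Real.exp_le_exp.2 (mul_le_mul_of_nonneg_right (hω x) ht)

lemma boundedSymbol_exp_mul {t : ℝ} (ht : 0 ≤ t) :
    BoundedSymbol fun x => Complex.exp (t * a x) :=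
  ⟨by have := ha.measurable; fun_prop, _, norm_exp_mul_le hω ht⟩

lemma mulSemigroup_sym {t : ℝ} (ht : 0 ≤ t) (f : L2) :
    Sym (fun x => Complex.exp (t * a x)) f (mulSemigroup a t f) := by
  rw [mulSemigroup, max_eq_left ht]
  exact mul_sym (boundedSymbol_exp_mul ha hω ht) f

lemma norm_mulSemigroup_le {t : ℝ} (ht : 0 ≤ t) : ‖mulSemigroup a t‖ ≤ Real.exp (ω * t) :=
  ContinuousLinearMap.opNorm_le_bound _ (Real.exp_pos _).le fun f =>
    (mulSemigroup_sym ha hω ht f).norm_le (norm_exp_mul_le hω ht)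

lemma mulSemigroup_isC0Semigroup : IsC0Semigroup (mulSemigroup a) where
  zero := by
    ext1 f
    refine (mulSemigroup_sym ha hω le_rfl f).unique ((Sym.one f).congr fun x => ?_)
    simp
  add s t hs ht := by
    ext1 f
    refine (mulSemigroup_sym ha hω (add_nonneg hs ht) f).unique
      (((mulSemigroup_sym ha hω hs _).comp (mulSemigroup_sym ha hω ht f)).congr fun x => ?_)
    rw [← Complex.exp_add]
    congr 1
    push_cast; ring
  tendsto f := by
    refine tendsto_of_symbols (l := 𝓝[>] (0 : ℝ)) (M := fun t x => Complex.exp (t * a x)) (m := fun _ => 1)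
      ?_ (Sym.one f) (Sym.one f) (Real.exp |ω| + 1) ?_ fun x => ?_
    · filter_upwards [self_mem_nhdsWithin] with t ht
      exact mulSemigroup_sym ha hω (le_of_lt ht) f
    · filter_upwards [self_mem_nhdsWithin, nhdsWithin_le_nhds (eventually_lt_nhds zero_lt_one)]
        with t ht ht1 x
      have ht : 0 < t := ht
      have h1 := norm_exp_mul_le hω ht.le x
      have h2 : Real.exp (ω * t) ≤ Real.exp |ω| :=
        Real.exp_le_exp.2 (by nlinarith [le_abs_self ω, abs_nonneg ω])
      have h3 := norm_sub_le (Complex.exp (t * a x)) 1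
      rw [norm_one] at h3 ⊢
      have := Real.exp_pos |ω|
      nlinarith
    · have h : Continuous fun t : ℝ => Complex.exp (t * a x) := by fun_prop
      have := h.tendsto 0
      simp only [Complex.ofReal_zero, zero_mul, Complex.exp_zero] at this
      exact this.mono_left nhdsWithin_le_nhds

-- The mean value inequality along the segment from 0 to `t * a x` gives a bound uniform in `t ≤ 1`.
-- It is the majorant, with `d = a`, for differentiating the semigroup at zero.
omit ha in
lemma norm_exp_sub_one_div_le {t : ℝ} (ht : 0 < t) (ht1 : t ≤ 1) (x : ℝ) :
    ‖((t⁻¹ : ℝ) : ℂ) * (Complex.exp (t * a x) - 1)‖ ≤ Real.exp |ω| * ‖a x‖ := by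
  have h1 : ∀ u ∈ Set.Icc (0 : ℝ) 1,
      HasDerivWithinAt (fun u : ℝ => Complex.exp (u * (t * a x)))
        (Complex.exp (u * (t * a x)) * (t * a x)) (Set.Icc 0 1) u := by
    intro u _
    have h2 : HasDerivAt (fun u : ℝ => (u : ℂ) * (t * a x)) (1 * (t * a x)) u :=
      (Complex.ofRealCLM.hasDerivAt (x := u)).mul_const _
    rw [one_mul] at h2
    exact h2.cexp.hasDerivWithinAt
  have h3 := norm_image_sub_le_of_norm_deriv_le_segment_01' h1 (C := Real.exp |ω| * (t * ‖a x‖))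
    fun u hu => by
      rw [norm_mul, norm_mul, Complex.norm_real, Real.norm_of_nonneg ht.le]
      refine mul_le_mul_of_nonneg_right ?_ (by positivity)
      rw [← mul_assoc, ← Complex.ofReal_mul]
      refine (norm_exp_mul_le hω (mul_nonneg hu.1 ht.le) x).trans (Real.exp_le_exp.2 ?_)
      have h4 : u * t ≤ 1 := mul_le_one₀ hu.2.le ht.le ht1
      have h5 : 0 ≤ u * t := mul_nonneg hu.1 ht.le
      nlinarith [le_abs_self ω, abs_nonneg ω]
  simp only [Complex.ofReal_one, one_mul, Complex.ofReal_zero, zero_mul, Complex.exp_zero] at h3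
  rw [norm_mul, Complex.norm_real, Real.norm_of_nonneg (by positivity)]
  refine (mul_le_mul_of_nonneg_left h3 (by positivity)).trans (le_of_eq ?_)
  field_simp

omit ha hω in
lemma tendsto_exp_sub_one_div (x : ℝ) :
    Tendsto (fun t : ℝ => ((t⁻¹ : ℝ) : ℂ) * (Complex.exp (t * a x) - 1)) (𝓝[>] 0) (𝓝 (a x)) := by
  have h2 : HasDerivAt (fun u : ℝ => (u : ℂ) * a x) (1 * a x) 0 :=
    (Complex.ofRealCLM.hasDerivAt (x := (0 : ℝ))).mul_const _
  have h3 := h2.cexp.hasDerivWithinAt (s := Set.Ioi 0)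
  rw [hasDerivWithinAt_iff_tendsto_slope' (by simp)] at h3
  simp only [Complex.ofReal_zero, zero_mul, Complex.exp_zero, one_mul] at h3
  refine h3.congr fun t => ?_
  rw [slope_def_module]
  simp

lemma mulSemigroup_isGenerator : IsGenerator (mulSemigroup a) (maxMul a) := by
  intro f h
  have hsym {t : ℝ} (ht : 0 < t) : Sym (fun x => ((t⁻¹ : ℝ) : ℂ) * (Complex.exp (t * a x) - 1)) f
      (((t⁻¹ : ℝ) : ℂ) • (mulSemigroup a t f - f)) :=
    ((mulSemigroup_sym ha hω ht.le f).sub_symbol (Sym.one f)).smul_symbol _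
  rw [mem_maxMul_graph]
  constructor
  · intro hf
    refine tendsto_of_symbols (l := 𝓝[>] (0 : ℝ)) (M := fun t x => ((t⁻¹ : ℝ) : ℂ) * (Complex.exp (t * a x) - 1))
      ?_ hf hf (Real.exp |ω| + 1) ?_ fun x => tendsto_exp_sub_one_div x
    · filter_upwards [self_mem_nhdsWithin] with t ht using hsym ht
    · filter_upwards [self_mem_nhdsWithin, nhdsWithin_le_nhds (eventually_lt_nhds zero_lt_one)]
        with t ht ht1 x
      have h1 := norm_exp_sub_one_div_le hω ht ht1.le x
      have h2 := norm_sub_le (((t⁻¹ : ℝ) : ℂ) * (Complex.exp (t * a x) - 1)) (a x)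
      have := Real.exp_pos |ω|
      nlinarith [norm_nonneg (a x)]
  · intro hlim
    -- Conversely, an L² limit of the difference quotients is their almost everywhere limit along a
    -- subsequence of times, and pointwise that limit can only be multiplication by `a`.
    have h1 : Tendsto (fun k : ℕ => 1 / ((k : ℝ) + 1)) atTop (𝓝[>] 0) :=
      tendsto_nhdsWithin_iff.2 ⟨tendsto_one_div_add_atTop_nhds_zero_nat,
        Eventually.of_forall fun k => by simp only [Set.mem_Ioi]; positivity⟩
    have h2 := ((Lp.fourierTransformₗᵢ ℝ ℂ).continuous.tendsto h).comp (hlim.comp h1)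
    obtain ⟨ns, hns, h3⟩ := (tendstoInMeasure_of_tendsto_Lp h2).exists_seq_tendsto_ae
    filter_upwards [h3, ae_all_iff.2 fun k : ℕ => hsym (t := 1 / ((k : ℝ) + 1)) (by positivity)]
      with ξ h4 h5
    refine tendsto_nhds_unique h4 ?_
    have h6 := ((tendsto_exp_sub_one_div (a := a) (2 * Real.pi * ξ)).comp
      (h1.comp hns.tendsto_atTop)).mul_const ((𝓕 f : L2) ξ)
    refine h6.congr fun i => ?_
    exact (h5 (ns i)).symm

lemma generatesStable_maxMul (h : ω < 0) : GeneratesStable (maxMul a) := by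
  refine ⟨mulSemigroup a, mulSemigroup_isC0Semigroup ha hω, mulSemigroup_isGenerator ha hω,
    1, -ω, by linarith, fun t ht => ?_⟩
  rw [one_mul, neg_mul, neg_neg]
  exact norm_mulSemigroup_le ha hω ht

end mulSemigroup

/-! ### Generators with a continuous symbol -/

section generator

variable {A : L2 →ₗ.[ℂ] L2} {S : ℝ → L2 →L[ℂ] L2} {a : ℝ → ℂ} (hS : IsC0Semigroup S)
  (hgen : IsGenerator S A) (hdense : Dense (A.domain : Set L2)) (ha : Continuous a)
  (hsym : HasFourierSymbol A a)
include hS hgen hdense ha hsym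

/-- Duality: for band-limited `w` and `f` in the domain, the pairing of exp((T - s) ā) w with `S s
f` has zero derivative in `s`. Comparing s = 0 with s = T gives the symbol on the domain, and
density extends it to all of L². -/
lemma semigroup_sym {T : ℝ} (hT : 0 ≤ T) (f : L2) :
    Sym (fun x => Complex.exp (T * a x)) f (S T f) := by
  have hc : Continuous fun x => Complex.exp (T * a x) := by fun_prop
  have key (n : ℕ) (f : A.domain) :
      band n (S T f) = bandMul n (fun x => Complex.exp (T * a x)) f := by
    refine ext_inner_left ℂ fun w => ?_
    let W : ℝ → ℝ → ℂ := fun s x => Complex.exp ((T - s : ℝ) * star (a x))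
    let W' : ℝ → ℝ → ℂ := fun s x => -star (a x) * Complex.exp ((T - s : ℝ) * star (a x))
    have hstar : Continuous fun x => star (a x) := continuous_star.comp ha
    have hW (s : ℝ) : Continuous (W s) := by fun_prop
    have hW' : Continuous fun p : ℝ × ℝ => W' p.1 p.2 := by fun_prop
    have hd (s x : ℝ) : HasDerivAt (fun s => W s x) (W' s x) s := by
      have h1 : HasDerivAt (fun s : ℝ => ((T - s : ℝ) : ℂ)) (((-1 : ℝ)) : ℂ) s :=
        ((hasDerivAt_id s).const_sub T).ofReal_comp
      convert! (h1.mul_const (star (a x))).cexp using 1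
      simp only [W']; push_cast; ring
    have hdW (s : ℝ) := hasDerivAt_bandMul n hd hW hW' w s
    have hconst := constant_of_has_deriv_right_zero (a := 0) (b := T)
      (f := fun s => inner ℂ (bandMul n (W s) w) (S s f)) ?_ ?_ T ⟨hT, le_rfl⟩
    · simp only [hS.zero_apply] at hconst
      have h1 : Sym (cut n) w (bandMul n (W T) w) :=
        (bandMul_sym (hW T) n w).congr fun x => by simp [W]
      have h2 := (band_sym n (S T f)).inner_eq (h1.comp (Sym.one w) |>.congr fun x => by
        rw [star_cut, mul_one])
      rw [h2, hconst]
      refine (((bandMul_sym hc n (f : L2)).inner_eq ((bandMul_sym (hW 0) n w).congr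
        fun x => ?_))).symm
      simp only [W, star_mul', star_cut, sub_zero]
      congr 1
      simp [← Complex.exp_conj]
    · exact ContinuousOn.inner (fun s _ => (hdW s).continuousAt.continuousWithinAt)
        ((hS.continuousOn_apply f).mono fun s hs => hs.1)
    · intro s hs
      have h1 := (hS.hasDerivWithinAt hgen (A.mem_graph f) hs.1)
      have h2 := (hdW s).hasDerivWithinAt (s := Set.Ici s)
      have h3 := h2.inner ℂ h1
      convert! h3 using 1
      have h4 := hS.mem_graph_apply hgen (A.mem_graph f) hs.1
      obtain ⟨x, hx1, hx2⟩ := (LinearPMap.mem_graph_iff _).1 h4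
      have h5 : Sym a (S s f) (S s (A f)) := by
        rw [← show (x : L2) = S s f from hx1, ← show A x = S s (A f) from hx2]
        exact hsym x
      have hW's : Continuous (W' s) := by fun_prop
      have h6 : Sym (fun x => star (a x)) (bandMul n (W s) w) ((-1 : ℂ) • bandMul n (W' s) w) := by
        refine Sym.of_comp (((bandMul_sym hW's n w).smul_symbol (-1)).congr fun x => ?_)
          (bandMul_sym (hW s) n w)
        simp only [W, W']; ring
      rw [h5.inner_eq h6, neg_one_smul, inner_neg_left, neg_add_cancel]
  have key2 (n : ℕ) (f : L2) : band n (S T f) = bandMul n (fun x => Complex.exp (T * a x)) f := by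
    have hclosed : IsClosed {f : L2 | band n (S T f) =
        bandMul n (fun x => Complex.exp (T * a x)) f} :=
      isClosed_eq ((band n).continuous.comp (S T).continuous) (bandMul n _).continuous
    have h1 := closure_minimal (fun f hf => key n ⟨f, hf⟩) hclosed
    rw [hdense.closure_eq] at h1
    exact h1 (Set.mem_univ f)
  refine Sym.of_tendsto (fun n => ?_) (tendsto_band f) (tendsto_band (S T f))
  rw [key2]
  exact sym_band_bandMul hc n f

/-- The bounded operator `S 1` has the continuous symbol exp(a), so the modulus exp(Re a) is at most
its norm at every frequency. -/
lemma exists_re_symbol_le : ∃ ω : ℝ, ∀ x, (a x).re ≤ ω := by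
  refine ⟨Real.log ‖S 1‖, fun x => ?_⟩
  have h := norm_symbol_le (T := S 1) (m := fun x => Complex.exp ((1 : ℝ) * a x)) (by fun_prop)
    (fun n f _ => semigroup_sym hS hgen hdense ha hsym zero_le_one f) x
  rw [Complex.norm_exp, Complex.re_ofReal_mul, one_mul] at h
  exact (Real.le_log_iff_exp_le ((Real.exp_pos _).trans_le h)).2 h

/-- A generator with a continuous symbol has the maximal domain. -/
lemma generator_eq_maxMul : A = maxMul a := by
  obtain ⟨ω, hω⟩ := exists_re_symbol_le hS hgen hdense ha hsym
  refine LinearPMap.eq_of_eq_graph (Submodule.ext fun ⟨f, h⟩ => ?_)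
  -- Both graphs consist of the limits of difference quotients, and the two semigroups agree at
  -- positive times.
  rw [hgen f h, mulSemigroup_isGenerator ha hω f h]
  refine tendsto_congr' ?_
  filter_upwards [self_mem_nhdsWithin] with t ht
  rw [(semigroup_sym hS hgen hdense ha hsym (le_of_lt ht) f).unique
    (mulSemigroup_sym ha hω (le_of_lt ht) f)]

end generator

/-! ### Stabilizability in the frequency domain -/

lemma eventually_norm_sub_le {m : ℝ → ℂ} (hm : Continuous m) (x₀ : ℝ) {ε : ℝ} (hε : 0 < ε) :
    ∀ᶠ x in 𝓝 x₀, ‖m x - m x₀‖ ≤ ε := by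
  have h := ((hm.tendsto x₀).sub_const (m x₀)).norm
  rw [sub_self, norm_zero] at h
  filter_upwards [h.eventually_lt_const hε] with x hx using hx.le

/-- The frequency-domain (Hautus) test for exponential stabilizability. -/
lemma GeneratesStable.symbol_dichotomy {a b : ℝ → ℂ} (ha : Continuous a) (hb : Continuous b)
    {R F : L2 →L[ℂ] L2} (hR : ∀ f, Sym b f (R f)) (hRb : BoundedSymbol b)
    (h : GeneratesStable (((R.comp F : L2 →L[ℂ] L2) : L2 →ₗ[ℂ] L2) +ᵥ maxMul a)) :
    ∃ δ > 0, ∀ x, (a x).re ≤ -δ ∨ δ ≤ ‖b x‖ := by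
  obtain ⟨S, hS, hgen, M, ω, hω, hM⟩ := h
  have hM0 : 0 ≤ M := by
    have := (norm_nonneg _).trans (hM 0 le_rfl)
    simpa using this
  -- A packet near `x₀` is almost an eigenvector of the adjoint closed loop with eigenvalue the
  -- conjugate of `μ`, where Re μ ≥ 0. The defect is about the negative part of Re a plus |b| ‖F‖,
  -- and stability forbids it to be too small.
  have key (x₀ : ℝ) : 1 ≤ M / ω * (max 0 (-(a x₀).re) + ‖b x₀‖ * ‖F‖) := by
    refine le_of_forall_pos_le_add fun ε' hε' => ?_
    obtain ⟨ε, hε, hεε'⟩ : ∃ ε > 0, M / ω * (ε + ε * ‖F‖) ≤ ε' := by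
      refine ⟨ε' / (M / ω * (1 + ‖F‖) + 1), by positivity, ?_⟩
      have h1 : 0 < M / ω * (1 + ‖F‖) + 1 := by positivity
      calc M / ω * (ε' / (M / ω * (1 + ‖F‖) + 1) + ε' / (M / ω * (1 + ‖F‖) + 1) * ‖F‖)
          = ε' * ((M / ω * (1 + ‖F‖)) / (M / ω * (1 + ‖F‖) + 1)) := by ring
        _ ≤ ε' * 1 := by
            refine mul_le_mul_of_nonneg_left ?_ hε'.le
            rw [div_le_one h1]; linarith
        _ = ε' := mul_one _
    -- The point of the closed right half-plane nearest to `a x₀`: the damping factor exp(-μt) stays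
    -- bounded, and the distance to `a x₀` is the negative part of its real part.
    set μ : ℂ := ((max (a x₀).re 0 : ℝ) : ℂ) + (a x₀).im * Complex.I with hμ
    have hμre : μ.re = max (a x₀).re 0 := by simp [hμ]
    have hdist : ‖a x₀ - μ‖ = max 0 (-(a x₀).re) := by
      have h1 : a x₀ - μ = (((a x₀).re - max (a x₀).re 0 : ℝ) : ℂ) := by
        apply Complex.ext <;> simp [hμ]
      rw [h1, Complex.norm_real, Real.norm_eq_abs]
      rcases le_total (a x₀).re 0 with h2 | h2
      · rw [max_eq_right h2, sub_zero, abs_of_nonpos h2, max_eq_right (by linarith)]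
      · rw [max_eq_left h2, sub_self, abs_zero, max_eq_left (by linarith)]
    obtain ⟨n, g, hg0, hgn, hg⟩ := exists_localized x₀
      ((eventually_norm_sub_le ha x₀ hε).and (eventually_norm_sub_le hb x₀ hε))
    have hsa : Continuous fun x => star (a x) := continuous_star.comp ha
    set g' := bandMul n (fun x => star (a x)) g
    have hg' : Sym (fun x => star (a x)) g g' := hgn.sym hsa
    set Rg := ContinuousLinearMap.adjoint R g
    have hRg : Sym (fun x => star (b x)) g Rg := adjoint_sym hR hRb g
    have h1 : ‖g' - star μ • g‖ ≤ (max 0 (-(a x₀).re) + ε) * ‖g‖ := by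
      refine hg _ _ _ ?_ (hg'.sub_symbol ((Sym.one g).smul_symbol (star μ)))
      intro x hx
      rw [mul_one, ← star_sub, norm_star, ← hdist]
      calc ‖a x - μ‖ = ‖(a x₀ - μ) + (a x - a x₀)‖ := by congr 1; ring
        _ ≤ _ := (norm_add_le _ _).trans (add_le_add le_rfl hx.1)
    have h2 : ‖Rg‖ ≤ (‖b x₀‖ + ε) * ‖g‖ := by
      refine hg _ _ _ ?_ hRg
      intro x hx
      rw [norm_star]
      calc ‖b x‖ = ‖b x₀ + (b x - b x₀)‖ := by congr 1; ring
        _ ≤ _ := (norm_add_le _ _).trans (add_le_add le_rfl hx.2)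
    set η := max 0 (-(a x₀).re) + ε + (‖b x₀‖ + ε) * ‖F‖ with hη
    have hη0 : 0 ≤ η := by positivity
    have hgdom : g ∈ (maxMul a).domain := ⟨_, hgn.sym ha⟩
    set T := ((R.comp F : L2 →L[ℂ] L2) : L2 →ₗ[ℂ] L2) +ᵥ maxMul a with hT
    have hgraph : (g, T ⟨g, hgdom⟩) ∈ T.graph := T.mem_graph ⟨g, hgdom⟩
    set k := T ⟨g, hgdom⟩
    have hderiv {t : ℝ} (ht : 0 ≤ t) : inner ℂ g (S t k) =
        μ * inner ℂ g (S t g) + (inner ℂ (g' - star μ • g) (S t g) + inner ℂ Rg (F (S t g))) := by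
      have h3 := hS.mem_graph_apply hgen hgraph ht
      obtain ⟨y, hy1, hy2⟩ := (LinearPMap.mem_graph_iff _).1 h3
      have hy1 : (y : L2) = S t g := hy1
      have hy2 : T y = S t k := hy2
      obtain ⟨z, h5, h4⟩ : ∃ z, Sym a (S t g) z ∧ S t k = R (F (S t g)) + z :=
        ⟨maxMul a ⟨y, y.2⟩, hy1 ▸ maxMul_sym a ⟨y, y.2⟩, by rw [← hy2, ← hy1]; rfl⟩
      rw [h4, inner_add_right, h5.inner_eq hg', ← ContinuousLinearMap.adjoint_inner_left,
        inner_sub_left, inner_smul_left]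
      simp only [RCLike.star_def, RCLike.conj_conj]
      ring
    have herr {t : ℝ} (ht : 0 ≤ t) : ‖inner ℂ (g' - star μ • g) (S t g) + inner ℂ Rg (F (S t g))‖ ≤
        η * M * ‖g‖ ^ 2 * Real.exp (-(ω * t)) := by
      have h3 : ‖S t g‖ ≤ M * Real.exp (-(ω * t)) * ‖g‖ := (S t).le_of_opNorm_le (hM t ht) g
      have h4 := norm_inner_le_norm (𝕜 := ℂ) (g' - star μ • g) (S t g)
      have h5 := norm_inner_le_norm (𝕜 := ℂ) Rg (F (S t g))
      have h6 : ‖F (S t g)‖ ≤ ‖F‖ * (M * Real.exp (-(ω * t)) * ‖g‖) :=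
        (F.le_opNorm _).trans (mul_le_mul_of_nonneg_left h3 (norm_nonneg _))
      have h7 := mul_le_mul h1 h3 (norm_nonneg _) (by positivity)
      have h8 := mul_le_mul h2 h6 (norm_nonneg _) (by positivity)
      calc _ ≤ _ := norm_add_le _ _
        _ ≤ _ := add_le_add (h4.trans h7) (h5.trans h8)
        _ = _ := by rw [hη]; ring
    -- This function starts at ‖g‖² and tends to zero, while its derivative is at most ηM‖g‖²
    -- exp(-ωt). Integrating over all times gives ‖g‖² ≤ ηM‖g‖²/ω.
    set ψ : ℝ → ℂ := fun t => Complex.exp (-(μ * t)) * inner ℂ g (S t g) with hψ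
    have hexp (t : ℝ) : HasDerivAt (fun t : ℝ => Complex.exp (-(μ * t)))
        (Complex.exp (-(μ * t)) * (-(μ * 1))) t :=
      ((Complex.ofRealCLM.hasDerivAt (x := t)).const_mul μ).neg.cexp
    have hψd {t : ℝ} (ht : 0 ≤ t) : HasDerivWithinAt ψ (Complex.exp (-(μ * t)) *
        (inner ℂ (g' - star μ • g) (S t g) + inner ℂ Rg (F (S t g)))) (Set.Ici t) t := by
      have h3 : HasDerivWithinAt (fun t => inner ℂ g (S t g)) (inner ℂ g (S t k)) (Set.Ici t) t := by
        have := (hasDerivWithinAt_const t (Set.Ici t) g).inner ℂ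
          (hS.hasDerivWithinAt hgen hgraph ht)
        simpa using this
      convert! (hexp t).hasDerivWithinAt.mul h3 using 1
      rw [hderiv ht]
      ring
    have hnexp {t : ℝ} (ht : 0 ≤ t) : ‖Complex.exp (-(μ * t))‖ ≤ 1 := by
      rw [Complex.norm_exp, Real.exp_le_one_iff]
      have : 0 ≤ μ.re := hμre ▸ le_max_right _ _
      simp only [Complex.neg_re, Complex.mul_re, Complex.ofReal_re, Complex.ofReal_im, mul_zero,
        sub_zero, Left.neg_nonpos_iff]
      positivity
    have hψ0 : ψ 0 = (‖g‖ ^ 2 : ℝ) := by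
      simp [hψ, hS.zero_apply]
    have hbound {t : ℝ} (ht : 0 ≤ t) : ‖g‖ ^ 2 ≤
        η * M * ‖g‖ ^ 2 / ω * (1 - Real.exp (-(ω * t))) + M * Real.exp (-(ω * t)) * ‖g‖ ^ 2 := by
      have hcont : ContinuousOn (fun t => ψ t - ψ 0) (Set.Icc 0 t) := by
        have h3 : ContinuousOn (fun t => inner ℂ g (S t g)) (Set.Icc 0 t) :=
          continuousOn_const.inner ((hS.continuousOn_apply g).mono fun s hs => hs.1)
        exact (ContinuousOn.mul (fun s _ => (hexp s).continuousAt.continuousWithinAt) h3).sub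
          continuousOn_const
      have hB (s : ℝ) : HasDerivAt (fun s => η * M * ‖g‖ ^ 2 / ω * (1 - Real.exp (-(ω * s))))
          (η * M * ‖g‖ ^ 2 * Real.exp (-(ω * s))) s := by
        have h3 := ((((hasDerivAt_id s).const_mul ω).neg.exp.const_sub 1).const_mul
          (η * M * ‖g‖ ^ 2 / ω))
        convert! h3 using 1
        simp only [id]
        field_simp
        rfl
      have h4 := image_norm_le_of_norm_deriv_right_le_deriv_boundary' hcont
        (f' := fun s => Complex.exp (-(μ * s)) *
          (inner ℂ (g' - star μ • g) (S s g) + inner ℂ Rg (F (S s g))))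
        (fun s hs => (hψd hs.1).sub_const _)
        (B := fun s => η * M * ‖g‖ ^ 2 / ω * (1 - Real.exp (-(ω * s)))) (by simp)
        (fun s _ => (hB s).continuousAt.continuousWithinAt)
        (fun s _ => (hB s).hasDerivWithinAt) (fun s hs => by
          rw [norm_mul]
          exact (mul_le_of_le_one_left (norm_nonneg _) (hnexp hs.1)).trans (herr hs.1))
        (x := t) ⟨ht, le_rfl⟩
      have h5 : ‖ψ t‖ ≤ M * Real.exp (-(ω * t)) * ‖g‖ ^ 2 := by
        rw [hψ, norm_mul]
        refine (mul_le_of_le_one_left (norm_nonneg _) (hnexp ht)).trans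
          ((norm_inner_le_norm _ _).trans ?_)
        have h3 : ‖S t g‖ ≤ M * Real.exp (-(ω * t)) * ‖g‖ := (S t).le_of_opNorm_le (hM t ht) g
        nlinarith [norm_nonneg g]
      have h6 : ‖ψ 0‖ = ‖g‖ ^ 2 := by
        rw [hψ0, Complex.norm_real, Real.norm_of_nonneg (by positivity)]
      have h7 := norm_sub_norm_le (ψ 0) (ψ t)
      rw [norm_sub_rev] at h7
      linarith
    have hlim : ‖g‖ ^ 2 ≤ η * M * ‖g‖ ^ 2 / ω := by
      have h3 : Tendsto (fun t : ℝ => Real.exp (-(ω * t))) atTop (𝓝 0) :=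
        Real.tendsto_exp_neg_atTop_nhds_zero.comp (tendsto_id.const_mul_atTop hω)
      have h4 := ((h3.const_sub 1).const_mul (η * M * ‖g‖ ^ 2 / ω)).add
        ((h3.const_mul M).mul_const (‖g‖ ^ 2))
      simp only [sub_zero, mul_one, mul_zero, zero_mul, add_zero] at h4
      refine ge_of_tendsto h4 ?_
      filter_upwards [eventually_ge_atTop 0] with t ht using hbound ht
    have hg2 : 0 < ‖g‖ ^ 2 := by positivity
    have h9 : 1 ≤ M / ω * η := by
      by_contra! hlt
      have : M / ω * η * ‖g‖ ^ 2 < 1 * ‖g‖ ^ 2 := mul_lt_mul_of_pos_right hlt hg2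
      have h10 : η * M * ‖g‖ ^ 2 / ω = M / ω * η * ‖g‖ ^ 2 := by ring
      linarith
    have h11 : M / ω * η = M / ω * (max 0 (-(a x₀).re) + ‖b x₀‖ * ‖F‖) +
      M / ω * (ε + ε * ‖F‖) := by rw [hη]; ring
    linarith
  set K := M / ω with hK
  have hK0 : 0 ≤ K := by positivity
  have hF : 0 ≤ ‖F‖ := norm_nonneg F
  -- If both alternatives failed at `x`, the right side of `key` would be at most Kδ(1 + ‖F‖) =
  -- K/(2(K + 1)) < 1/2.
  refine ⟨1 / (2 * (K + 1) * (1 + ‖F‖)), by positivity, fun x => ?_⟩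
  by_contra! hcon
  set δ := 1 / (2 * (K + 1) * (1 + ‖F‖)) with hδ
  have hδ0 : 0 < δ := by positivity
  have h1 := key x
  have h2 : max 0 (-(a x).re) ≤ δ := max_le hδ0.le (by linarith [hcon.1])
  have h3 : ‖b x‖ * ‖F‖ ≤ δ * ‖F‖ := mul_le_mul_of_nonneg_right hcon.2.le hF
  have h4 : δ * (2 * (K + 1) * (1 + ‖F‖)) = 1 := by
    rw [hδ]; field_simp
  have h5 := mul_le_mul_of_nonneg_left (add_le_add h2 h3) hK0
  nlinarith [mul_nonneg hδ0.le hF, mul_nonneg (mul_nonneg hδ0.le hF) hK0, mul_nonneg hδ0.le hK0]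

/-! ### The symbols of the plant -/

namespace IsProperRational

variable {φ : ℝ → ℂ} (h : IsProperRational φ)
include h

lemma continuous : Continuous φ := by
  obtain ⟨num, den, -, -, hd, hφ⟩ := h
  have : φ = fun x : ℝ => num.eval (x : ℂ) / den.eval (x : ℂ) := funext hφ
  rw [this]
  exact Continuous.div (num.continuous.comp Complex.continuous_ofReal)
    (den.continuous.comp Complex.continuous_ofReal) hd

lemma ne_zero (x : ℝ) : φ x ≠ 0 := by
  obtain ⟨num, den, -, hn, hd, hφ⟩ := h
  rw [hφ]
  exact div_ne_zero (hn x) (hd x)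

end IsProperRational

lemma BoundedSymbol.star {m : ℝ → ℂ} (hm : BoundedSymbol m) :
    BoundedSymbol fun x => star (m x) :=
  ⟨continuous_star.measurable.comp hm.1, hm.2.imp fun c h x => by simpa using h x⟩

namespace Plant

variable {p : Plant} (hp : p.Admissible)
include hp

lemma Admissible.continuous_symB : Continuous p.symB := hp.rational_B.continuous
lemma Admissible.continuous_symC : Continuous p.symC := hp.rational_C.continuous
lemma Admissible.continuous_symG : Continuous p.symG := hp.rational_G.continuous

lemma Admissible.B_sym (f : L2) : Sym p.symB f (p.B f) :=
  hasFourierSymbol_toPartial_iff.1 hp.symbol_B f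
lemma Admissible.C_sym (f : L2) : Sym p.symC f (p.C f) :=
  hasFourierSymbol_toPartial_iff.1 hp.symbol_C f
lemma Admissible.G_sym (f : L2) : Sym p.symG f (p.G f) :=
  hasFourierSymbol_toPartial_iff.1 hp.symbol_G f

lemma Admissible.norm_symC_le (x : ℝ) : ‖p.symC x‖ ≤ ‖p.C‖ :=
  norm_symbol_le hp.continuous_symC (fun _ f _ => hp.C_sym f) x
lemma Admissible.norm_symB_le (x : ℝ) : ‖p.symB x‖ ≤ ‖p.B‖ :=
  norm_symbol_le hp.continuous_symB (fun _ f _ => hp.B_sym f) x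
lemma Admissible.norm_symG_le (x : ℝ) : ‖p.symG x‖ ≤ ‖p.G‖ :=
  norm_symbol_le hp.continuous_symG (fun _ f _ => hp.G_sym f) x

lemma Admissible.boundedSymbol_B : BoundedSymbol p.symB :=
  ⟨hp.continuous_symB.measurable, _, hp.norm_symB_le⟩
lemma Admissible.boundedSymbol_C : BoundedSymbol p.symC :=
  ⟨hp.continuous_symC.measurable, _, hp.norm_symC_le⟩
lemma Admissible.boundedSymbol_G : BoundedSymbol p.symG :=
  ⟨hp.continuous_symG.measurable, _, hp.norm_symG_le⟩

lemma Admissible.adjoint_B_sym (f : L2) :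
    Sym (fun x => star (p.symB x)) f (ContinuousLinearMap.adjoint p.B f) :=
  adjoint_sym hp.B_sym hp.boundedSymbol_B f
lemma Admissible.adjoint_C_sym (f : L2) :
    Sym (fun x => star (p.symC x)) f (ContinuousLinearMap.adjoint p.C f) :=
  adjoint_sym hp.C_sym hp.boundedSymbol_C f
lemma Admissible.adjoint_G_sym (f : L2) :
    Sym (fun x => star (p.symG x)) f (ContinuousLinearMap.adjoint p.G f) :=
  adjoint_sym hp.G_sym hp.boundedSymbol_G f

lemma Admissible.symC_ne_zero (x : ℝ) : p.symC x ≠ 0 := hp.rational_C.ne_zero x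
lemma Admissible.symB_ne_zero (x : ℝ) : p.symB x ≠ 0 := hp.rational_B.ne_zero x
lemma Admissible.symG_ne_zero (x : ℝ) : p.symG x ≠ 0 := hp.rational_G.ne_zero x

lemma Admissible.A_eq : p.A = maxMul p.symA :=
  generator_eq_maxMul hp.semigroup hp.generator hp.dense_A hp.continuous_symA hp.symbol_A

lemma Admissible.adjoint_A_eq : p.A.adjoint = maxMul fun x => star (p.symA x) := by
  rw [hp.A_eq, maxMul_adjoint hp.continuous_symA]

lemma Admissible.S_sym {t : ℝ} (ht : 0 ≤ t) (f : L2) :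
    Sym (fun x => Complex.exp (t * p.symA x)) f (p.S t f) :=
  semigroup_sym hp.semigroup hp.generator hp.dense_A hp.continuous_symA hp.symbol_A ht f

lemma Admissible.exists_re_symA_le : ∃ ω : ℝ, ∀ x, (p.symA x).re ≤ ω :=
  exists_re_symbol_le hp.semigroup hp.generator hp.dense_A hp.continuous_symA hp.symbol_A

lemma Admissible.adjoint_S_sym {t : ℝ} (ht : 0 ≤ t) (f : L2) :
    Sym (fun x => Complex.exp (t * star (p.symA x))) f
      (ContinuousLinearMap.adjoint (p.S t) f) := by
  obtain ⟨ω, hω⟩ := hp.exists_re_symA_le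
  refine (adjoint_sym (hp.S_sym ht) (boundedSymbol_exp_mul hp.continuous_symA hω ht) f).congr
    fun x => ?_
  simp [← Complex.exp_conj]

/-! ### The scalar Riccati equation -/

omit hp

/-- The coefficient `|C|² / |G|²` of the scalar Riccati equation. -/
def quadCoeff (p : Plant) (x : ℝ) : ℝ := ‖p.symC x‖ ^ 2 * (‖p.symG x‖ ^ 2)⁻¹

/-- The decay rate of the closed loop at the frequency `x`. -/
def decayRate (p : Plant) (x : ℝ) : ℝ :=
  √((p.symA x).re ^ 2 + ‖p.symB x‖ ^ 2 * p.quadCoeff x)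

/-- The nonnegative solution of the scalar Riccati equation. -/
def riccatiSymbol (p : Plant) (x : ℝ) : ℝ := ((p.symA x).re + p.decayRate x) / p.quadCoeff x

include hp

lemma Admissible.normB_pos (x : ℝ) : 0 < ‖p.symB x‖ := norm_pos_iff.2 (hp.symB_ne_zero x)
lemma Admissible.normC_pos (x : ℝ) : 0 < ‖p.symC x‖ := norm_pos_iff.2 (hp.symC_ne_zero x)
lemma Admissible.normG_pos (x : ℝ) : 0 < ‖p.symG x‖ := norm_pos_iff.2 (hp.symG_ne_zero x)

lemma Admissible.quadCoeff_pos (x : ℝ) : 0 < p.quadCoeff x := by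
  have := hp.normC_pos x
  have := hp.normG_pos x
  unfold quadCoeff
  positivity

lemma Admissible.continuous_quadCoeff : Continuous p.quadCoeff := by
  have h1 := hp.continuous_symC
  have h2 := hp.continuous_symG
  have h3 : ∀ x, ‖p.symG x‖ ^ 2 ≠ 0 := fun x => (pow_pos (hp.normG_pos x) 2).ne'
  unfold quadCoeff
  fun_prop (disch := assumption)

lemma Admissible.continuous_decayRate : Continuous p.decayRate := by
  have h1 := hp.continuous_symA
  have h2 := hp.continuous_symB
  have h3 := hp.continuous_quadCoeff
  unfold decayRate
  fun_prop

lemma Admissible.continuous_riccatiSymbol : Continuous p.riccatiSymbol := by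
  have h1 := hp.continuous_symA
  have h2 := hp.continuous_decayRate
  have h3 := hp.continuous_quadCoeff
  have h4 : ∀ x, p.quadCoeff x ≠ 0 := fun x => (hp.quadCoeff_pos x).ne'
  unfold riccatiSymbol
  fun_prop (disch := assumption)

lemma Admissible.decayRate_sq (x : ℝ) :
    p.decayRate x ^ 2 = (p.symA x).re ^ 2 + ‖p.symB x‖ ^ 2 * p.quadCoeff x := by
  have := hp.quadCoeff_pos x
  exact Real.sq_sqrt (by positivity)

/-- Strictness comes from the absence of real zeros of the symbols of B and C. It makes one root of
the scalar equation positive and the other negative. -/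
lemma Admissible.abs_re_lt_decayRate (x : ℝ) : |(p.symA x).re| < p.decayRate x := by
  have := hp.quadCoeff_pos x
  have := hp.normB_pos x
  refine Real.lt_sqrt_of_sq_lt ?_
  rw [sq_abs]
  have : 0 < ‖p.symB x‖ ^ 2 * p.quadCoeff x := by positivity
  linarith

lemma Admissible.decayRate_pos (x : ℝ) : 0 < p.decayRate x :=
  (abs_nonneg _).trans_lt (hp.abs_re_lt_decayRate x)

lemma Admissible.quadCoeff_mul_riccatiSymbol (x : ℝ) :
    p.quadCoeff x * p.riccatiSymbol x = (p.symA x).re + p.decayRate x :=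
  mul_div_cancel₀ _ (hp.quadCoeff_pos x).ne'

lemma Admissible.riccatiSymbol_pos (x : ℝ) : 0 < p.riccatiSymbol x := by
  have := (abs_lt.1 (hp.abs_re_lt_decayRate x)).1
  exact div_pos (by linarith) (hp.quadCoeff_pos x)

omit hp in
lemma scalarARE_iff (x s : ℝ) : p.ScalarARE x s ↔
    2 * (p.symA x).re * s + ‖p.symB x‖ ^ 2 - p.quadCoeff x * s ^ 2 = 0 := Iff.rfl

/-- The root of the second factor is (α - σ)/q, which is negative. The factorization is checked
after multiplication by q, where only qr = α + σ and the formula for σ² enter. -/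
lemma Admissible.scalarARE_iff_factor (x s : ℝ) : p.ScalarARE x s ↔
    (s - p.riccatiSymbol x) * (p.quadCoeff x * s + (p.decayRate x - (p.symA x).re)) = 0 := by
  rw [scalarARE_iff]
  have h1 := hp.quadCoeff_mul_riccatiSymbol x
  have h2 := hp.decayRate_sq x
  have h3 := hp.quadCoeff_pos x
  have h4 : p.quadCoeff x * ((s - p.riccatiSymbol x) *
      (p.quadCoeff x * s + (p.decayRate x - (p.symA x).re))) =
      - (p.quadCoeff x * (2 * (p.symA x).re * s + ‖p.symB x‖ ^ 2 - p.quadCoeff x * s ^ 2)) := by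
    linear_combination (-(p.quadCoeff x * s) - p.decayRate x + (p.symA x).re) * h1 - h2
  constructor
  · intro h
    rw [h, mul_zero, neg_zero] at h4
    exact (mul_eq_zero.1 h4).resolve_left h3.ne'
  · intro h
    rw [h, mul_zero] at h4
    exact (mul_eq_zero.1 (neg_eq_zero.1 h4.symm)).resolve_left h3.ne'

lemma Admissible.scalarARE_riccatiSymbol (x : ℝ) : p.ScalarARE x (p.riccatiSymbol x) := by
  rw [hp.scalarARE_iff_factor, sub_self, zero_mul]

lemma Admissible.eq_riccatiSymbol {x s : ℝ} (hs : 0 ≤ s) (h : p.ScalarARE x s) :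
    s = p.riccatiSymbol x := by
  rw [hp.scalarARE_iff_factor] at h
  have h1 := (abs_lt.1 (hp.abs_re_lt_decayRate x)).2
  have h2 := hp.quadCoeff_pos x
  have h3 : 0 < p.quadCoeff x * s + (p.decayRate x - (p.symA x).re) := by
    have := mul_nonneg h2.le hs
    linarith
  exact sub_eq_zero.1 ((mul_eq_zero.1 h).resolve_right h3.ne')

/-! ### Uniform bounds from stabilizability -/

lemma Admissible.dichotomy_B : ∃ δ > 0, ∀ x, (p.symA x).re ≤ -δ ∨ δ ≤ ‖p.symB x‖ := by
  obtain ⟨F, hF⟩ := hp.stabilizable_AB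
  rw [hp.A_eq] at hF
  exact hF.symbol_dichotomy hp.continuous_symA hp.continuous_symB hp.B_sym hp.boundedSymbol_B

lemma Admissible.dichotomy_C : ∃ δ > 0, ∀ x, (p.symA x).re ≤ -δ ∨ δ ≤ ‖p.symC x‖ := by
  obtain ⟨F, hF⟩ := hp.stabilizable_AC
  rw [hp.adjoint_A_eq] at hF
  have := hF.symbol_dichotomy (continuous_star.comp hp.continuous_symA)
    (continuous_star.comp hp.continuous_symC) hp.adjoint_C_sym hp.boundedSymbol_C.star
  simpa using this

/-- There are two regimes. Where Re A ≤ -δ the plant is damped, which gives σ ≥ δ directly.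
Elsewhere |B| and |C| are bounded below, and so is q because |G| is bounded above; then the noise
and the measurement control both quantities. -/
lemma Admissible.exists_decayRate_ge_and_riccatiSymbol_le :
    ∃ δ > 0, ∃ c, ∀ x, δ ≤ p.decayRate x ∧ p.riccatiSymbol x ≤ c := by
  obtain ⟨δ₁, hδ₁, h₁⟩ := hp.dichotomy_B
  obtain ⟨δ₂, hδ₂, h₂⟩ := hp.dichotomy_C
  obtain ⟨ω, hω⟩ := hp.exists_re_symA_le
  set δ := min δ₁ δ₂ with hδ
  have hδ0 : 0 < δ := lt_min hδ₁ hδ₂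
  have hG0 : 0 < ‖p.G‖ := (hp.normG_pos 0).trans_le (hp.norm_symG_le 0)
  have key (x : ℝ) : (p.symA x).re ≤ -δ ∨ δ ≤ ‖p.symB x‖ ∧ δ ^ 2 * (‖p.G‖ ^ 2)⁻¹ ≤ p.quadCoeff x := by
    rcases h₁ x with h | h
    · exact Or.inl (h.trans (neg_le_neg (min_le_left _ _)))
    rcases h₂ x with h' | h'
    · exact Or.inl (h'.trans (neg_le_neg (min_le_right _ _)))
    · refine Or.inr ⟨(min_le_left _ _).trans h, ?_⟩
      have h3 : δ ≤ ‖p.symC x‖ := (min_le_right _ _).trans h'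
      have h4 := hp.norm_symG_le x
      have h5 := hp.normG_pos x
      unfold quadCoeff
      gcongr
  set κ₀ := δ ^ 2 * (‖p.G‖ ^ 2)⁻¹ with hκ₀
  have hκ₀pos : 0 < κ₀ := by positivity
  -- In the damped regime the Riccati equation gives 2δr ≤ |B|². In the other one σ² ≥ |B|²q ≥ δ²κ₀,
  -- and an r above the second bound would make qr² exceed 2(Re A)r + |B|².
  refine ⟨min δ (δ * √κ₀), by positivity, max (‖p.B‖ ^ 2 / (2 * δ))
    ((3 * |ω| + 2 * δ + 1) / κ₀ + ‖p.B‖ ^ 2), fun x => ?_⟩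
  have hq := hp.quadCoeff_pos x
  have hσ := hp.decayRate_sq x
  have hσ0 := hp.decayRate_pos x
  have hr := hp.quadCoeff_mul_riccatiSymbol x
  have hr0 := hp.riccatiSymbol_pos x
  have hB := hp.norm_symB_le x
  have hB0 := hp.normB_pos x
  have hB2 : ‖p.symB x‖ ^ 2 ≤ ‖p.B‖ ^ 2 := by gcongr
  have hare := (hp.scalarARE_riccatiSymbol x)
  rw [scalarARE_iff] at hare
  rcases key x with h | ⟨h, h'⟩
  · constructor
    · refine (min_le_left _ _).trans ?_
      have := (abs_lt.1 (hp.abs_re_lt_decayRate x)).1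
      linarith
    · refine le_trans ?_ (le_max_left _ _)
      rw [le_div_iff₀ (by positivity)]
      nlinarith [mul_pos hq (pow_pos hr0 2)]
  · constructor
    · refine (min_le_right _ _).trans ?_
      refine Real.le_sqrt_of_sq_le ?_
      rw [mul_pow, Real.sq_sqrt hκ₀pos.le]
      have h3 : δ ^ 2 ≤ ‖p.symB x‖ ^ 2 := by gcongr
      have := mul_le_mul h3 h' hκ₀pos.le (by positivity)
      nlinarith [sq_nonneg (p.symA x).re]
    · refine le_trans ?_ (le_max_right _ _)
      have hω' : (p.symA x).re ≤ |ω| := (hω x).trans (le_abs_self _)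
      by_contra! hlt
      set R := p.riccatiSymbol x
      have h7 : ‖p.B‖ ^ 2 < R := by
        have : 0 ≤ (3 * |ω| + 2 * δ + 1) / κ₀ := by positivity
        linarith
      have h8 : (3 * |ω| + 2 * δ + 1) < κ₀ * R := by
        have h9 : (3 * |ω| + 2 * δ + 1) / κ₀ < R := by
          have : 0 ≤ ‖p.B‖ ^ 2 := by positivity
          linarith
        rw [div_lt_iff₀ hκ₀pos] at h9
        linarith
      have h10 : κ₀ * R ≤ p.quadCoeff x * R := mul_le_mul_of_nonneg_right h' hr0.le
      have h11 := abs_nonneg ω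
      nlinarith

end Plant

/-! ### The Riccati equation for operators with a real symbol -/

lemma Sym.inv {m : ℝ → ℂ} {f g : L2} (h : Sym m f g) (hm : ∀ x, m x ≠ 0) :
    Sym (fun x => (m x)⁻¹) g f := by
  filter_upwards [h] with ξ h1
  rw [h1, inv_mul_cancel_left₀ (hm _)]

/-- A function with the spectrum `[-n, n]`. -/
lemma exists_fourier_eq_cut (n : ℕ) : ∃ f : L2, ∀ᵐ ξ : ℝ, (𝓕 f : L2) ξ = cut n (2 * Real.pi * ξ) := by
  have hπ : 2 * Real.pi ≠ 0 := by positivity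
  set E : Set ℝ := (fun ξ => 2 * Real.pi * ξ) ⁻¹' Set.Icc (-(n : ℝ)) n with hE
  have hEc : IsCompact E :=
    (Homeomorph.mulLeft₀ (2 * Real.pi) hπ).isClosedEmbedding.isCompact_preimage isCompact_Icc
  have hmem : MemLp (E.indicator fun _ => (1 : ℂ)) 2 volume :=
    memLp_indicator_const 2 hEc.measurableSet 1 (Or.inr hEc.measure_lt_top.ne)
  refine ⟨𝓕⁻ (hmem.toLp _ : L2), ?_⟩
  rw [fourier_fourierInv_L2]
  exact hmem.coeFn_toLp

/-- A symbol that annihilates all band-limited functions vanishes almost everywhere. -/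
lemma ae_eq_zero_of_sym {m : ℝ → ℂ} (h : ∀ n f, BandLimited n f → Sym m f 0) :
    ∀ᵐ x, m x = 0 := by
  rw [← ae_frequency_iff]
  have h0 : (𝓕 (0 : L2) : L2) = 0 := (Lp.fourierTransformₗᵢ ℝ ℂ).map_zero
  have key (n : ℕ) : ∀ᵐ ξ : ℝ, |2 * Real.pi * ξ| ≤ n → m (2 * Real.pi * ξ) = 0 := by
    obtain ⟨f, hf⟩ := exists_fourier_eq_cut n
    have hb : BandLimited n f := by
      filter_upwards [hf] with ξ h1
      rw [h1, cut_mul_cut]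
    have h1 := h n f hb
    rw [Sym, h0] at h1
    filter_upwards [hf, h1, Lp.coeFn_zero ℂ 2 (volume : Measure ℝ)] with ξ h2 h3 h4 h5
    rw [h2, cut_of_mem h5, mul_one, h4] at h3
    exact h3.symm
  filter_upwards [ae_all_iff.2 key] with ξ h1
  obtain ⟨n, hn⟩ := exists_nat_ge |2 * Real.pi * ξ|
  exact h1 n hn

lemma isSelfAdjoint_of_real_symbol {Q : L2 →L[ℂ] L2} {q : ℝ → ℝ}
    (hQ : ∀ f, Sym (fun x => (q x : ℂ)) f (Q f)) : IsSelfAdjoint Q := by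
  rw [ContinuousLinearMap.isSelfAdjoint_iff_isSymmetric]
  intro f g
  exact ((hQ g).inner_eq ((hQ f).congr fun x => by simp)).symm

lemma integrable_star_mul (f g : L2) : Integrable fun x => star (f x) * g x := by
  refine (L2.integrable_inner (𝕜 := ℂ) f g).congr (ae_of_all _ fun x => ?_)
  simp [mul_comm]

/-- Together with Plancherel this reduces the weak Riccati equation to an identity at almost every
frequency. -/
lemma inner_add_add_sub_eq_zero {f₁ g₁ f₂ g₂ f₃ g₃ f₄ g₄ : L2}
    (h : ∀ᵐ x, star (f₁ x) * g₁ x + star (f₂ x) * g₂ x + star (f₃ x) * g₃ x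
      - star (f₄ x) * g₄ x = 0) :
    inner ℂ f₁ g₁ + inner ℂ f₂ g₂ + inner ℂ f₃ g₃ - inner ℂ f₄ g₄ = 0 := by
  have i₁ := integrable_star_mul f₁ g₁
  have i₂ := integrable_star_mul f₂ g₂
  have i₃ := integrable_star_mul f₃ g₃
  have i₄ := integrable_star_mul f₄ g₄
  have i₁₂ : Integrable fun x => star (f₁ x) * g₁ x + star (f₂ x) * g₂ x := i₁.add i₂
  have i₁₂₃ : Integrable fun x => star (f₁ x) * g₁ x + star (f₂ x) * g₂ x + star (f₃ x) * g₃ x :=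
    i₁₂.add i₃
  rw [inner_eq_integral, inner_eq_integral, inner_eq_integral, inner_eq_integral,
    ← integral_add i₁ i₂, ← integral_add i₁₂ i₃, ← integral_sub i₁₂₃ i₄,
    integral_congr_ae h, integral_zero]

namespace Plant

variable {p : Plant}

lemma Admissible.adjoint_A_sym (hp : p.Admissible) (h : p.A.adjoint.domain) :
    Sym (fun x => star (p.symA x)) h (p.A.adjoint h) := by
  have h1 : ∀ z, z ∈ p.A.adjoint.graph → z ∈ (maxMul fun x => star (p.symA x)).graph := by
    rw [hp.adjoint_A_eq]; exact fun z hz => hz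
  exact mem_maxMul_graph.1 (h1 _ (p.A.adjoint.mem_graph h))

lemma Admissible.mem_adjoint_A_domain (hp : p.Admissible) {f g : L2}
    (h : Sym (fun x => star (p.symA x)) f g) :
    ∃ hf : f ∈ p.A.adjoint.domain, p.A.adjoint ⟨f, hf⟩ = g := by
  have hg : (f, g) ∈ p.A.adjoint.graph := by
    rw [hp.adjoint_A_eq]; exact mem_maxMul_graph.2 h
  obtain ⟨y, hy1, hy2⟩ := (LinearPMap.mem_graph_iff _).1 hg
  have hy1 : (y : L2) = f := hy1
  subst hy1
  exact ⟨y.2, hy2⟩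

lemma Admissible.bandLimited_mem_adjoint_A_domain (hp : p.Admissible) {n : ℕ} {f : L2}
    (hf : BandLimited n f) : f ∈ p.A.adjoint.domain :=
  (hp.mem_adjoint_A_domain (hf.sym (continuous_star.comp hp.continuous_symA))).1

lemma Admissible.continuous_inv_symG (hp : p.Admissible) : Continuous fun x => (p.symG x)⁻¹ :=
  hp.continuous_symG.inv₀ hp.symG_ne_zero

lemma mul_star_eq (z : ℂ) : z * star z = ((‖z‖ ^ 2 : ℝ) : ℂ) := by
  rw [RCLike.star_def, Complex.mul_conj, Complex.normSq_eq_norm_sq]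

lemma star_mul_eq (z : ℂ) : star z * z = ((‖z‖ ^ 2 : ℝ) : ℂ) := by
  rw [mul_comm, mul_star_eq]

/-- The pointwise form of the Riccati equation. -/
lemma scalarARE_iff_complex (x s : ℝ) : p.ScalarARE x s ↔
    p.symA x * s + s * star (p.symA x) + p.symB x * star (p.symB x) -
      s * (star (p.symC x) * ((star (p.symG x))⁻¹ * ((p.symG x)⁻¹ * (p.symC x * s)))) = 0 := by
  have h1 : p.symA x * s + s * star (p.symA x) + p.symB x * star (p.symB x) -
      s * (star (p.symC x) * ((star (p.symG x))⁻¹ * ((p.symG x)⁻¹ * (p.symC x * s)))) =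
      ((2 * (p.symA x).re * s + ‖p.symB x‖ ^ 2 - p.quadCoeff x * s ^ 2 : ℝ) : ℂ) := by
    have h2 : p.symA x + star (p.symA x) = ((2 * (p.symA x).re : ℝ) : ℂ) := by
      rw [RCLike.star_def, Complex.add_conj]
    calc _ = (p.symA x + star (p.symA x)) * s + p.symB x * star (p.symB x) -
        (p.symC x * star (p.symC x)) * (p.symG x * star (p.symG x))⁻¹ * s ^ 2 := by
          rw [mul_inv]; ring
      _ = _ := by
          rw [h2, mul_star_eq, mul_star_eq, mul_star_eq, quadCoeff]
          push_cast; ring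
  rw [h1, Complex.ofReal_eq_zero, scalarARE_iff]

/-- The delicate point is that `C Q f` lies in the range of `G`, although 1/G may be unbounded. The
scalar equation supplies it by expressing the quadratic term through terms that the domain of A*
controls. -/
lemma Admissible.solvesARE_of_scalarARE (hp : p.Admissible) {Q : L2 →L[ℂ] L2} {q : ℝ → ℝ}
    (hQ : ∀ f, Sym (fun x => (q x : ℂ)) f (Q f)) (h : ∀ᵐ x, p.ScalarARE x (q x)) :
    p.SolvesARE Q := by
  refine ⟨isSelfAdjoint_of_real_symbol hQ, ?_⟩
  have h' := ae_frequency_iff.2 h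
  -- From qs² = 2(Re A)s + |B|² ≤ (|A| + |s| + |B|)² one gets |G⁻¹Csf| ≤ |Af| + |sf| + |Bf| in
  -- frequency, a square integrable bound.
  have key (f : p.A.adjoint.domain) : ∃ u, Sym (fun x => (p.symG x)⁻¹) (p.C (Q f)) u := by
    refine exists_sym_of_le hp.continuous_inv_symG.measurable
      (u := fun ξ => ‖(𝓕 (p.A.adjoint f) : L2) ξ‖ + ‖(𝓕 (Q f) : L2) ξ‖ +
        ‖(𝓕 (ContinuousLinearMap.adjoint p.B f) : L2) ξ‖)
      (((Lp.memLp (𝓕 (p.A.adjoint f) : L2)).norm.add (Lp.memLp (𝓕 (Q f) : L2)).norm).add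
        (Lp.memLp (𝓕 (ContinuousLinearMap.adjoint p.B f) : L2)).norm) ?_
    filter_upwards [h', hp.adjoint_A_sym f, hQ f, hp.C_sym (Q f), hp.adjoint_B_sym f]
      with ξ h1 h2 h3 h4 h5
    rw [h4, h3, h2, h5]
    set x := 2 * Real.pi * ξ
    set w := (𝓕 (f : L2) : L2) ξ
    rw [scalarARE_iff] at h1
    simp only [norm_mul, norm_inv, norm_star, Complex.norm_real, Real.norm_eq_abs]
    refine abs_le_of_sq_le_sq' ?_ (by positivity) |>.2
    have h6 : (‖p.symG x‖⁻¹ * (‖p.symC x‖ * (|q x| * ‖w‖))) ^ 2 =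
        p.quadCoeff x * q x ^ 2 * ‖w‖ ^ 2 := by
      unfold quadCoeff
      rw [mul_pow, mul_pow, mul_pow, sq_abs, inv_pow]
      ring
    have h7 : p.quadCoeff x * q x ^ 2 = 2 * (p.symA x).re * q x + ‖p.symB x‖ ^ 2 := by linarith
    rw [h6, h7]
    have h8 : 2 * (p.symA x).re * q x ≤ 2 * ‖p.symA x‖ * |q x| := by
      have h9 := Complex.abs_re_le_norm (p.symA x)
      calc 2 * (p.symA x).re * q x ≤ |2 * (p.symA x).re * q x| := le_abs_self _
        _ = 2 * |(p.symA x).re| * |q x| := by rw [abs_mul, abs_mul, abs_two]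
        _ ≤ _ := by gcongr
    have h10 : (2 * (p.symA x).re * q x + ‖p.symB x‖ ^ 2) * ‖w‖ ^ 2 ≤
        (2 * ‖p.symA x‖ * |q x| + ‖p.symB x‖ ^ 2) * ‖w‖ ^ 2 := by gcongr
    refine h10.trans ?_
    have e1 : 0 ≤ ‖p.symA x‖ * ‖w‖ := by positivity
    have e2 : 0 ≤ |q x| * ‖w‖ := by positivity
    have e3 : 0 ≤ ‖p.symB x‖ * ‖w‖ := by positivity
    nlinarith [mul_nonneg e1 e3, mul_nonneg e2 e3, sq_nonneg (‖p.symA x‖ * ‖w‖),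
      sq_nonneg (|q x| * ‖w‖)]
  intro h f
  obtain ⟨u, hu⟩ := key h
  obtain ⟨v, hv⟩ := key f
  have hG {k u : L2} (hu : Sym (fun x => (p.symG x)⁻¹) k u) : p.G u = k := by
    have h1 := hu.inv fun x => inv_ne_zero (hp.symG_ne_zero x)
    exact (hp.G_sym u).unique (h1.congr fun x => inv_inv _)
  refine ⟨u, v, hG hu, hG hv, ?_⟩
  rw [← inner_fourier_L2, ← inner_fourier_L2 (f : L2), ← inner_fourier_L2 (f : L2),
    ← inner_fourier_L2 v]
  refine inner_add_add_sub_eq_zero ?_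
  filter_upwards [h', hp.adjoint_A_sym f, hQ h, hQ f, hQ (p.A.adjoint h), hp.adjoint_A_sym h,
    hp.B_sym (ContinuousLinearMap.adjoint p.B h), hp.adjoint_B_sym h, hu, hv,
    hp.C_sym (Q h), hp.C_sym (Q f)] with ξ h1 h2 h3 h4 h5 h6 h7 h8 h9 h10 h11 h12
  rw [h2, h5, h6, h7, h8, h9, h10, h11, h12, h3, h4]
  rw [scalarARE_iff_complex] at h1
  simp only [star_mul', star_inv₀, RCLike.star_def, Complex.conj_ofReal, Complex.conj_conj] at h1 ⊢
  linear_combination ((starRingEnd ℂ) ((𝓕 (f : L2) : L2) ξ) * (𝓕 (h : L2) : L2) ξ) * h1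

/-- On a band-limited argument every factor of the quadratic term is defined, so the weak equation
becomes the vanishing of one vector. Its symbol is the scalar Riccati expression. -/
lemma Admissible.scalarARE_of_solvesARE (hp : p.Admissible) {Q : L2 →L[ℂ] L2} {q : ℝ → ℝ}
    (hQ : ∀ f, Sym (fun x => (q x : ℂ)) f (Q f)) (h : p.SolvesARE Q) :
    ∀ᵐ x, p.ScalarARE x (q x) := by
  simp_rw [scalarARE_iff_complex]
  refine ae_eq_zero_of_sym fun n h₀ hh₀ => ?_
  obtain ⟨hsa, hare⟩ := h
  have hsym : (Q : L2 →ₗ[ℂ] L2).IsSymmetric := hsa.isSymmetric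
  set h' : p.A.adjoint.domain := ⟨h₀, hp.bandLimited_mem_adjoint_A_domain hh₀⟩ with hh'
  have hQh : BandLimited n (Q h₀) := (hQ h₀).bandLimited hh₀
  have hCQh : BandLimited n (p.C (Q h₀)) := (hp.C_sym _).bandLimited hQh
  set k₁ := bandMul n p.symA (Q h₀)
  have hk₁ : Sym p.symA (Q h₀) k₁ := hQh.sym hp.continuous_symA
  set u := bandMul n (fun x => (p.symG x)⁻¹) (p.C (Q h₀))
  have hu : Sym (fun x => (p.symG x)⁻¹) (p.C (Q h₀)) u := hCQh.sym hp.continuous_inv_symG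
  have hsg : Continuous fun x => (star (p.symG x))⁻¹ :=
    (continuous_star.comp hp.continuous_symG).inv₀ fun x => star_ne_zero.2 (hp.symG_ne_zero x)
  set u' := bandMul n (fun x => (star (p.symG x))⁻¹) u
  have hu' : Sym (fun x => (star (p.symG x))⁻¹) u u' := (hu.bandLimited hCQh).sym hsg
  set Z := k₁ + Q (p.A.adjoint h') + p.B (ContinuousLinearMap.adjoint p.B h₀) -
    Q (ContinuousLinearMap.adjoint p.C u') with hZ
  -- `Z` is the Riccati expression applied to `h₀`; it is orthogonal to the dense domain of the
  -- adjoint.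
  have hZ0 : Z = 0 := by
    have hdense : Dense (p.A.adjoint.domain : Set L2) :=
      dense_of_bandLimited fun n f hf => hp.bandLimited_mem_adjoint_A_domain hf
    refine hdense.eq_zero_of_inner_right ℂ fun f hf => ?_
    obtain ⟨u₁, v, hu₁, hv, heq⟩ := hare h' ⟨f, hf⟩
    have h1 := hp.adjoint_A_sym ⟨f, hf⟩
    have h2 : inner ℂ (p.A.adjoint ⟨f, hf⟩) (Q h₀) = inner ℂ f k₁ := (hk₁.inner_eq h1).symm
    have hG {w : L2} : Sym (fun x => (p.symG x)⁻¹) (p.G w) w := (hp.G_sym w).inv hp.symG_ne_zero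
    have h3 : u₁ = u := by
      have h4 := hG (w := u₁)
      rw [hu₁] at h4
      exact h4.unique hu
    have h5 : inner ℂ v u = inner ℂ f (Q (ContinuousLinearMap.adjoint p.C u')) := by
      have h6 : inner ℂ f (Q (ContinuousLinearMap.adjoint p.C u')) = inner ℂ (p.C (Q f)) u' := by
        rw [← ContinuousLinearMap.adjoint_inner_right]
        exact (hsym f _).symm
      rw [h6, ← hv]
      refine (hu'.inner_eq (hG.congr fun x => ?_)).symm
      rw [star_inv₀, star_star]
    rw [hZ, inner_sub_right, inner_add_right, inner_add_right, ← h2, ← h5, ← h3]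
    exact heq
  have hfin := (((hk₁.comp (hQ h₀)).add_symbol ((hQ _).comp (hp.adjoint_A_sym h'))).add_symbol
    ((hp.B_sym _).comp (hp.adjoint_B_sym h₀))).sub_symbol
    ((hQ _).comp ((hp.adjoint_C_sym u').comp (hu'.comp (hu.comp
      ((hp.C_sym _).comp (hQ h₀))))))
  rw [← hZ0]
  exact hfin

lemma Admissible.solvesARE_iff (hp : p.Admissible) {Q : L2 →L[ℂ] L2} {q : ℝ → ℝ}
    (hQ : HasFourierSymbol (toPartial Q) fun x => (q x : ℂ)) :
    p.SolvesARE Q ↔ ∀ᵐ x, p.ScalarARE x (q x) :=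
  ⟨hp.scalarARE_of_solvesARE (hasFourierSymbol_toPartial_iff.1 hQ),
    hp.solvesARE_of_scalarARE (hasFourierSymbol_toPartial_iff.1 hQ)⟩

end Plant

/-! ### Translation invariance -/

lemma sym_of_eq_maxMul {T : L2 →ₗ.[ℂ] L2} {m : ℝ → ℂ} (h : T = maxMul m) (f : T.domain) :
    Sym m f (T f) := by
  subst h; exact maxMul_sym m f

lemma mem_domain_of_eq_maxMul {T : L2 →ₗ.[ℂ] L2} {m : ℝ → ℂ} (h : T = maxMul m) {f g : L2}
    (hfg : Sym m f g) : ∃ hf : f ∈ T.domain, T ⟨f, hf⟩ = g := by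
  subst h; exact ⟨⟨g, hfg⟩, (maxMul_sym m ⟨f, g, hfg⟩).unique hfg⟩

lemma translationInvariant_of_sym {T : L2 →ₗ.[ℂ] L2} {m : ℝ → ℂ}
    (hT : ∀ f : T.domain, Sym m f (T f))
    (hd : ∀ (z : ℝ) (f : L2), f ∈ T.domain → translation z f ∈ T.domain) :
    TranslationInvariant T := fun z f =>
  ⟨hd z f f.2, (hT ⟨translation z f, hd z f f.2⟩).unique ((hT f).translation z)⟩

lemma translationInvariant_of_eq_maxMul {T : L2 →ₗ.[ℂ] L2} {m : ℝ → ℂ} (h : T = maxMul m) :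
    TranslationInvariant T :=
  translationInvariant_of_sym (sym_of_eq_maxMul h) fun z f hf =>
    (mem_domain_of_eq_maxMul h ((sym_of_eq_maxMul h ⟨f, hf⟩).translation z)).1

lemma TranslationInvariant.mem_graph {T : L2 →ₗ.[ℂ] L2} (hT : TranslationInvariant T) (z : ℝ)
    {f g : L2} (h : (f, g) ∈ T.graph) : (translation z f, translation z g) ∈ T.graph := by
  obtain ⟨x, rfl, h⟩ := (LinearPMap.mem_graph_iff _).1 h
  have h : T x = g := h
  obtain ⟨h1, h2⟩ := hT z x
  rw [← h, ← h2]
  exact T.mem_graph ⟨_, h1⟩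

lemma TranslationInvariant.subComp {A R : L2 →ₗ.[ℂ] L2} {T : L2 →L[ℂ] L2}
    (hA : TranslationInvariant A) (hR : TranslationInvariant R)
    (hT : TranslationInvariant (toPartial T)) : TranslationInvariant (subComp A R T) := by
  intro z f
  have h0 : T (translation z f) = translation z (T f) := (hT z ⟨f, trivial⟩).2
  obtain ⟨h1, h2⟩ := hA z ⟨f, f.2.1⟩
  obtain ⟨h3, h4⟩ := hR z ⟨T f, f.2.2⟩
  have h5 : T (translation z f) ∈ R.domain := by rw [h0]; exact h3
  refine ⟨⟨h1, h5⟩, ?_⟩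
  have h6 : R ⟨T (translation z f), h5⟩ = R ⟨translation z (T f), h3⟩ := by
    congr 1; exact Subtype.ext h0
  change A ⟨translation z f, h1⟩ - R ⟨T (translation z f), h5⟩ = translation z (A _ - R _)
  rw [h6, h2, h4, map_sub]

lemma subComp_sym {A R : L2 →ₗ.[ℂ] L2} {T : L2 →L[ℂ] L2} {a ρ c : ℝ → ℂ}
    (hA : ∀ f : A.domain, Sym a f (A f)) (hR : ∀ f : R.domain, Sym ρ f (R f))
    (hT : ∀ f, Sym c f (T f)) (f : (subComp A R T).domain) :
    Sym (fun x => a x - ρ x * c x) f (subComp A R T f) :=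
  (hA ⟨f, f.2.1⟩).sub_symbol ((hR ⟨T f, f.2.2⟩).comp (hT f))

namespace Plant

variable {p : Plant}

/-! ### The gain and the filter operator -/

lemma Admissible.adjoint_comp_sym (hp : p.Admissible) (f : L2) :
    Sym (fun x => ((‖p.symG x‖ ^ 2 : ℝ) : ℂ)) f
      (p.G (ContinuousLinearMap.adjoint p.G f)) :=
  ((hp.G_sym _).comp (hp.adjoint_G_sym f)).congr fun _ => mul_star_eq _

lemma Admissible.normG_sq_ne_zero (hp : p.Admissible) (x : ℝ) :
    ((‖p.symG x‖ ^ 2 : ℝ) : ℂ) ≠ 0 :=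
  Complex.ofReal_ne_zero.2 (pow_pos (hp.normG_pos x) 2).ne'

lemma Admissible.continuous_inv_normG_sq (hp : p.Admissible) :
    Continuous fun x => (((‖p.symG x‖ ^ 2 : ℝ) : ℂ))⁻¹ := by
  have h1 := hp.continuous_symG
  exact Continuous.inv₀ (by fun_prop) hp.normG_sq_ne_zero

lemma Admissible.invGG_eq (hp : p.Admissible) :
    p.invGG = maxMul fun x => (((‖p.symG x‖ ^ 2 : ℝ) : ℂ))⁻¹ := by
  refine LinearPMap.eq_of_eq_graph ?_
  have hker : LinearMap.ker
      (toPartial (p.G.comp (ContinuousLinearMap.adjoint p.G))).toFun = ⊥ := by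
    rw [LinearMap.ker_eq_bot']
    intro f hf
    have h1 := (hp.adjoint_comp_sym f).inv hp.normG_sq_ne_zero
    have h2 : p.G (ContinuousLinearMap.adjoint p.G f) = 0 := hf
    rw [h2] at h1
    exact Subtype.ext (h1.unique (Sym.zero _))
  rw [invGG, LinearPMap.inverse_graph hker]
  ext ⟨f, g⟩
  rw [mem_maxMul_graph, Submodule.mem_map]
  constructor
  · rintro ⟨⟨x, y⟩, hxy, h⟩
    obtain ⟨rfl, rfl⟩ : y = f ∧ x = g := by simpa using h
    obtain ⟨x', rfl, hx⟩ := (LinearPMap.mem_graph_iff _).1 hxy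
    have hx : p.G (ContinuousLinearMap.adjoint p.G x') = y := hx
    have h1 := (hp.adjoint_comp_sym x').inv hp.normG_sq_ne_zero
    rwa [hx] at h1
  · intro h
    refine ⟨(g, f), ?_, rfl⟩
    rw [LinearPMap.mem_graph_iff]
    refine ⟨⟨g, trivial⟩, rfl, ?_⟩
    exact (hp.adjoint_comp_sym g).unique
      ((h.inv fun x => inv_ne_zero (hp.normG_sq_ne_zero x)).congr fun x => inv_inv _)

lemma Admissible.invGG_sym (hp : p.Admissible) (f : p.invGG.domain) :
    Sym (fun x => (((‖p.symG x‖ ^ 2 : ℝ) : ℂ))⁻¹) f (p.invGG f) := sym_of_eq_maxMul hp.invGG_eq f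

lemma Admissible.bandLimited_mem_invGG_domain (hp : p.Admissible) {n : ℕ} {f : L2}
    (hf : BandLimited n f) : f ∈ p.invGG.domain :=
  (mem_domain_of_eq_maxMul hp.invGG_eq (hf.sym hp.continuous_inv_normG_sq)).1

lemma Admissible.A_sym (hp : p.Admissible) (f : p.A.domain) : Sym p.symA f (p.A f) :=
  hp.symbol_A f

lemma Admissible.bandLimited_mem_A_domain (hp : p.Admissible) {n : ℕ} {f : L2}
    (hf : BandLimited n f) : f ∈ p.A.domain :=
  (mem_domain_of_eq_maxMul hp.A_eq (hf.sym hp.continuous_symA)).1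

lemma Admissible.bandLimited_mem_closedLoop_domain (hp : p.Admissible) {n : ℕ} {f : L2}
    (hf : BandLimited n f) (P : L2 →L[ℂ] L2) : f ∈ (p.closedLoop P).domain :=
  ⟨hp.bandLimited_mem_A_domain hf, hp.bandLimited_mem_invGG_domain ((hp.C_sym f).bandLimited hf)⟩

/-- The operator whose symbol is the nonnegative solution of the scalar Riccati equation. -/
def riccatiOp (p : Plant) : L2 →L[ℂ] L2 := mul fun x => (p.riccatiSymbol x : ℂ)

lemma Admissible.boundedSymbol_riccati (hp : p.Admissible) :
    BoundedSymbol fun x => (p.riccatiSymbol x : ℂ) := by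
  obtain ⟨δ, -, c, h⟩ := hp.exists_decayRate_ge_and_riccatiSymbol_le
  refine ⟨(Complex.continuous_ofReal.comp hp.continuous_riccatiSymbol).measurable, c, fun x => ?_⟩
  rw [Complex.norm_real, Real.norm_of_nonneg (hp.riccatiSymbol_pos x).le]
  exact (h x).2

lemma Admissible.riccatiOp_sym (hp : p.Admissible) (f : L2) :
    Sym (fun x => (p.riccatiSymbol x : ℂ)) f (p.riccatiOp f) := mul_sym hp.boundedSymbol_riccati f

lemma Admissible.solvesARE_riccatiOp (hp : p.Admissible) : p.SolvesARE p.riccatiOp :=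
  hp.solvesARE_of_scalarARE hp.riccatiOp_sym (ae_of_all _ hp.scalarARE_riccatiSymbol)

/-- The symbol of the Kalman gain. -/
def gainSymbol (p : Plant) (x : ℝ) : ℂ :=
  (p.riccatiSymbol x : ℂ) * star (p.symC x) / ((‖p.symG x‖ ^ 2 : ℝ) : ℂ)

lemma Admissible.gain_sym (hp : p.Admissible) (f : (p.gain p.riccatiOp).domain) :
    Sym p.gainSymbol f (p.gain p.riccatiOp f) := by
  refine ((hp.riccatiOp_sym _).comp ((hp.adjoint_C_sym _).comp (hp.invGG_sym f))).congr
    fun x => ?_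
  rw [gainSymbol, div_eq_mul_inv, mul_assoc]

lemma Admissible.dense_gain_domain (hp : p.Admissible) (P : L2 →L[ℂ] L2) :
    Dense ((p.gain P).domain : Set L2) :=
  dense_of_bandLimited fun _ _ hf => hp.bandLimited_mem_invGG_domain hf

lemma Admissible.translationInvariant_gain (hp : p.Admissible) :
    TranslationInvariant (p.gain p.riccatiOp) :=
  translationInvariant_of_sym hp.gain_sym fun z f hf =>
    (translationInvariant_of_eq_maxMul hp.invGG_eq z ⟨f, hf⟩).1

lemma Admissible.continuous_gainSymbol (hp : p.Admissible) : Continuous p.gainSymbol := by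
  have h1 := hp.continuous_riccatiSymbol
  have h2 := hp.continuous_symC
  have h3 := hp.continuous_inv_normG_sq
  unfold gainSymbol
  simp_rw [div_eq_mul_inv]
  fun_prop

/-- The symbol of the closed loop operator. -/
def closedLoopSymbol (p : Plant) (x : ℝ) : ℂ := p.symA x - p.gainSymbol x * p.symC x

lemma Admissible.continuous_closedLoopSymbol (hp : p.Admissible) :
    Continuous p.closedLoopSymbol :=
  hp.continuous_symA.sub (hp.continuous_gainSymbol.mul hp.continuous_symC)

lemma gainSymbol_mul_symC (x : ℝ) :
    p.gainSymbol x * p.symC x = ((p.quadCoeff x * p.riccatiSymbol x : ℝ) : ℂ) := by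
  have h := star_mul_eq (p.symC x)
  have h1 : p.gainSymbol x * p.symC x =
      p.riccatiSymbol x * (star (p.symC x) * p.symC x) / ((‖p.symG x‖ ^ 2 : ℝ) : ℂ) := by
    rw [gainSymbol]; ring
  rw [h1, h, quadCoeff]
  push_cast
  ring

/-- Feedback subtracts qr = α + σ from α, which leaves exactly the decay rate with a negative sign.
-/
lemma Admissible.closedLoopSymbol_re (hp : p.Admissible) (x : ℝ) :
    (p.closedLoopSymbol x).re = -p.decayRate x := by
  rw [closedLoopSymbol, gainSymbol_mul_symC, Complex.sub_re, Complex.ofReal_re,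
    hp.quadCoeff_mul_riccatiSymbol]
  ring

/-- The natural domain contains the band-limited functions even if the inverse of GG* is unbounded,
and these determine the closure. -/
lemma Admissible.closedLoop_closure (hp : p.Admissible) :
    (p.closedLoop p.riccatiOp).IsClosable ∧
      (p.closedLoop p.riccatiOp).closure = maxMul p.closedLoopSymbol :=
  closure_eq_maxMul (subComp_sym hp.A_sym hp.gain_sym hp.C_sym) fun _ _ hf =>
    hp.bandLimited_mem_closedLoop_domain hf _

lemma Admissible.dualClosedLoop_sym (hp : p.Admissible)
    (f : (p.dualClosedLoop p.riccatiOp).domain) :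
    Sym (fun x => star (p.closedLoopSymbol x)) f (p.dualClosedLoop p.riccatiOp f) := by
  have h1 : ∀ f : ((ContinuousLinearMap.adjoint p.C : L2 →ₗ[ℂ] L2).compPMap p.invGG).domain,
      Sym _ f (((ContinuousLinearMap.adjoint p.C : L2 →ₗ[ℂ] L2).compPMap p.invGG) f) :=
    fun f => (hp.adjoint_C_sym _).comp (hp.invGG_sym f)
  refine (subComp_sym hp.adjoint_A_sym h1
    (T := p.C.comp p.riccatiOp) (fun f => (hp.C_sym _).comp (hp.riccatiOp_sym f)) f).congr
    fun x => ?_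
  rw [closedLoopSymbol, gainSymbol_mul_symC, star_sub, RCLike.star_def, Complex.conj_ofReal,
    ← gainSymbol_mul_symC, gainSymbol]
  simp only [RCLike.star_def]
  ring

lemma Admissible.dualClosedLoop_closure (hp : p.Admissible) :
    (p.dualClosedLoop p.riccatiOp).IsClosable ∧
      (p.dualClosedLoop p.riccatiOp).closure = maxMul fun x => star (p.closedLoopSymbol x) :=
  closure_eq_maxMul hp.dualClosedLoop_sym fun _ _ hf =>
    ⟨hp.bandLimited_mem_adjoint_A_domain hf, hp.bandLimited_mem_invGG_domain
      ((hp.C_sym _).bandLimited ((hp.riccatiOp_sym _).bandLimited hf))⟩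

lemma Admissible.exists_closedLoopSymbol_re_le (hp : p.Admissible) :
    ∃ ω < 0, ∀ x, (p.closedLoopSymbol x).re ≤ ω := by
  obtain ⟨δ, hδ, c, h⟩ := hp.exists_decayRate_ge_and_riccatiSymbol_le
  refine ⟨-δ, by linarith, fun x => ?_⟩
  rw [hp.closedLoopSymbol_re]
  linarith [(h x).1]

lemma Admissible.isStabilizing_riccatiOp (hp : p.Admissible) : p.IsStabilizing p.riccatiOp := by
  obtain ⟨h1, h2⟩ := hp.closedLoop_closure
  obtain ⟨h3, h4⟩ := hp.dualClosedLoop_closure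
  obtain ⟨ω, hω, h⟩ := hp.exists_closedLoopSymbol_re_le
  refine ⟨h1, ?_, h3, ?_⟩
  · rw [h2]
    exact generatesStable_maxMul hp.continuous_closedLoopSymbol h hω
  · rw [h2, h4, maxMul_adjoint hp.continuous_closedLoopSymbol]

/-! ### Spatial invariance of the filter -/

lemma Admissible.translationInvariant_A (hp : p.Admissible) : TranslationInvariant p.A :=
  translationInvariant_of_eq_maxMul hp.A_eq

lemma Admissible.translationInvariant_closedLoop (hp : p.Admissible) :
    TranslationInvariant (p.closedLoop p.riccatiOp) :=
  hp.translationInvariant_A.subComp hp.translationInvariant_gain hp.invariant_C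

lemma Admissible.translationInvariant_closedLoop_closure (hp : p.Admissible) :
    TranslationInvariant (p.closedLoop p.riccatiOp).closure :=
  translationInvariant_of_eq_maxMul hp.closedLoop_closure.2

lemma Admissible.isFilterTrajectory_translation (hp : p.Admissible) (z : ℝ) {y est : ℝ → L2}
    (h : p.IsFilterTrajectory p.riccatiOp y est) :
    p.IsFilterTrajectory p.riccatiOp (fun t => translation z (y t))
      (fun t => translation z (est t)) := by
  refine ⟨by simp only [h.1, map_zero], fun t ht => ?_⟩
  obtain ⟨u, v, hu, hv, hd⟩ := h.2 t ht
  refine ⟨translation z u, translation z v,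
    hp.translationInvariant_closedLoop_closure.mem_graph z hu,
    hp.translationInvariant_gain.mem_graph z hv, ?_⟩
  rw [← map_add]
  exact (((translation z).toContinuousLinearMap.restrictScalars ℝ).hasFDerivAt).comp_hasDerivWithinAt
    t hd

end Plant

/-! ### Uniqueness of the stabilizing solution -/

/-- A closed densely defined operator contains its second adjoint. -/
lemma mem_graph_of_forall_adjoint {T : L2 →ₗ.[ℂ] L2} (hT : T.IsClosed)
    (hd : Dense (T.domain : Set L2)) {u v : L2}
    (h : ∀ f f', (f, f') ∈ T.adjoint.graph → inner ℂ f v = inner ℂ f' u) : (u, v) ∈ T.graph := by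
  -- The product carries the sup norm; its ℓ² version is a Hilbert space, where a closed subspace
  -- equals its double orthogonal complement.
  set E := WithLp.linearEquiv 2 ℂ (L2 × L2)
  set K : Submodule ℂ (WithLp 2 (L2 × L2)) := T.graph.comap (E : WithLp 2 (L2 × L2) →ₗ[ℂ] L2 × L2)
  have hK : IsClosed (K : Set (WithLp 2 (L2 × L2))) :=
    IsClosed.preimage (WithLp.prod_continuous_ofLp 2 L2 L2) hT
  have : CompleteSpace K := hK.completeSpace_coe
  have h1 : (WithLp.toLp 2 (u, v) : WithLp 2 (L2 × L2)) ∈ Kᗮᗮ := by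
    rw [Submodule.mem_orthogonal]
    intro c hc
    rw [Submodule.mem_orthogonal] at hc
    -- The orthogonal complement of a graph is the graph of the adjoint after a quarter turn.
    have h2 : (c.snd, -c.fst) ∈ T.adjoint.graph := by
      rw [LinearPMap.adjoint_graph_eq_graph_adjoint hd, Submodule.mem_adjoint_iff]
      intro a b hab
      have h3 := hc (WithLp.toLp 2 (a, b)) hab
      rw [WithLp.prod_inner_apply] at h3
      simp only [inner_neg_right, sub_neg_eq_add]
      rw [add_comm]
      exact h3
    have h4 := h _ _ h2
    rw [inner_neg_left] at h4
    rw [WithLp.prod_inner_apply]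
    change inner ℂ c.fst u + inner ℂ c.snd v = 0
    rw [h4, add_neg_cancel]
  rw [Submodule.orthogonal_orthogonal] at h1
  exact h1

namespace Plant

variable {p : Plant}

lemma Admissible.G_injective (hp : p.Admissible) {u v : L2} (h : p.G u = p.G v) : u = v := by
  have h1 := (hp.G_sym u).inv hp.symG_ne_zero
  rw [h] at h1
  exact h1.unique ((hp.G_sym v).inv hp.symG_ne_zero)

lemma Admissible.comp_adjoint_invGG (hp : p.Admissible) (f : p.invGG.domain) :
    p.G (ContinuousLinearMap.adjoint p.G (p.invGG f)) = f :=
  (hp.adjoint_comp_sym _).unique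
    (((hp.invGG_sym f).inv fun x => inv_ne_zero (hp.normG_sq_ne_zero x)).congr fun _ => inv_inv _)

/-- The difference of the two Riccati equations, with mixed quadratic terms inserted, is the weak
form of A_Q D + D A_P* = 0, where D = Q - P and A_Q, A_P are the closed loops. -/
lemma Admissible.inner_dualClosedLoop_add (hp : p.Admissible) {P Q : L2 →L[ℂ] L2}
    (hP : p.SolvesARE P) (hQ : p.SolvesARE Q) (f : (p.dualClosedLoop Q).domain)
    (h : (p.dualClosedLoop P).domain) :
    inner ℂ (p.dualClosedLoop Q f) ((Q - P) h) +
      inner ℂ (f : L2) ((Q - P) (p.dualClosedLoop P h)) = 0 := by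
  have symP : (P : L2 →ₗ[ℂ] L2).IsSymmetric := hP.1.isSymmetric
  have symQ : (Q : L2 →ₗ[ℂ] L2).IsSymmetric := hQ.1.isSymmetric
  obtain ⟨u₁, v₁, hu₁, hv₁, e₁⟩ := hQ.2 ⟨h, h.2.1⟩ ⟨f, f.2.1⟩
  obtain ⟨u₂, v₂, hu₂, hv₂, e₂⟩ := hP.2 ⟨h, h.2.1⟩ ⟨f, f.2.1⟩
  set Af := p.A.adjoint ⟨f, f.2.1⟩
  set Ah := p.A.adjoint ⟨h, h.2.1⟩
  set l := p.invGG ⟨p.C (Q f), f.2.2⟩ with hl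
  set k := p.invGG ⟨p.C (P h), h.2.2⟩ with hk
  have hl' : p.G (ContinuousLinearMap.adjoint p.G l) = p.C (Q f) := hp.comp_adjoint_invGG _
  have hk' : p.G (ContinuousLinearMap.adjoint p.G k) = p.C (P h) := hp.comp_adjoint_invGG _
  -- Injectivity of `G` identifies the vector G⁻¹CQf of the weak equation with G*(GG*)⁻¹CQf from the
  -- closed loop.
  have hv : ContinuousLinearMap.adjoint p.G l = v₁ := hp.G_injective (hl'.trans hv₁.symm)
  have hu : ContinuousLinearMap.adjoint p.G k = u₂ := hp.G_injective (hk'.trans hu₂.symm)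
  change inner ℂ (Af - ContinuousLinearMap.adjoint p.C l) (Q h - P h) +
    inner ℂ (f : L2) ((Q - P) (Ah - ContinuousLinearMap.adjoint p.C k)) = 0
  have e₃ : inner ℂ (ContinuousLinearMap.adjoint p.C l) (Q h - P h) =
      inner ℂ v₁ u₁ - inner ℂ v₁ u₂ := by
    rw [ContinuousLinearMap.adjoint_inner_left, map_sub, ← hu₁, ← hu₂, ← map_sub,
      ← ContinuousLinearMap.adjoint_inner_left, hv, inner_sub_right]
  have e₄ : inner ℂ (f : L2) ((Q - P) (ContinuousLinearMap.adjoint p.C k)) =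
      inner ℂ v₁ u₂ - inner ℂ v₂ u₂ := by
    have e₅ : inner ℂ (f : L2) ((Q - P) (ContinuousLinearMap.adjoint p.C k)) =
        inner ℂ ((Q - P) f) (ContinuousLinearMap.adjoint p.C k) := by
      rw [sub_apply, sub_apply, inner_sub_left,
        inner_sub_right]
      congr 1
      · exact (symQ _ _).symm
      · exact (symP _ _).symm
    rw [e₅, ContinuousLinearMap.adjoint_inner_right, sub_apply, map_sub,
      ← hv₁, ← hv₂, ← map_sub, ← ContinuousLinearMap.adjoint_inner_right, hu, inner_sub_left]
  rw [inner_sub_left, e₃, map_sub, inner_sub_right (f : L2), e₄, inner_sub_right,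
    sub_apply, inner_sub_right]
  linear_combination e₁ - e₂

lemma graph_closure_induction {T : L2 →ₗ.[ℂ] L2} (hT : T.IsClosable) {q : L2 × L2 → Prop}
    (hq : IsClosed {z | q z}) (h : ∀ f : T.domain, q (f, T f)) {z : L2 × L2}
    (hz : z ∈ T.closure.graph) : q z := by
  rw [← hT.graph_closure_eq_closure_graph] at hz
  refine closure_minimal (t := {z | q z}) ?_ hq hz
  rintro ⟨a, b⟩ hab
  obtain ⟨x, rfl, hx⟩ := (LinearPMap.mem_graph_iff _).1 hab
  rw [← show T x = b from hx]
  exact h x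

lemma inner_add_inner_closure_eq_zero {T₁ T₂ : L2 →ₗ.[ℂ] L2} (h₁ : T₁.IsClosable)
    (h₂ : T₂.IsClosable) (D : L2 →L[ℂ] L2)
    (h : ∀ (f : T₁.domain) (h : T₂.domain),
      inner ℂ (T₁ f) (D h) + inner ℂ (f : L2) (D (T₂ h)) = 0)
    {z w : L2 × L2} (hz : z ∈ T₁.closure.graph) (hw : w ∈ T₂.closure.graph) :
    inner ℂ z.2 (D w.1) + inner ℂ z.1 (D w.2) = 0 := by
  have hcont (u v : L2) : IsClosed {z : L2 × L2 | inner ℂ z.2 u + inner ℂ z.1 v = 0} :=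
    isClosed_eq ((continuous_snd.inner continuous_const).add
      (continuous_fst.inner continuous_const)) continuous_const
  have hcont' (u v : L2) :
      IsClosed {w : L2 × L2 | inner ℂ u (D w.1) + inner ℂ v (D w.2) = 0} :=
    isClosed_eq ((continuous_const.inner (D.continuous.comp continuous_fst)).add
      (continuous_const.inner (D.continuous.comp continuous_snd))) continuous_const
  exact graph_closure_induction h₁ (hcont _ _) (fun f =>
    graph_closure_induction h₂ (hcont' _ _) (fun k => h f k) hw) hz

/-- `D` maps trajectories of the adjoint closed loop of `riccatiOp`, run backwards, to trajectories
of the closed loop of `Q`. Hence D h = S(t) D exp(t A_P*) h for every t ≥ 0. The last factor is a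
contraction and S(t) decays, so D h = 0. -/
lemma Admissible.eq_riccatiOp (hp : p.Admissible) {Q : L2 →L[ℂ] L2} (hQ : p.SolvesARE Q)
    (hs : p.IsStabilizing Q) : Q = p.riccatiOp := by
  obtain ⟨hc, ⟨S, hS, hgen, M, ω, hω, hM⟩, hc', hadj⟩ := hs
  obtain ⟨D, hD⟩ : ∃ D, D = Q - p.riccatiOp := ⟨_, rfl⟩
  obtain ⟨hd₁, hd₂⟩ := hp.dualClosedLoop_closure
  have key {f f' h h' : L2} (hf : (f, f') ∈ (p.dualClosedLoop Q).closure.graph)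
      (hh : Sym (fun x => star (p.closedLoopSymbol x)) h h') :
      inner ℂ f' (D h) + inner ℂ f (D h') = 0 := by
    have hh : (h, h') ∈ (p.dualClosedLoop p.riccatiOp).closure.graph := by
      rw [hd₂]; exact mem_maxMul_graph.2 hh
    refine inner_add_inner_closure_eq_zero hc' hd₁ D (fun f h => ?_) hf hh
    rw [hD]
    exact hp.inner_dualClosedLoop_add hp.solvesARE_riccatiOp hQ f h
  set T := (p.closedLoop Q).closure with hT
  have hTd : Dense (T.domain : Set L2) := by
    have h1 : Dense ((p.closedLoop Q).domain : Set L2) :=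
      dense_of_bandLimited fun n f hf => hp.bandLimited_mem_closedLoop_domain hf Q
    exact h1.mono (p.closedLoop Q).le_closure.1
  -- The adjoint condition in the definition of stabilizing enters here: it upgrades the weak
  -- intertwining relation to membership of `D h` in the domain of the closed operator `T`.
  have hgraph {h h' : L2} (hh : Sym (fun x => star (p.closedLoopSymbol x)) h h') :
      (D h, -D h') ∈ T.graph := by
    refine mem_graph_of_forall_adjoint hc.closure_isClosed hTd fun f f' hf => ?_
    rw [hadj] at hf
    rw [inner_neg_right, neg_eq_iff_add_eq_zero, add_comm]
    exact key hf hh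
  have hcont := continuous_star.comp hp.continuous_closedLoopSymbol
  obtain ⟨ω', hω', hre⟩ := hp.exists_closedLoopSymbol_re_le
  have hzero (n : ℕ) (h : L2) (hh : BandLimited n h) : D h = 0 := by
    have hbound (t : ℝ) (ht : 0 ≤ t) :
        ‖D h‖ ≤ M * Real.exp (-(ω * t)) * (‖D‖ * ‖h‖) := by
      -- The flow runs backwards, with the value 1 at s = t. Its derivative then carries the minus
      -- sign that `hgraph` turns into the equation y' = Ty.
      set m : ℝ → ℝ → ℂ := fun s x => Complex.exp ((t - s : ℝ) * star (p.closedLoopSymbol x))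
      set m' : ℝ → ℝ → ℂ := fun s x => -(star (p.closedLoopSymbol x) * m s x)
      have hc₂ : Continuous fun z : ℝ × ℝ => star (p.closedLoopSymbol z.2) :=
        hcont.comp continuous_snd
      have hm : Continuous fun z : ℝ × ℝ => m z.1 z.2 :=
        Complex.continuous_exp.comp (Continuous.mul (by fun_prop) hc₂)
      have hm' : Continuous fun z : ℝ × ℝ => m' z.1 z.2 := (hc₂.mul hm).neg
      have hder (s x : ℝ) : HasDerivAt (fun s => m s x) (m' s x) s := by
        have h1 : HasDerivAt (fun s : ℝ => ((t - s : ℝ) : ℂ) * star (p.closedLoopSymbol x))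
            (-star (p.closedLoopSymbol x)) s := by
          have := (((hasDerivAt_id s).const_sub t).ofReal_comp).mul_const
            (star (p.closedLoopSymbol x))
          simpa using this
        refine h1.cexp.congr_deriv ?_
        simp only [m', m]
        ring
      have hms (s : ℝ) : Continuous (m s) := hm.comp (by fun_prop : Continuous fun x => (s, x))
      have hms' (s : ℝ) : Continuous (m' s) := hm'.comp (by fun_prop : Continuous fun x => (s, x))
      set y : ℝ → L2 := fun s => D (bandMul n (m s) h)
      have hy (s : ℝ) : HasDerivAt y (D (bandMul n (m' s) h)) s :=
        (D.restrictScalars ℝ).hasFDerivAt.comp_hasDerivAt s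
          (hasDerivAt_bandMul n hder hms hm' h s)
      have h1 : y t = S t (y 0) := by
        refine hS.eq_of_classical hgen ht (fun s _ => (hy s).continuousAt.continuousWithinAt)
          fun s _ => ⟨_, ?_, (hy s).hasDerivWithinAt⟩
        have h2 : Sym (fun x => star (p.closedLoopSymbol x)) (bandMul n (m s) h)
            (-(bandMul n (m' s) h)) := by
          rw [← neg_one_smul ℂ (bandMul n (m' s) h)]
          refine Sym.of_comp (((hh.sym (hms' s)).smul_symbol (-1)).congr fun x => ?_)
            (hh.sym (hms s))
          simp only [m', neg_mul, one_mul, neg_neg]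
        have := hgraph h2
        rwa [map_neg, neg_neg] at this
      have h2 : y t = D h := by
        have : bandMul n (m t) h = h :=
          (hh.sym (hms t)).unique ((Sym.one h).congr fun x => by simp [m])
        simp only [y, this]
      have h3 : ‖bandMul n (m 0) h‖ ≤ 1 * ‖h‖ := by
        refine (hh.sym (hms 0)).norm_le fun x => ?_
        simp only [m, sub_zero, Complex.norm_exp, Complex.re_ofReal_mul, RCLike.star_def,
          Complex.conj_re, Real.exp_le_one_iff]
        exact mul_nonpos_of_nonneg_of_nonpos ht ((hre x).trans hω'.le)
      rw [← h2, h1]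
      refine ((S t).le_of_opNorm_le (hM t ht) _).trans ?_
      have h5 : 0 ≤ M * Real.exp (-(ω * t)) := (norm_nonneg _).trans (hM t ht)
      refine mul_le_mul_of_nonneg_left (D.le_opNorm_of_le (by simpa using h3)) h5
    have hlim : Tendsto (fun t : ℝ => M * Real.exp (-(ω * t)) * (‖D‖ * ‖h‖)) atTop
        (𝓝 (M * 0 * (‖D‖ * ‖h‖))) := by
      refine Tendsto.mul_const _ (Tendsto.const_mul _ ?_)
      exact Real.tendsto_exp_neg_atTop_nhds_zero.comp (tendsto_id.const_mul_atTop hω)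
    have := ge_of_tendsto hlim (eventually_ge_atTop 0 |>.mono hbound)
    simpa using this
  have hall : ∀ h, D h = 0 := fun h => by
    have h1 : Tendsto (fun n => D (band n h)) atTop (𝓝 (D h)) :=
      (D.continuous.tendsto h).comp (tendsto_band h)
    refine tendsto_nhds_unique h1 ?_
    simp_rw [fun n => hzero n _ (bandLimited_band n h)]
    exact tendsto_const_nhds
  rw [← sub_eq_zero, ← hD]
  exact ContinuousLinearMap.ext hall

end Plant

/-! ### Real operators have Hermitian symbols -/

namespace Plant

variable {p : Plant}

/-- A real operator commutes with conjugation, so `star (m (-x))` is a second continuous symbol for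
it, and continuous symbols are unique. -/
lemma hermitian_of_real {T : L2 →L[ℂ] L2} {m : ℝ → ℂ} (hm : Continuous m)
    (hT : ∀ f, Sym m f (T f)) (hr : IsRealOperator (toPartial T)) (x : ℝ) :
    m (-x) = star (m x) := by
  have hm' : Continuous fun x => star (m (-x)) := by fun_prop
  have h1 : ∀ f, T (star f) = star (T f) := fun f => (hr ⟨f, trivial⟩).2
  have h2 : m = fun x => star (m (-x)) := symbol_unique hm hm' fun n f _ => ⟨T f, hT f, by
    have := (hT (star f)).star
    rwa [h1, star_star, star_star] at this⟩
  rw [congrFun h2 (-x), neg_neg]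

end Plant

/-! ### Functions of polynomial growth -/

lemma hasTemperateGrowth_polynomial (q : Polynomial ℂ) :
    Function.HasTemperateGrowth fun ξ : ℝ => q.eval ((2 * Real.pi * ξ : ℝ) : ℂ) := by
  have h0 : Function.HasTemperateGrowth fun ξ : ℝ => ((2 * Real.pi * ξ : ℝ) : ℂ) := by fun_prop
  induction q using Polynomial.induction_on' with
  | add q r hq hr => simp only [Polynomial.eval_add]; exact hq.fun_add hr
  | monomial n c =>
    simp only [Polynomial.eval_monomial]
    fun_prop

/-- A polynomial without real zeros is bounded away from zero on the real line. -/
lemma exists_pos_le_norm_eval (q : Polynomial ℂ) (hq : ∀ x : ℝ, q.eval (x : ℂ) ≠ 0) :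
    ∃ ε > 0, ∀ x : ℝ, ε ≤ ‖q.eval (x : ℂ)‖ := by
  rcases lt_or_ge 0 q.degree with hd | hd
  · have h1 : Tendsto (fun x : ℝ => ‖q.eval (x : ℂ)‖) (cocompact ℝ) atTop := by
      refine q.tendsto_norm_atTop hd ?_
      simp only [Complex.norm_real]
      exact tendsto_norm_cocompact_atTop
    have h2 : Continuous fun x : ℝ => ‖q.eval (x : ℂ)‖ := by fun_prop
    obtain ⟨x₀, h3⟩ := h2.exists_forall_le h1
    exact ⟨_, norm_pos_iff.2 (hq x₀), h3⟩
  · rw [Polynomial.eq_C_of_degree_le_zero hd] at hq ⊢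
    simp only [Polynomial.eval_C] at hq ⊢
    exact ⟨_, norm_pos_iff.2 (hq 0), fun _ => le_rfl⟩

section kernel

variable {l ρ : ℝ → ℂ} (hl : Continuous l) (hρ : ρ.HasTemperateGrowth)
  (hle : ∀ ξ, ‖l (2 * Real.pi * ξ)‖ ≤ ‖ρ ξ‖)
include hl hρ hle

lemma integrable_schwartz_mul (φ : 𝓢(ℝ, ℂ)) : Integrable fun ξ => φ ξ * l (2 * Real.pi * ξ) := by
  refine (SchwartzMap.integrable (SchwartzMap.smulLeftCLM ℂ ρ φ) (μ := volume)).mono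
    (by fun_prop) (ae_of_all _ fun ξ => ?_)
  rw [SchwartzMap.smulLeftCLM_apply_apply hρ, norm_mul, smul_eq_mul, norm_mul, mul_comm]
  exact mul_le_mul_of_nonneg_right (hle ξ) (norm_nonneg _)

lemma exists_sym_toLp (φ : 𝓢(ℝ, ℂ)) : ∃ g, Sym l (φ.toLp 2 volume) g := by
  refine exists_sym_of_le hl.measurable
    (SchwartzMap.memLp (SchwartzMap.smulLeftCLM ℂ ρ (𝓕 φ)) 2 volume).norm ?_
  rw [fourier_toLp]
  filter_upwards [(𝓕 φ).coeFn_toLp 2 volume] with ξ h1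
  rw [h1, SchwartzMap.smulLeftCLM_apply_apply hρ, norm_mul, smul_eq_mul, norm_mul]
  exact mul_le_mul_of_nonneg_right (hle ξ) (norm_nonneg _)

/-- The tempered distribution with the density `l (2πξ)`. -/
lemma exists_distribution (hρ0 : ∀ ξ, ρ ξ ≠ 0) :
    ∃ T : 𝓢'(ℝ, ℂ), ∀ φ : 𝓢(ℝ, ℂ), T φ = ∫ ξ : ℝ, φ ξ * l (2 * Real.pi * ξ) := by
  have hρc : Continuous ρ := hρ.1.continuous
  -- The quotient by ρ is bounded, hence a tempered distribution; multiplication by ρ, which has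
  -- temperate growth, restores the density `l`.
  have hmem : MemLp (fun ξ => l (2 * Real.pi * ξ) / ρ ξ) ∞ volume := by
    refine memLp_top_of_bound ?_ 1 (ae_of_all _ fun ξ => ?_)
    · exact ((hl.comp (by fun_prop)).div hρc hρ0).aestronglyMeasurable
    · rw [norm_div]
      exact div_le_one_of_le₀ (hle ξ) (norm_nonneg _)
  refine ⟨TemperedDistribution.smulLeftCLM ℂ ρ
    (Lp.toTemperedDistribution (hmem.toLp _)), fun φ => ?_⟩
  rw [TemperedDistribution.smulLeftCLM_apply_apply, Lp.toTemperedDistribution_apply]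
  refine integral_congr_ae ?_
  filter_upwards [hmem.coeFn_toLp] with ξ h1
  rw [h1, SchwartzMap.smulLeftCLM_apply_apply hρ]
  have := hρ0 ξ
  simp only [smul_eq_mul]
  field_simp

-- Reflection about `x` becomes the character of Fourier inversion, so pairing the kernel with
-- `reflectAt x φ` evaluates an inverse transform at `x`.
omit hρ hle hl in
lemma fourierInv_reflectAt (x : ℝ) (φ : 𝓢(ℝ, ℂ)) (ξ : ℝ) :
    𝓕⁻ (reflectAt x φ) ξ = Complex.exp (2 * Real.pi * (x * ξ) * Complex.I) * 𝓕 φ ξ := by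
  rw [SchwartzMap.fourierInv_coe, Real.fourierInv_eq', fourier_schwartz_apply,
    ← integral_const_mul, ← integral_sub_left_eq_self _ volume x]
  refine integral_congr_ae (ae_of_all _ fun v => ?_)
  have h1 : reflectAt x φ (x - v) = φ v := by simp [reflectAt]
  simp only [h1, RCLike.inner_apply, conj_trivial, smul_eq_mul]
  rw [← mul_assoc (Complex.exp _), ← Complex.exp_add]
  push_cast
  ring_nf

omit hρ hle hl in
/-- The inverse Fourier transform on `L²`, for an integrable transform. -/
lemma ae_eq_integral_of_integrable {g : L2} (hg : Integrable (𝓕 g : L2)) :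
    ∀ᵐ x : ℝ, g x =
      ∫ ξ : ℝ, Complex.exp (2 * Real.pi * (x * ξ) * Complex.I) * (𝓕 g : L2) ξ := by
  have h0 : ∀ x : ℝ, ∫ ξ : ℝ, Complex.exp (2 * Real.pi * (x * ξ) * Complex.I) * (𝓕 g : L2) ξ =
      𝓕⁻ ((𝓕 g : L2) : ℝ → ℂ) x := by
    intro x
    rw [Real.fourierInv_eq']
    refine integral_congr_ae (ae_of_all _ fun ξ => ?_)
    simp only [RCLike.inner_apply, conj_trivial, smul_eq_mul]
    push_cast
    rw [mul_assoc]
  simp_rw [h0]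
  have hcont : Continuous fun z : ℝ × ℝ => (-innerₗ ℝ) z.1 z.2 := by
    simp only [LinearMap.neg_apply, innerₗ_apply_apply]
    fun_prop
  -- Both sides are locally integrable, so smooth compactly supported test functions decide. The L²
  -- side goes to frequency space through tempered distributions and returns by the multiplication
  -- formula.
  refine ae_eq_of_integral_contDiff_smul_eq ((Lp.memLp g).locallyIntegrable one_le_two) ?_ ?_
  · exact (VectorFourier.fourierIntegral_continuous Real.continuous_fourierChar
      hcont hg).locallyIntegrable
  · intro ψ hψ hψc
    have hg₁ : HasCompactSupport (Complex.ofRealCLM ∘ ψ) := hψc.comp_left rfl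
    have hg₂ := Complex.ofRealCLM.contDiff.comp hψ
    set Ψ : 𝓢(ℝ, ℂ) := hg₁.toSchwartzMap hg₂
    have e1 : ∫ x, ψ x • g x = (Lp.toTemperedDistribution g : 𝓢'(ℝ, ℂ)) Ψ := by
      rw [Lp.toTemperedDistribution_apply]
      rfl
    have e2 : (Lp.toTemperedDistribution g : 𝓢'(ℝ, ℂ)) Ψ = ∫ ξ, 𝓕⁻ Ψ ξ • (𝓕 g : L2) ξ := by
      rw [← Lp.toTemperedDistribution_apply, ← Lp.fourier_toTemperedDistribution_eq,
        TemperedDistribution.fourier_apply, FourierTransform.fourier_fourierInv_eq]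
    have e3 : ∫ ξ, 𝓕⁻ Ψ ξ • (𝓕 g : L2) ξ = ∫ x, Ψ x • 𝓕⁻ ((𝓕 g : L2) : ℝ → ℂ) x := by
      have := VectorFourier.integral_fourierIntegral_smul_eq_flip (L := -innerₗ ℝ)
        Real.continuous_fourierChar hcont (Ψ.integrable (μ := volume)) hg
      rw [show (-innerₗ ℝ : ℝ →ₗ[ℝ] ℝ →ₗ[ℝ] ℝ).flip = -innerₗ ℝ by ext; simp] at this
      rw [SchwartzMap.fourierInv_coe]
      exact this
    rw [e1, e2, e3]
    rfl

/-- An operator with a symbol of polynomial growth is a convolution. -/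
lemma exists_kernel (hρ0 : ∀ ξ, ρ ξ ≠ 0) (hsym : ∀ x, l (-x) = star (l x)) {L : L2 →ₗ.[ℂ] L2}
    (hL : ∀ f : L.domain, Sym l f (L f)) (hd : ∀ φ : 𝓢(ℝ, ℂ), φ.toLp 2 volume ∈ L.domain) :
    ∃ K : 𝓢'(ℝ, ℂ), IsSpatialConvolution L K ∧ KernelHasSymbol K l := by
  obtain ⟨T, hT⟩ := exists_distribution hl hρ hle hρ0
  refine ⟨𝓕⁻ T, ⟨fun φ hφ => ?_, fun φ => ⟨hd φ, ?_⟩⟩, fun φ => ⟨integrable_schwartz_mul hl hρ hle φ, ?_⟩⟩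
  -- The kernel is real because conjugation followed by ξ ↦ -ξ leaves the integral unchanged: both
  -- `l` and the transform of a real function are Hermitian.
  · rw [TemperedDistribution.fourierInv_apply, hT, ← Complex.conj_eq_iff_im, ← integral_conj,
      ← integral_neg_eq_self]
    refine integral_congr_ae (ae_of_all _ fun ξ => ?_)
    have h1 : ∀ ξ, 𝓕⁻ φ ξ = 𝓕 φ (-ξ) := fun ξ => by
      rw [SchwartzMap.fourierInv_coe, Real.fourierInv_eq_fourier_neg, SchwartzMap.fourier_coe]
    have h2 := fourier_conj_integral φ φ (fun x => (Complex.conj_eq_iff_im.2 (hφ x)).symm) (-ξ)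
    simp only [map_mul, h1, mul_neg, hsym, neg_neg] at h2 ⊢
    rw [h2]
    simp
  · have hs := hL ⟨_, hd φ⟩
    set g := L ⟨_, hd φ⟩
    have h1 : ∀ᵐ ξ, (𝓕 g : L2) ξ = 𝓕 φ ξ * l (2 * Real.pi * ξ) := by
      have h2 := hs
      simp only [Sym, fourier_toLp] at h2
      filter_upwards [h2, (𝓕 φ).coeFn_toLp 2 volume] with ξ h3 h4
      rw [h3, h4, mul_comm]
    have h2 : Integrable (𝓕 g : L2) :=
      (integrable_schwartz_mul hl hρ hle (𝓕 φ)).congr (h1.mono fun _ h => h.symm)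
    filter_upwards [ae_eq_integral_of_integrable h2] with x h3
    rw [h3, TemperedDistribution.fourierInv_apply, hT]
    refine integral_congr_ae ?_
    filter_upwards [h1] with ξ h4
    rw [h4, fourierInv_reflectAt, ← mul_assoc]
  · rw [FourierTransform.fourier_fourierInv_eq, hT]

end kernel

namespace Plant

variable {p : Plant}

lemma Admissible.symA_neg (hp : p.Admissible) (x : ℝ) : p.symA (-x) = star (p.symA x) := by
  have h2 : p.symA = fun x => star (p.symA (-x)) :=
    symbol_unique hp.continuous_symA (by have := hp.continuous_symA; fun_prop) fun n f hf => by
      have hf' := hp.bandLimited_mem_A_domain hf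
      refine ⟨p.A ⟨f, hf'⟩, hp.A_sym _, ?_⟩
      obtain ⟨h1, h2⟩ := hp.real_A ⟨f, hf'⟩
      have h3 := (hp.A_sym ⟨_, h1⟩).star
      rw [h2] at h3
      simpa only [star_star] using h3
  rw [congrFun h2 (-x), neg_neg]

lemma Admissible.symB_neg (hp : p.Admissible) (x : ℝ) : p.symB (-x) = star (p.symB x) :=
  hermitian_of_real hp.continuous_symB hp.B_sym hp.real_B x

lemma Admissible.symC_neg (hp : p.Admissible) (x : ℝ) : p.symC (-x) = star (p.symC x) :=
  hermitian_of_real hp.continuous_symC hp.C_sym hp.real_C x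

lemma Admissible.symG_neg (hp : p.Admissible) (x : ℝ) : p.symG (-x) = star (p.symG x) :=
  hermitian_of_real hp.continuous_symG hp.G_sym hp.real_G x

lemma Admissible.quadCoeff_neg (hp : p.Admissible) (x : ℝ) :
    p.quadCoeff (-x) = p.quadCoeff x := by
  simp only [quadCoeff, hp.symC_neg, hp.symG_neg, norm_star]

lemma Admissible.decayRate_neg (hp : p.Admissible) (x : ℝ) :
    p.decayRate (-x) = p.decayRate x := by
  simp only [decayRate, hp.symA_neg, hp.symB_neg, hp.quadCoeff_neg, RCLike.star_def,
    RCLike.norm_conj, Complex.conj_re]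

lemma Admissible.riccatiSymbol_neg (hp : p.Admissible) (x : ℝ) :
    p.riccatiSymbol (-x) = p.riccatiSymbol x := by
  simp only [riccatiSymbol, hp.symA_neg, hp.decayRate_neg, hp.quadCoeff_neg, RCLike.star_def,
    Complex.conj_re]

lemma Admissible.gainSymbol_neg (hp : p.Admissible) (x : ℝ) :
    p.gainSymbol (-x) = star (p.gainSymbol x) := by
  simp only [gainSymbol, hp.riccatiSymbol_neg, hp.symC_neg, hp.symG_neg, star_div₀,
    star_mul', RCLike.star_def, RCLike.norm_conj, Complex.conj_ofReal]

/-- Writing G = num/den, the numerator is bounded away from zero, so 1/|G|² is at most a constant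
times |den|². The same ρ bounds the symbol of the gain, for the kernel, and that of (GG*)⁻¹, which
puts Schwartz functions in the domain and shows that ρ has no zeros. -/
lemma Admissible.exists_temperate_bound (hp : p.Admissible) :
    ∃ ρ : ℝ → ℂ, ρ.HasTemperateGrowth ∧ ∀ ξ, ‖p.gainSymbol (2 * Real.pi * ξ)‖ ≤ ‖ρ ξ‖ ∧
      ‖(((‖p.symG (2 * Real.pi * ξ)‖ ^ 2 : ℝ) : ℂ))⁻¹‖ ≤ ‖ρ ξ‖ := by
  obtain ⟨num, den, -, hn, hd, hg⟩ := hp.rational_G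
  obtain ⟨ε, hε, hle⟩ := exists_pos_le_norm_eval num hn
  obtain ⟨δ, -, c, hc⟩ := hp.exists_decayRate_ge_and_riccatiSymbol_le
  have hc0 : 0 ≤ c := (hp.riccatiSymbol_pos 0).le.trans (hc 0).2
  have hden := hasTemperateGrowth_polynomial den
  refine ⟨fun ξ => (((1 + c * ‖p.C‖) / ε ^ 2 : ℝ) : ℂ) *
    den.eval ((2 * Real.pi * ξ : ℝ) : ℂ) ^ 2, by fun_prop, fun ξ => ?_⟩
  set x := 2 * Real.pi * ξ
  have h1 : (‖p.symG x‖ ^ 2)⁻¹ ≤ ‖den.eval (x : ℂ)‖ ^ 2 / ε ^ 2 := by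
    rw [hg, norm_div, div_pow, inv_div]
    have := hle x
    gcongr
  have h2 : ‖(((1 + c * ‖p.C‖) / ε ^ 2 : ℝ) : ℂ) * den.eval (x : ℂ) ^ 2‖ =
      (1 + c * ‖p.C‖) * (‖den.eval (x : ℂ)‖ ^ 2 / ε ^ 2) := by
    rw [norm_mul, norm_pow, Complex.norm_real, Real.norm_of_nonneg (by positivity)]
    ring
  have h3 : p.riccatiSymbol x * ‖p.symC x‖ ≤ c * ‖p.C‖ :=
    mul_le_mul (hc x).2 (hp.norm_symC_le x) (norm_nonneg _) hc0
  have h4 : 0 ≤ (‖p.symG x‖ ^ 2)⁻¹ := by positivity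
  have h5 : 0 ≤ c * ‖p.C‖ := by positivity
  rw [h2, norm_inv, Complex.norm_real, Real.norm_of_nonneg (by positivity)]
  constructor
  · rw [gainSymbol, norm_div, norm_mul, norm_star, Complex.norm_real, Complex.norm_real,
      Real.norm_of_nonneg (hp.riccatiSymbol_pos x).le, Real.norm_of_nonneg (by positivity),
      div_eq_mul_inv]
    exact mul_le_mul (by linarith) h1 h4 (by linarith)
  · nlinarith

lemma Admissible.exists_convolution_kernel (hp : p.Admissible) :
    ∃ K : 𝓢'(ℝ, ℂ), IsSpatialConvolution (p.gain p.riccatiOp) K ∧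
      KernelHasSymbol K p.gainSymbol := by
  obtain ⟨ρ, hρ, hle⟩ := hp.exists_temperate_bound
  refine exists_kernel hp.continuous_gainSymbol hρ (fun ξ => (hle ξ).1) (fun ξ h0 => ?_)
    hp.gainSymbol_neg hp.gain_sym fun φ => ?_
  · have h1 := (hle ξ).2
    rw [h0, norm_zero, norm_le_zero_iff] at h1
    exact inv_ne_zero (hp.normG_sq_ne_zero _) h1
  · obtain ⟨g, hg⟩ := exists_sym_toLp hp.continuous_inv_normG_sq hρ (fun ξ => (hle ξ).2) φ
    exact (mem_domain_of_eq_maxMul hp.invGG_eq hg).1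

end Plant

/-! ### Gaussian inputs -/

lemma condExp_add_of_indep {Ω : Type*} {m mΩ : MeasurableSpace Ω} {μ : Measure Ω}
    [IsProbabilityMeasure μ] (hm : m ≤ mΩ) {D Y : Ω → ℝ} (hD : Measurable D)
    (hDi : Integrable D μ) (hD0 : ∫ ω, D ω ∂μ = 0) (hY : Measurable[m] Y) (hYi : Integrable Y μ)
    (h : Indep (MeasurableSpace.comap D inferInstance) m μ) : μ[D + Y | m] =ᵐ[μ] Y := by
  have h1 : μ[D | m] =ᵐ[μ] fun _ => ∫ ω, D ω ∂μ :=
    condExp_indep_eq hD.comap_le hm (Measurable.of_comap_le le_rfl).stronglyMeasurable h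
  have h2 : μ[Y | m] = Y := condExp_of_stronglyMeasurable hm hY.stronglyMeasurable hYi
  filter_upwards [h1, condExp_add hDi hYi m] with ω e1 e2
  rw [e2, Pi.add_apply, e1, h2, hD0, zero_add]

lemma norm_toLp_sq {Ω : Type*} {mΩ : MeasurableSpace Ω} {μ : Measure Ω} {Z : Ω → ℝ}
    (hZ : MemLp Z 2 μ) : ‖hZ.toLp Z‖ ^ 2 = ∫ ω, Z ω ^ 2 ∂μ := by
  rw [← real_inner_self_eq_norm_sq, L2.inner_def]
  refine integral_congr_ae ?_
  filter_upwards [hZ.coeFn_toLp] with ω h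
  rw [h, real_inner_self_eq_norm_sq, Real.norm_eq_abs, sq_abs]

/-- The mean square error of the conditional expectation is continuous on `L²`. -/
lemma tendsto_integral_sub_condExp_sq {Ω : Type*} {m mΩ : MeasurableSpace Ω} {μ : Measure Ω}
    [IsProbabilityMeasure μ] {X : Ω → ℝ} {Xs : ℕ → Ω → ℝ}
    (hX : MemLp X 2 μ) (hXs : ∀ n, MemLp (Xs n) 2 μ)
    (h : Tendsto (fun n => ∫ ω, (Xs n ω - X ω) ^ 2 ∂μ) atTop (𝓝 0)) :
    Tendsto (fun n => ∫ ω, (Xs n ω - (μ[Xs n | m]) ω) ^ 2 ∂μ) atTop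
      (𝓝 (∫ ω, (X ω - (μ[X | m]) ω) ^ 2 ∂μ)) := by
  have hd (Z : Ω → ℝ) (hZ : MemLp Z 2 μ) : MemLp (Z - μ[Z | m]) 2 μ :=
    hZ.sub (hZ.condExp one_le_two)
  have e (Z : Ω → ℝ) (hZ : MemLp Z 2 μ) :
      ∫ ω, (Z ω - (μ[Z | m]) ω) ^ 2 ∂μ = ‖(hd Z hZ).toLp‖ ^ 2 := (norm_toLp_sq (hd Z hZ)).symm
  -- The residual is linear in the variable and conditional expectation contracts L², hence the
  -- factor 2.
  have hle (n : ℕ) : ‖(hd _ (hXs n)).toLp - (hd X hX).toLp‖ ≤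
      2 * ‖((hXs n).sub hX).toLp‖ := by
    have hs := (hXs n).sub hX
    have h1 : (hd _ (hXs n)).toLp - (hd X hX).toLp =
        hs.toLp - (hs.condExp (m := m) one_le_two).toLp := by
      rw [← MemLp.toLp_sub, ← MemLp.toLp_sub]
      refine MemLp.toLp_congr _ _ ?_
      filter_upwards [condExp_sub ((hXs n).integrable one_le_two) (hX.integrable one_le_two) m]
        with ω h2
      simp only [Pi.sub_apply] at h2 ⊢
      rw [h2]; ring
    have h2 : ‖(hs.condExp (m := m) one_le_two).toLp‖ ≤ ‖hs.toLp‖ := by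
      rw [Lp.norm_toLp, Lp.norm_toLp]
      exact ENNReal.toReal_mono hs.2.ne (eLpNorm_condExp_le_eLpNorm _ one_le_two)
    rw [h1, two_mul]
    exact (norm_sub_le _ _).trans (by gcongr)
  have h0 : Tendsto (fun n => 2 * ‖((hXs n).sub hX).toLp‖) atTop (𝓝 0) := by
    have h1 : ∀ n, ‖((hXs n).sub hX).toLp‖ = √(∫ ω, (Xs n ω - X ω) ^ 2 ∂μ) := fun n => by
      rw [← Real.sqrt_sq (norm_nonneg ((hXs n).sub hX).toLp), norm_toLp_sq]; rfl
    simp_rw [h1]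
    simpa using (h.sqrt).const_mul 2
  have h1 : Tendsto (fun n => (hd _ (hXs n)).toLp) atTop (𝓝 ((hd X hX).toLp)) := by
    rw [tendsto_iff_norm_sub_tendsto_zero]
    exact squeeze_zero (fun _ => norm_nonneg _) hle h0
  rw [e X hX]
  simp_rw [fun n => e _ (hXs n)]
  exact h1.norm.pow 2

namespace Inputs

/-- Test functions for the initial state and for the two noises. -/
abbrev Test : Type := RealField × RealSignal × RealSignal

variable {Ω : Type*} (N : Inputs Ω)

/-- The three random inputs, tested against the components of `θ`. -/
def part (θ : Test) : Fin 3 → Ω → ℝ := ![N.init θ.1.1, N.w θ.2.1.1, N.v θ.2.2.1]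

/-- The sum of the three random inputs, tested against the components of `θ`. -/
def total (θ : Test) (ω : Ω) : ℝ := N.init θ.1.1 ω + N.w θ.2.1.1 ω + N.v θ.2.2.1 ω

lemma total_eq_sum (θ : Test) (ω : Ω) : N.total θ ω = ∑ i, N.part θ i ω := by
  simp [total, part, Fin.sum_univ_three]

/-- The covariance of the inputs. -/
def cov (θ θ' : Test) : ℝ :=
  (inner ℂ θ.1.1 θ'.1.1).re +
    (∫ t in Set.Ici (0 : ℝ), (inner ℂ (θ.2.1.1 t) (θ'.2.1.1 t)).re) +
    ∫ t in Set.Ici (0 : ℝ), (inner ℂ (θ.2.2.1 t) (θ'.2.2.1 t)).re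

namespace IsWhite

variable {N} [MeasurableSpace Ω] {μ : Measure Ω} (hN : N.IsWhite μ)
include hN

lemma isGaussianProcess_part (i : Fin 3) : IsGaussianProcess (fun θ => N.part θ i) μ := by
  fin_cases i
  · exact hN.init.gaussian.comp_right fun θ : Test => θ.1
  · exact hN.w.gaussian.comp_right fun θ : Test => θ.2.1
  · exact hN.v.gaussian.comp_right fun θ : Test => θ.2.2

lemma measurable_part (i : Fin 3) (θ : Test) : Measurable (N.part θ i) := by
  fin_cases i
  · exact hN.init.measurable θ.1
  · exact hN.w.measurable θ.2.1
  · exact hN.v.measurable θ.2.2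

lemma measurable_total (θ : Test) : Measurable (N.total θ) := by
  have : N.total θ = fun ω => ∑ i, N.part θ i ω := funext fun ω => N.total_eq_sum θ ω
  rw [this]
  exact Finset.measurable_fun_sum _ fun i _ => hN.measurable_part i θ

lemma iIndep_part : iIndep (fun i => generatedBy fun θ => N.part θ i) μ := by
  refine iIndep_of_iIndep_of_le hN.indep fun i => iSup_le fun θ => ?_
  fin_cases i
  · exact le_iSup (fun f : RealField => MeasurableSpace.comap (N.init f.1) inferInstance) θ.1
  · exact le_iSup (fun f : RealSignal => MeasurableSpace.comap (N.w f.1) inferInstance) θ.2.1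
  · exact le_iSup (fun f : RealSignal => MeasurableSpace.comap (N.v f.1) inferInstance) θ.2.2

/-- Independence of the three Gaussian inputs makes them jointly Gaussian. This is what lets
uncorrelated errors be independent of the observations. -/
lemma isGaussianProcess_total : IsGaussianProcess N.total μ where
  hasGaussianLaw I := by
    have h1 : iIndepFun (fun i ω => I.restrict (fun θ => N.part θ i ω)) μ := by
      rw [iIndepFun_iff_iIndep]
      refine iIndep_of_iIndep_of_le hN.iIndep_part fun i => ?_
      rw [← measurable_iff_comap_le]
      refine @measurable_pi_lambda _ _ _ (_) _ _ fun θ => ?_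
      exact (Measurable.of_comap_le le_rfl).mono
        (le_iSup (fun θ => MeasurableSpace.comap (N.part θ i) inferInstance) θ.1) le_rfl
    have h2 := iIndepFun.hasGaussianLaw_fun_sum
      (fun i => (hN.isGaussianProcess_part i).hasGaussianLaw I) h1
    convert! h2 using 2 with ω
    ext θ
    simp [total_eq_sum]

lemma memLp_part (i : Fin 3) (θ : Test) : MemLp (N.part θ i) 2 μ :=
  ((hN.isGaussianProcess_part i).hasGaussianLaw_eval θ).memLp_two

lemma memLp_total (θ : Test) : MemLp (N.total θ) 2 μ :=
  (hN.isGaussianProcess_total.hasGaussianLaw_eval θ).memLp_two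

lemma integral_part (i : Fin 3) (θ : Test) : ∫ ω, N.part θ i ω ∂μ = 0 := by
  fin_cases i
  · exact hN.init.mean θ.1
  · exact hN.w.mean θ.2.1
  · exact hN.v.mean θ.2.2

lemma integral_part_mul_part {i j : Fin 3} (hij : i ≠ j) (θ θ' : Test) :
    ∫ ω, N.part θ i ω * N.part θ' j ω ∂μ = 0 := by
  have h1 : IndepFun (N.part θ i) (N.part θ' j) μ := by
    rw [IndepFun_iff_Indep]
    refine indep_of_indep_of_le_left (indep_of_indep_of_le_right (hN.iIndep_part.indep hij) ?_) ?_
    · exact le_iSup (fun θ => MeasurableSpace.comap (N.part θ j) inferInstance) θ'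
    · exact le_iSup (fun θ => MeasurableSpace.comap (N.part θ i) inferInstance) θ
  rw [h1.integral_fun_mul_eq_mul_integral (hN.measurable_part i θ).aestronglyMeasurable
    (hN.measurable_part j θ').aestronglyMeasurable, hN.integral_part, zero_mul]

lemma integral_total (θ : Test) : ∫ ω, N.total θ ω ∂μ = 0 := by
  have := hN.isGaussianProcess_total.isProbabilityMeasure
  simp_rw [total_eq_sum]
  rw [integral_finsetSum _ fun i _ => (hN.memLp_part i θ).integrable one_le_two]
  simp [hN.integral_part]

lemma integral_total_mul_total (θ θ' : Test) :
    ∫ ω, N.total θ ω * N.total θ' ω ∂μ = cov θ θ' := by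
  have hi (i j : Fin 3) : Integrable (fun ω => N.part θ i ω * N.part θ' j ω) μ :=
    (hN.memLp_part i θ).integrable_mul (hN.memLp_part j θ')
  simp_rw [total_eq_sum, Finset.sum_mul_sum]
  rw [integral_finsetSum _ fun i _ => integrable_finsetSum _ fun j _ => hi i j]
  have h1 (i : Fin 3) : ∫ ω, ∑ j, N.part θ i ω * N.part θ' j ω ∂μ =
      ∫ ω, N.part θ i ω * N.part θ' i ω ∂μ := by
    rw [integral_finsetSum _ fun j _ => hi i j]
    exact Finset.sum_eq_single i (fun j _ hj => hN.integral_part_mul_part hj.symm θ θ') (by simp)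
  simp_rw [h1]
  rw [Fin.sum_univ_three, cov]
  congr 2
  · exact hN.init.covariance θ.1 θ'.1
  · exact hN.w.covariance θ.2.1 θ'.2.1
  · exact hN.v.covariance θ.2.2 θ'.2.2

/-- Gaussian regression: the conditional expectation is the linear estimate with uncorrelated
error. -/
lemma condExp_eq {κ : Type*} (θ : κ → Test) (θ₀ : Test) (k₀ : κ)
    (h : ∀ k, cov θ₀ (θ k) = cov (θ k₀) (θ k)) :
    μ[N.total θ₀ | generatedBy fun k => N.total (θ k)] =ᵐ[μ] N.total (θ k₀) := by
  have hprob := hN.isGaussianProcess_total.isProbabilityMeasure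
  -- The error is made a process with one index so that, for jointly Gaussian processes, zero
  -- covariance with each observation yields independence from all of them together.
  set D : Unit → Ω → ℝ := fun _ ω => N.total θ₀ ω - N.total (θ k₀) ω with hD
  set Y : κ → Ω → ℝ := fun k => N.total (θ k)
  have hDmem : MemLp (D ()) 2 μ := (hN.memLp_total θ₀).sub (hN.memLp_total (θ k₀))
  have hDm : Measurable (D ()) := (hN.measurable_total θ₀).sub (hN.measurable_total (θ k₀))
  have hDint : ∫ ω, D () ω ∂μ = 0 := by
    simp only [hD]
    rw [integral_sub ((hN.memLp_total θ₀).integrable one_le_two)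
      ((hN.memLp_total (θ k₀)).integrable one_le_two), hN.integral_total, hN.integral_total,
      sub_zero]
  have hgauss : IsGaussianProcess (Sum.elim D Y) μ := by
    classical
    refine hN.isGaussianProcess_total.of_isGaussianProcess fun s => ?_
    rcases s with _ | k
    · refine ⟨{θ₀, θ k₀}, ContinuousLinearMap.proj ⟨θ₀, by simp⟩ -
        ContinuousLinearMap.proj ⟨θ k₀, by simp⟩, fun ω => rfl⟩
    · exact ⟨{θ k}, ContinuousLinearMap.proj ⟨θ k, by simp⟩, fun ω => rfl⟩
  have hindep : IndepFun (fun ω s => D s ω) (fun ω k => Y k ω) μ := by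
    refine hgauss.indepFun_of_covariance_eq_zero (fun _ => hDm.aemeasurable)
      (fun k => (hN.measurable_total (θ k)).aemeasurable) fun _ k => ?_
    rw [covariance_eq_sub hDmem (hN.memLp_total (θ k)), hDint, zero_mul, sub_zero]
    have : D () * Y k =
        fun ω => N.total θ₀ ω * N.total (θ k) ω - N.total (θ k₀) ω * N.total (θ k) ω :=
      funext fun ω => sub_mul _ _ _
    rw [this]
    refine (integral_sub ((hN.memLp_total θ₀).integrable_mul (hN.memLp_total (θ k)))
      ((hN.memLp_total (θ k₀)).integrable_mul (hN.memLp_total (θ k)))).trans ?_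
    rw [sub_eq_zero]
    exact (hN.integral_total_mul_total θ₀ (θ k)).trans
      ((h k).trans (hN.integral_total_mul_total (θ k₀) (θ k)).symm)
  have hI : Indep (MeasurableSpace.comap (D ()) inferInstance) (generatedBy Y) μ := by
    rw [IndepFun_iff_Indep] at hindep
    refine indep_of_indep_of_le_left (indep_of_indep_of_le_right hindep ?_) ?_
    · refine iSup_le fun k => ?_
      have : Y k = (fun y : κ → ℝ => y k) ∘ fun ω k => Y k ω := rfl
      rw [this, ← MeasurableSpace.comap_comp]
      exact MeasurableSpace.comap_mono (measurable_pi_apply k).comap_le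
    · have : D () = (fun y : Unit → ℝ => y ()) ∘ fun ω s => D s ω := rfl
      rw [this, ← MeasurableSpace.comap_comp]
      exact MeasurableSpace.comap_mono (measurable_pi_apply ()).comap_le
  have h3 : N.total θ₀ = D () + N.total (θ k₀) := by
    funext ω; simp [hD]
  rw [h3]
  exact condExp_add_of_indep (iSup_le fun k => (hN.measurable_total (θ k)).comap_le) hDm
    (hDmem.integrable one_le_two) hDint
    ((Measurable.of_comap_le le_rfl).mono
      (le_iSup (fun k => MeasurableSpace.comap (Y k) inferInstance) k₀) le_rfl)
    ((hN.memLp_total (θ k₀)).integrable one_le_two) hI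

end IsWhite

end Inputs

/-! ### Reality -/

lemma star_apply_of_hermitian {T : L2 →L[ℂ] L2} {m : ℝ → ℂ} (hT : ∀ f, Sym m f (T f))
    (hm : ∀ x, m (-x) = star (m x)) (f : L2) : T (star f) = star (T f) :=
  (hT (star f)).unique ((hT f).star.congr fun x => by rw [hm, star_star])

lemma integral_star_L2 {X : Type*} {mX : MeasurableSpace X} (μ : Measure X) (φ : X → L2) :
    ∫ x, (star (φ x) : L2) ∂μ = star (∫ x, φ x ∂μ) :=
  conjL.integral_comp_comm φ

lemma inner_eq_re_of_real {f g : L2} (hf : star f = f) (hg : star g = g) :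
    (inner ℂ f g : ℂ) = ((inner ℂ f g).re : ℂ) := by
  have h := inner_star_star f g
  rw [hf, hg] at h
  exact (Complex.conj_eq_iff_re.1 h.symm).symm

lemma integrable_inner_of_memLp {X : Type*} {mX : MeasurableSpace X} {μ : Measure X}
    {f g : X → L2} (hf : MemLp f 2 μ) (hg : MemLp g 2 μ) :
    Integrable (fun x => inner ℂ (f x) (g x)) μ := by
  refine (hf.norm.integrable_mul hg.norm).mono' (hf.1.inner hg.1) (ae_of_all _ fun x => ?_)
  exact norm_inner_le_norm _ _

/-! ### The flow of the plant -/

lemma IsC0Semigroup.continuous_apply_max {S : ℝ → L2 →L[ℂ] L2} (hS : IsC0Semigroup S) :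
    Continuous fun z : ℝ × L2 => S (max z.1 0) z.2 :=
  hS.continuousOn_uncurry.comp_continuous
    (f := fun z : ℝ × L2 => (max z.1 0, z.2)) (by fun_prop) fun z =>
      ⟨Set.mem_Ici.2 (le_max_right z.1 0), Set.mem_univ _⟩

namespace Plant

/-- The semigroup of the plant, extended to negative times by the identity. -/
def flow (p : Plant) (t : ℝ) : L2 →L[ℂ] L2 := p.S (max t 0)

/-- The adjoint semigroup, extended to negative times by the identity. -/
def dualFlow (p : Plant) (t : ℝ) : L2 →L[ℂ] L2 := ContinuousLinearMap.adjoint (p.S (max t 0))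

variable {p : Plant}

lemma inner_dualFlow (t : ℝ) (f g : L2) :
    inner ℂ f (p.dualFlow t g) = inner ℂ (p.flow t f) g :=
  ContinuousLinearMap.adjoint_inner_right _ _ _

lemma adjoint_S_eq {t : ℝ} (ht : 0 ≤ t) : ContinuousLinearMap.adjoint (p.S t) = p.dualFlow t := by
  rw [dualFlow, max_eq_left ht]

lemma Admissible.flow_sym (hp : p.Admissible) {t : ℝ} (ht : 0 ≤ t) (f : L2) :
    Sym (fun x => Complex.exp (t * p.symA x)) f (p.flow t f) := by
  rw [flow, max_eq_left ht]
  exact hp.S_sym ht f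

lemma Admissible.dualFlow_sym (hp : p.Admissible) {t : ℝ} (ht : 0 ≤ t) (f : L2) :
    Sym (fun x => Complex.exp (t * star (p.symA x))) f (p.dualFlow t f) := by
  rw [dualFlow, max_eq_left ht]
  exact hp.adjoint_S_sym ht f

lemma Admissible.dualFlow_eq (hp : p.Admissible) (t : ℝ) :
    p.dualFlow t = mulSemigroup (fun x => star (p.symA x)) (max t 0) := by
  obtain ⟨ω, hω⟩ := hp.exists_re_symA_le
  ext1 f
  refine (hp.adjoint_S_sym (le_max_right t 0) f).unique
    (mulSemigroup_sym (continuous_star.comp hp.continuous_symA) (ω := ω) (fun x => ?_)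
      (le_max_right t 0) f)
  simpa using hω x

lemma Admissible.continuous_dualFlow_apply (hp : p.Admissible) :
    Continuous fun z : ℝ × L2 => p.dualFlow z.1 z.2 := by
  obtain ⟨ω, hω⟩ := hp.exists_re_symA_le
  simp_rw [hp.dualFlow_eq]
  exact (mulSemigroup_isC0Semigroup (continuous_star.comp hp.continuous_symA)
    (ω := ω) (fun x => by simpa using hω x)).continuous_apply_max

lemma Admissible.continuous_flow_apply (hp : p.Admissible) :
    Continuous fun z : ℝ × L2 => p.flow z.1 z.2 := hp.semigroup.continuous_apply_max

lemma Admissible.exists_norm_dualFlow_le (hp : p.Admissible) (T : ℝ) :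
    ∃ c, ∀ t ≤ T, ‖p.dualFlow t‖ ≤ c := by
  obtain ⟨c, hc⟩ := hp.semigroup.exists_bound (max T 0)
  refine ⟨c, fun t ht => ?_⟩
  rw [dualFlow, ContinuousLinearMap.adjoint.norm_map]
  exact hc _ (le_max_right _ _) (max_le_max_right 0 ht)

lemma Admissible.star_dualFlow (hp : p.Admissible) (t : ℝ) (f : L2) :
    p.dualFlow t (star f) = star (p.dualFlow t f) :=
  star_apply_of_hermitian (fun f => hp.adjoint_S_sym (le_max_right t 0) f) (fun x => by
    simp [hp.symA_neg, ← Complex.exp_conj]) f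

lemma Admissible.star_adjoint_B (hp : p.Admissible) (f : L2) :
    ContinuousLinearMap.adjoint p.B (star f) = star (ContinuousLinearMap.adjoint p.B f) :=
  star_apply_of_hermitian hp.adjoint_B_sym (fun x => by rw [hp.symB_neg]) f

lemma Admissible.star_adjoint_C (hp : p.Admissible) (f : L2) :
    ContinuousLinearMap.adjoint p.C (star f) = star (ContinuousLinearMap.adjoint p.C f) :=
  star_apply_of_hermitian hp.adjoint_C_sym (fun x => by rw [hp.symC_neg]) f

lemma Admissible.star_adjoint_G (hp : p.Admissible) (f : L2) :
    ContinuousLinearMap.adjoint p.G (star f) = star (ContinuousLinearMap.adjoint p.G f) :=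
  star_apply_of_hermitian hp.adjoint_G_sym (fun x => by rw [hp.symG_neg]) f

/-! ### Backward integrals -/

section backward

variable {T : ℝ} {K : ℝ → L2}

/-- The integrand of the backward integrals. -/
def backwardKernel (p : Plant) (K : ℝ → L2) : ℝ × ℝ → L2 :=
  {z : ℝ × ℝ | z.1 ≤ z.2}.indicator fun z => p.dualFlow (z.2 - z.1) (K z.2)

lemma measurableSet_le_prod : MeasurableSet {z : ℝ × ℝ | z.1 ≤ z.2} :=
  measurableSet_le measurable_fst measurable_snd

lemma integrable_of_norm_le_snd {ν : Measure ℝ} [IsFiniteMeasure ν] {κ : ℝ × ℝ → L2} {c : ℝ}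
    (hκ : AEStronglyMeasurable κ (ν.prod ν)) (hK : Integrable K ν)
    (hle : ∀ᵐ z ∂ν.prod ν, ‖κ z‖ ≤ c * ‖K z.2‖) : Integrable κ (ν.prod ν) :=
  ((hK.norm.const_mul c).comp_snd ν).mono' hκ hle

lemma aestronglyMeasurable_indicator_apply {ν : Measure ℝ} [IsFiniteMeasure ν]
    {F : ℝ → L2 →L[ℂ] L2} (hF : Continuous fun z : ℝ × L2 => F z.1 z.2)
    (hK : AEStronglyMeasurable K ν) :
    AEStronglyMeasurable ({z : ℝ × ℝ | z.1 ≤ z.2}.indicator fun z => F (z.2 - z.1) (K z.2))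
      (ν.prod ν) := by
  have h1 : AEStronglyMeasurable (fun z : ℝ × ℝ => K z.2) (ν.prod ν) := hK.comp_snd
  have h2 : AEStronglyMeasurable (fun z : ℝ × ℝ => z.2 - z.1) (ν.prod ν) :=
    Continuous.aestronglyMeasurable (by fun_prop)
  have h3 : AEStronglyMeasurable (fun z : ℝ × ℝ => F (z.2 - z.1) (K z.2)) (ν.prod ν) :=
    hF.comp_aestronglyMeasurable (h2.prodMk h1)
  exact h3.indicator measurableSet_le_prod

lemma Admissible.integrable_backwardKernel (hp : p.Admissible)
    (hK : Integrable K (volume.restrict (Set.Icc 0 T))) :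
    Integrable (p.backwardKernel K)
      ((volume.restrict (Set.Icc 0 T)).prod (volume.restrict (Set.Icc 0 T))) := by
  obtain ⟨c, hc⟩ := hp.exists_norm_dualFlow_le T
  refine integrable_of_norm_le_snd (c := c)
    (aestronglyMeasurable_indicator_apply hp.continuous_dualFlow_apply hK.1) hK ?_
  rw [Measure.prod_restrict]
  filter_upwards [ae_restrict_mem (measurableSet_Icc.prod measurableSet_Icc)] with z hz
  have h4 : ‖p.dualFlow (z.2 - z.1)‖ ≤ c := hc (z.2 - z.1) (by linarith [hz.1.1, hz.2.2])
  exact (norm_indicator_le_norm_self _ _).trans ((p.dualFlow _).le_of_opNorm_le h4 _)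

lemma integral_backwardKernel {s : ℝ} (hs : 0 ≤ s) :
    ∫ τ in Set.Icc 0 T, p.backwardKernel K (s, τ) =
      ∫ τ in Set.Icc s T, p.dualFlow (τ - s) (K τ) := by
  have h1 : ∀ τ, p.backwardKernel K (s, τ) =
      (Set.Ici s).indicator (fun τ => p.dualFlow (τ - s) (K τ)) τ := fun τ => by
    simp [backwardKernel, Set.indicator]
  simp_rw [h1]
  rw [setIntegral_indicator measurableSet_Ici]
  congr 2
  ext τ
  simp only [Set.mem_inter_iff, Set.mem_Icc, Set.mem_Ici]
  constructor
  · rintro ⟨⟨_, h2⟩, h3⟩; exact ⟨h3, h2⟩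
  · rintro ⟨h2, h3⟩; exact ⟨⟨hs.trans h2, h3⟩, h2⟩

lemma Admissible.aestronglyMeasurable_backward (hp : p.Admissible)
    (hK : Integrable K (volume.restrict (Set.Icc 0 T))) :
    AEStronglyMeasurable (fun s => ∫ τ in Set.Icc s T, p.dualFlow (τ - s) (K τ))
      (volume.restrict (Set.Icc 0 T)) := by
  refine (hp.integrable_backwardKernel hK).1.integral_prod_right'.congr ?_
  filter_upwards [ae_restrict_mem measurableSet_Icc] with s hs
  exact integral_backwardKernel hs.1

lemma Admissible.memLp_backward (hp : p.Admissible)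
    (hK : Integrable K (volume.restrict (Set.Icc 0 T))) :
    MemLp (fun s => ∫ τ in Set.Icc s T, p.dualFlow (τ - s) (K τ)) 2
      (volume.restrict (Set.Icc 0 T)) := by
  obtain ⟨c, hc⟩ := hp.exists_norm_dualFlow_le T
  refine MemLp.of_bound (hp.aestronglyMeasurable_backward hK)
    (∫ τ in Set.Icc 0 T, c * ‖K τ‖) ?_
  filter_upwards [ae_restrict_mem measurableSet_Icc] with s hs
  rw [← integral_backwardKernel hs.1]
  refine norm_integral_le_of_norm_le (hK.norm.const_mul c) ?_
  filter_upwards [ae_restrict_mem measurableSet_Icc] with τ hτ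
  refine (norm_indicator_le_norm_self _ _).trans ?_
  exact (p.dualFlow _).le_of_opNorm_le (hc _ (by simp only; linarith [hτ.2, hs.1])) _

/-- The adjoint of the backward integral is the forward integral. -/
lemma Admissible.integral_inner_backward (hp : p.Admissible) {u : ℝ → L2} (hu : Continuous u)
    (hK : Integrable K (volume.restrict (Set.Icc 0 T))) :
    ∫ s in Set.Icc 0 T, inner ℂ (u s) (∫ τ in Set.Icc s T, p.dualFlow (τ - s) (K τ)) =
      ∫ τ in Set.Icc 0 T, inner ℂ (∫ s in Set.Icc 0 τ, p.flow (τ - s) (u s)) (K τ) := by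
  have hint := hp.integrable_backwardKernel hK
  set ν := (volume : Measure ℝ).restrict (Set.Icc 0 T)
  have hH : Integrable (fun z : ℝ × ℝ => inner ℂ (u z.1) (p.backwardKernel K z)) (ν.prod ν) := by
    obtain ⟨c, hc⟩ := isCompact_Icc.exists_bound_of_continuousOn (s := Set.Icc 0 T) hu.continuousOn
    refine (hint.norm.const_mul c).mono'
      ((hu.comp continuous_fst).aestronglyMeasurable.inner hint.1) ?_
    rw [Measure.prod_restrict]
    filter_upwards [ae_restrict_mem (measurableSet_Icc.prod measurableSet_Icc)] with z hz
    exact (norm_inner_le_norm _ _).trans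
      (mul_le_mul_of_nonneg_right (hc _ hz.1) (norm_nonneg _))
  have e1 : ∫ s, inner ℂ (u s) (∫ τ in Set.Icc s T, p.dualFlow (τ - s) (K τ)) ∂ν =
      ∫ s, ∫ τ, inner ℂ (u s) (p.backwardKernel K (s, τ)) ∂ν ∂ν := by
    refine integral_congr_ae ?_
    filter_upwards [ae_restrict_mem measurableSet_Icc, hint.prod_right_ae] with s hs hi
    rw [← integral_backwardKernel hs.1]
    exact (integral_inner hi _).symm
  -- Fubini on the triangle 0 ≤ s ≤ τ ≤ T; the indicator in `backwardKernel` puts it on the square.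
  rw [e1, integral_integral_swap hH]
  refine integral_congr_ae ?_
  filter_upwards [ae_restrict_mem measurableSet_Icc] with τ hτ
  have hfl : Continuous fun s => p.flow (τ - s) (u s) :=
    hp.continuous_flow_apply.comp (by fun_prop : Continuous fun s => (τ - s, u s))
  have e2 : ∀ s, inner ℂ (u s) (p.backwardKernel K (s, τ)) =
      (Set.Iic τ).indicator (fun s => inner ℂ (p.flow (τ - s) (u s)) (K τ)) s := fun s => by
    by_cases h : s ≤ τ
    · simp [backwardKernel, Set.indicator, h, inner_dualFlow]
    · simp [backwardKernel, Set.indicator, h]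
  simp_rw [e2]
  rw [setIntegral_indicator measurableSet_Iic]
  have e3 : Set.Icc 0 T ∩ Set.Iic τ = Set.Icc 0 τ := by
    ext s
    simp only [Set.mem_inter_iff, Set.mem_Icc, Set.mem_Iic]
    constructor
    · rintro ⟨⟨h1, _⟩, h2⟩; exact ⟨h1, h2⟩
    · rintro ⟨h1, h2⟩; exact ⟨⟨h1, h2.trans hτ.2⟩, h2⟩
  rw [e3]
  have hi : Integrable (fun s => p.flow (τ - s) (u s)) (volume.restrict (Set.Icc 0 τ)) :=
    hfl.integrableOn_Icc
  have e4 := integral_inner (𝕜 := ℂ) hi (K τ)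
  have e5 : ∀ s, inner ℂ (p.flow (τ - s) (u s)) (K τ) =
      (starRingEnd ℂ) (inner ℂ (K τ) (p.flow (τ - s) (u s))) := fun s =>
    (inner_conj_symm _ _).symm
  simp_rw [e5]
  rw [integral_conj, e4, inner_conj_symm]

end backward

end Plant

/-! ### Test signals -/

lemma restrict_Ici_restrict_Icc (T : ℝ) :
    ((volume : Measure ℝ).restrict (Set.Ici 0)).restrict (Set.Icc 0 T) =
      volume.restrict (Set.Icc 0 T) := by
  rw [Measure.restrict_restrict measurableSet_Icc]
  congr 1
  exact Set.inter_eq_left.2 fun t ht => ht.1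

/-- A real signal that is switched off after the time `T`. -/
def indicatorSignal (T : ℝ) (b : ℝ → L2) (hb : MemLp b 2 (volume.restrict (Set.Icc 0 T)))
    (hr : ∀ t ∈ Set.Icc 0 T, star (b t) = b t) : RealSignal :=
  ⟨(Set.Icc 0 T).indicator b, by
    rwa [memLp_indicator_iff_restrict measurableSet_Icc, restrict_Ici_restrict_Icc], fun t => by
    by_cases h : t ∈ Set.Icc 0 T
    · rw [Set.indicator_of_mem h, hr t h]
    · rw [Set.indicator_of_notMem h]; exact star_zero_L2⟩

/-- The signal that vanishes identically. -/
def zeroSignal : RealSignal := ⟨fun _ => 0, MemLp.zero', fun _ => star_zero_L2⟩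

lemma RealSignal.memLp_Icc (k : RealSignal) (T : ℝ) :
    MemLp k.1 2 (volume.restrict (Set.Icc 0 T)) := by
  rw [← restrict_Ici_restrict_Icc]
  exact k.2.1.restrict _

lemma integral_inner_indicator (T : ℝ) (b φ : ℝ → L2) :
    ∫ t in Set.Ici 0, inner ℂ ((Set.Icc 0 T).indicator b t) (φ t) =
      ∫ t in Set.Icc 0 T, inner ℂ (b t) (φ t) := by
  have h1 : ∀ t, inner ℂ ((Set.Icc 0 T).indicator b t) (φ t) =
      (Set.Icc 0 T).indicator (fun t => inner ℂ (b t) (φ t)) t := fun t => by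
    by_cases h : t ∈ Set.Icc 0 T
    · rw [Set.indicator_of_mem h, Set.indicator_of_mem h]
    · rw [Set.indicator_of_notMem h, Set.indicator_of_notMem h, inner_zero_left]
  simp_rw [h1]
  rw [integral_indicator measurableSet_Icc, restrict_Ici_restrict_Icc]

namespace Inputs

/-- All test fields are real, so their inner products are real. The complex form makes the adjoint
identities available. -/
lemma cov_eq (θ θ' : Test) : (cov θ θ' : ℂ) = inner ℂ θ.1.1 θ'.1.1 +
    (∫ t in Set.Ici (0 : ℝ), inner ℂ (θ.2.1.1 t) (θ'.2.1.1 t)) +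
    ∫ t in Set.Ici (0 : ℝ), inner ℂ (θ.2.2.1 t) (θ'.2.2.1 t) := by
  have h (k l : RealSignal) : ∫ t in Set.Ici (0 : ℝ), inner ℂ (k.1 t) (l.1 t) =
      ((∫ t in Set.Ici (0 : ℝ), (inner ℂ (k.1 t) (l.1 t)).re : ℝ) : ℂ) := by
    refine Eq.trans ?_ integral_ofReal
    exact integral_congr_ae (ae_of_all _ fun t => inner_eq_re_of_real (k.2.2 t) (l.2.2 t))
  rw [inner_eq_re_of_real θ.1.2 θ'.1.2, h, h, cov]
  push_cast
  rfl

lemma cov_comm (θ θ' : Test) : cov θ θ' = cov θ' θ := by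
  have h (f g : L2) : (inner ℂ f g).re = (inner ℂ g f).re := by
    rw [← inner_conj_symm, Complex.conj_re]
  simp only [cov, h θ.1.1, h (θ.2.1.1 _), h (θ.2.2.1 _)]

lemma re_inner_sub_self (f g : L2) : (inner ℂ f f).re - 2 * (inner ℂ f g).re + (inner ℂ g g).re =
    ‖f - g‖ ^ 2 := by
  have h1 := norm_sub_sq (𝕜 := ℂ) f g
  have h2 := inner_self_eq_norm_sq (𝕜 := ℂ) f
  have h3 := inner_self_eq_norm_sq (𝕜 := ℂ) g
  simp only [RCLike.re_to_complex] at h1 h2 h3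
  rw [h1, ← h2, ← h3]

lemma integral_sub_two_mul_add {X : Type*} {mX : MeasurableSpace X} {μ : Measure X}
    {a b c : X → ℝ} (ha : Integrable a μ) (hb : Integrable b μ) (hc : Integrable c μ) :
    (∫ x, a x ∂μ) - 2 * (∫ x, b x ∂μ) + (∫ x, c x ∂μ) = ∫ x, (a x - 2 * b x + c x) ∂μ := by
  have h1 : Integrable (fun x => a x - 2 * b x) μ := ha.sub (hb.const_mul 2)
  rw [integral_add h1 hc, integral_sub ha (hb.const_mul 2), integral_const_mul]

lemma integral_re_inner_sub_self (k l : RealSignal) :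
    (∫ t in Set.Ici (0 : ℝ), (inner ℂ (k.1 t) (k.1 t)).re) -
      2 * (∫ t in Set.Ici (0 : ℝ), (inner ℂ (k.1 t) (l.1 t)).re) +
      (∫ t in Set.Ici (0 : ℝ), (inner ℂ (l.1 t) (l.1 t)).re) =
    ∫ t in Set.Ici (0 : ℝ), ‖k.1 t - l.1 t‖ ^ 2 := by
  have hi (k l : RealSignal) : Integrable (fun t => (inner ℂ (k.1 t) (l.1 t)).re)
      (volume.restrict (Set.Ici (0 : ℝ))) := (integrable_inner_of_memLp k.2.1 l.2.1).re
  rw [integral_sub_two_mul_add (hi k k) (hi k l) (hi l l)]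
  exact integral_congr_ae (ae_of_all _ fun t => re_inner_sub_self _ _)

/-- The white noise isometry: mean square distance of the random variables is Hilbert space distance
of the test functions. -/
lemma cov_sub_sub (θ θ' : Test) : cov θ θ - 2 * cov θ θ' + cov θ' θ' =
    ‖θ.1.1 - θ'.1.1‖ ^ 2 + (∫ t in Set.Ici (0 : ℝ), ‖θ.2.1.1 t - θ'.2.1.1 t‖ ^ 2) +
      ∫ t in Set.Ici (0 : ℝ), ‖θ.2.2.1 t - θ'.2.2.1 t‖ ^ 2 := by
  rw [← re_inner_sub_self, ← integral_re_inner_sub_self, ← integral_re_inner_sub_self]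
  simp only [cov]
  ring

lemma IsWhite.integral_total_sub_total_sq {Ω : Type*} {N : Inputs Ω} [MeasurableSpace Ω]
    {μ : Measure Ω} (hN : N.IsWhite μ) (θ θ' : Test) :
    ∫ ω, (N.total θ ω - N.total θ' ω) ^ 2 ∂μ = cov θ θ - 2 * cov θ θ' + cov θ' θ' := by
  have hi (θ θ' : Test) : Integrable (fun ω => N.total θ ω * N.total θ' ω) μ :=
    (hN.memLp_total θ).integrable_mul (hN.memLp_total θ')
  have h1 : ∀ ω, (N.total θ ω - N.total θ' ω) ^ 2 =
      N.total θ ω * N.total θ ω - 2 * (N.total θ ω * N.total θ' ω) +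
        N.total θ' ω * N.total θ' ω := fun ω => by ring
  simp_rw [h1]
  rw [← integral_sub_two_mul_add (hi _ _) (hi _ _) (hi _ _),
    hN.integral_total_mul_total, hN.integral_total_mul_total, hN.integral_total_mul_total]

end Inputs

namespace Plant

variable {p : Plant}

/-- The signal against which the process noise is integrated in the state. -/
def stateNoise (p : Plant) (T : ℝ) (f : L2) (s : ℝ) : L2 :=
  ContinuousLinearMap.adjoint p.B (ContinuousLinearMap.adjoint (p.S (T - s)) f)

/-- The signal against which the process noise is integrated in the measurement. -/
def measurementNoise (p : Plant) (T : ℝ) (k : ℝ → L2) (s : ℝ) : L2 :=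
  ContinuousLinearMap.adjoint p.B (∫ τ in Set.Icc s T,
    ContinuousLinearMap.adjoint (p.S (τ - s)) (ContinuousLinearMap.adjoint p.C (k τ)))

lemma stateNoise_eq {T s : ℝ} (hs : s ∈ Set.Icc 0 T) (f : L2) :
    p.stateNoise T f s = ContinuousLinearMap.adjoint p.B (p.dualFlow (T - s) f) := by
  rw [stateNoise, adjoint_S_eq (by linarith [hs.2])]

lemma measurementNoise_eq (T s : ℝ) (k : ℝ → L2) :
    p.measurementNoise T k s = ContinuousLinearMap.adjoint p.B (∫ τ in Set.Icc s T,
      p.dualFlow (τ - s) (ContinuousLinearMap.adjoint p.C (k τ))) := by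
  rw [measurementNoise]
  congr 1
  refine setIntegral_congr_fun measurableSet_Icc fun τ hτ => ?_
  rw [adjoint_S_eq (by linarith [hτ.1])]

lemma measurementInit_eq (T : ℝ) (k : ℝ → L2) :
    ∫ τ in Set.Icc 0 T, ContinuousLinearMap.adjoint (p.S τ) (ContinuousLinearMap.adjoint p.C (k τ))
      = ∫ τ in Set.Icc 0 T, p.dualFlow τ (ContinuousLinearMap.adjoint p.C (k τ)) := by
  refine setIntegral_congr_fun measurableSet_Icc fun τ hτ => ?_
  rw [adjoint_S_eq hτ.1]

lemma continuous_apply_sub {F : ℝ → L2 →L[ℂ] L2} (hF : Continuous fun z : ℝ × L2 => F z.1 z.2)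
    (T : ℝ) (f : L2) : Continuous fun s => F (T - s) f :=
  hF.comp (by fun_prop : Continuous fun s => (T - s, f))

lemma Admissible.memLp_stateNoise (hp : p.Admissible) (T : ℝ) (f : L2) :
    MemLp (p.stateNoise T f) 2 (volume.restrict (Set.Icc 0 T)) := by
  have h1 : Continuous fun s => ContinuousLinearMap.adjoint p.B (p.dualFlow (T - s) f) :=
    (ContinuousLinearMap.adjoint p.B).continuous.comp
      (continuous_apply_sub hp.continuous_dualFlow_apply T f)
  obtain ⟨c, hc⟩ := isCompact_Icc.exists_bound_of_continuousOn (s := Set.Icc 0 T) h1.continuousOn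
  have h2 : MemLp (fun s => ContinuousLinearMap.adjoint p.B (p.dualFlow (T - s) f)) 2
      (volume.restrict (Set.Icc 0 T)) :=
    MemLp.of_bound h1.aestronglyMeasurable c (ae_restrict_of_forall_mem measurableSet_Icc hc)
  refine h2.ae_eq ?_
  filter_upwards [ae_restrict_mem measurableSet_Icc] with s hs
  exact (stateNoise_eq hs f).symm

lemma integrable_adjoint_C (k : RealSignal) (T : ℝ) :
    Integrable (fun τ => ContinuousLinearMap.adjoint p.C (k.1 τ))
      (volume.restrict (Set.Icc 0 T)) :=
  (ContinuousLinearMap.adjoint p.C).integrable_comp ((k.memLp_Icc T).integrable one_le_two)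

lemma Admissible.memLp_measurementNoise (hp : p.Admissible) (T : ℝ) (k : RealSignal) :
    MemLp (p.measurementNoise T k.1) 2 (volume.restrict (Set.Icc 0 T)) := by
  have h1 := (ContinuousLinearMap.adjoint p.B).comp_memLp'
    (hp.memLp_backward (integrable_adjoint_C (p := p) k T))
  rw [show p.measurementNoise T k.1 = _ from funext fun s => measurementNoise_eq T s k.1]
  exact h1

/-- The test function of the state. -/
def stateTest (hp : p.Admissible) {T : ℝ} (hT : 0 ≤ T) {f : L2} (hf : star f = f) : Inputs.Test :=
  (⟨ContinuousLinearMap.adjoint (p.S T) f, by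
      rw [adjoint_S_eq hT, ← hp.star_dualFlow, hf]⟩,
    indicatorSignal T (p.stateNoise T f) (hp.memLp_stateNoise T f) fun s hs => by
      rw [stateNoise_eq hs, ← hp.star_adjoint_B, ← hp.star_dualFlow, hf],
    zeroSignal)

/-- The test function of the measurement. -/
def measurementTest (hp : p.Admissible) (T : ℝ) (k : RealSignal) : Inputs.Test :=
  (⟨∫ τ in Set.Icc 0 T,
      ContinuousLinearMap.adjoint (p.S τ) (ContinuousLinearMap.adjoint p.C (k.1 τ)), by
      rw [measurementInit_eq, ← integral_star_L2]
      simp_rw [← hp.star_dualFlow, ← hp.star_adjoint_C, k.2.2]⟩,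
    indicatorSignal T (p.measurementNoise T k.1) (hp.memLp_measurementNoise T k) fun s _ => by
      rw [measurementNoise_eq, ← hp.star_adjoint_B, ← integral_star_L2]
      simp_rw [← hp.star_dualFlow, ← hp.star_adjoint_C, k.2.2],
    indicatorSignal T (fun s => ContinuousLinearMap.adjoint p.G (k.1 s))
      ((ContinuousLinearMap.adjoint p.G).comp_memLp' (k.memLp_Icc T)) fun s _ => by
      rw [← hp.star_adjoint_G, k.2.2])

variable {Ω : Type*} {N : Inputs Ω} [MeasurableSpace Ω] {μ : Measure Ω}

/-- The inputs are not assumed linear in their test functions, so the missing measurement noise term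
is the noise at the zero signal. It has variance zero and hence vanishes almost surely. -/
lemma state_ae_eq_total (hp : p.Admissible) (hN : N.IsWhite μ) {T : ℝ} (hT : 0 ≤ T) {f : L2}
    (hf : star f = f) : p.state N T f =ᵐ[μ] N.total (stateTest hp hT hf) := by
  have hv : ∀ᵐ ω ∂μ, N.v zeroSignal.1 ω = 0 := by
    have h1 := hN.v.covariance zeroSignal zeroSignal
    have h2 : MemLp (N.v zeroSignal.1) 2 μ := (hN.v.gaussian.hasGaussianLaw_eval zeroSignal).memLp_two
    simp only [zeroSignal, inner_zero_left, Complex.zero_re, integral_zero] at h1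
    have h3 := (integral_eq_zero_iff_of_nonneg (μ := μ) (fun ω => mul_self_nonneg _)
      (h2.integrable_mul h2)).1 h1
    filter_upwards [h3] with ω h4
    exact mul_self_eq_zero.1 h4
  filter_upwards [hv] with ω h
  change _ = _ + _ + N.v zeroSignal.1 ω
  rw [h, add_zero]
  rfl

end Plant

/-! ### The error variance on a finite horizon -/

lemma integral_inner_left {X : Type*} {mX : MeasurableSpace X} {μ : Measure X} {a : X → L2}
    (ha : Integrable a μ) (c : L2) : ∫ x, inner ℂ (a x) c ∂μ = inner ℂ (∫ x, a x ∂μ) c := by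
  have h : ∀ x, inner ℂ (a x) c = (starRingEnd ℂ) (inner ℂ c (a x)) := fun x =>
    (inner_conj_symm _ _).symm
  simp_rw [h]
  rw [integral_conj, integral_inner ha, inner_conj_symm]

lemma setIntegral_inner_indicator_right (T : ℝ) (a b : ℝ → L2) :
    ∫ t in Set.Icc 0 T, inner ℂ (a t) ((Set.Icc 0 T).indicator b t) =
      ∫ t in Set.Icc 0 T, inner ℂ (a t) (b t) :=
  setIntegral_congr_fun measurableSet_Icc fun t ht => by
    rw [Set.indicator_of_mem ht]

lemma memLp_two_of_continuous {a : ℝ → L2} (ha : Continuous a) (T : ℝ) :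
    MemLp a 2 (volume.restrict (Set.Icc 0 T)) := by
  obtain ⟨c, hc⟩ := isCompact_Icc.exists_bound_of_continuousOn (s := Set.Icc 0 T) ha.continuousOn
  exact MemLp.of_bound ha.aestronglyMeasurable c (ae_restrict_of_forall_mem measurableSet_Icc hc)

namespace Plant

variable {p : Plant}

lemma aestronglyMeasurable_apply {ν : Measure ℝ} {F : ℝ → L2 →L[ℂ] L2}
    (hF : Continuous fun z : ℝ × L2 => F z.1 z.2) {K : ℝ → L2} (hK : AEStronglyMeasurable K ν) :
    AEStronglyMeasurable (fun τ => F τ (K τ)) ν :=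
  hF.comp_aestronglyMeasurable (continuous_id.aestronglyMeasurable.prodMk hK)

lemma Admissible.integrable_dualFlow_apply (hp : p.Admissible) {T : ℝ} {K : ℝ → L2}
    (hK : Integrable K (volume.restrict (Set.Icc 0 T))) :
    Integrable (fun τ => p.dualFlow τ (K τ)) (volume.restrict (Set.Icc 0 T)) := by
  obtain ⟨c, hc⟩ := hp.exists_norm_dualFlow_le T
  refine (hK.norm.const_mul c).mono'
    (aestronglyMeasurable_apply hp.continuous_dualFlow_apply hK.1) ?_
  filter_upwards [ae_restrict_mem measurableSet_Icc] with τ hτ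
  exact (p.dualFlow τ).le_of_opNorm_le (hc τ hτ.2) _

/-- The optimality system of the problem to estimate `⟨ψ(T), f⟩` from the measurements on `[0, T]`:
the signal `k` is the optimal weight of the measurements. -/
structure IsOptimalWeight (p : Plant) (T : ℝ) (f : L2) (k : RealSignal) (z y : ℝ → L2) : Prop where
  continuous_state : Continuous z
  continuous_costate : Continuous y
  -- In differential form: z' = -A*z + C*k with z(T) = f, and y' = Ay + BB*z with y(0) = z(0), the
  -- initial covariance being the identity. The last condition Cy = GG*k is stationarity.
  state_eq : ∀ s ∈ Set.Icc 0 T, z s = p.dualFlow (T - s) f -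
    ∫ τ in Set.Icc s T, p.dualFlow (τ - s) (ContinuousLinearMap.adjoint p.C (k.1 τ))
  costate_eq : ∀ τ ∈ Set.Icc 0 T, y τ = p.flow τ (z 0) +
    ∫ s in Set.Icc 0 τ, p.flow (τ - s) (p.B (ContinuousLinearMap.adjoint p.B (z s)))
  weight_eq : ∀ τ ∈ Set.Icc 0 T, p.C (y τ) = p.G (ContinuousLinearMap.adjoint p.G (k.1 τ))

variable {T : ℝ} {f : L2} {k : RealSignal} {z y : ℝ → L2}

/-- The estimation error is the sum of the initial state tested against z(0) and the process noise
tested against B*z, minus the measurement noise tested against G*k. Its covariance with any test is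
read off from this. -/
lemma IsOptimalWeight.cov_sub_cov (h : p.IsOptimalWeight T f k z y) (hp : p.Admissible)
    (hT : 0 ≤ T) (hf : star f = f) (φ : Inputs.Test) :
    (Inputs.cov (stateTest hp hT hf) φ - Inputs.cov (measurementTest hp T k) φ : ℂ) =
      inner ℂ (z 0) φ.1.1 +
      (∫ s in Set.Icc 0 T, inner ℂ (ContinuousLinearMap.adjoint p.B (z s)) (φ.2.1.1 s)) -
      ∫ s in Set.Icc 0 T, inner ℂ (ContinuousLinearMap.adjoint p.G (k.1 s)) (φ.2.2.1 s) := by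
  have h0 : (0 : ℝ) ∈ Set.Icc 0 T := ⟨le_rfl, hT⟩
  rw [Inputs.cov_eq, Inputs.cov_eq]
  have e1 : z 0 = (stateTest hp hT hf).1.1 - (measurementTest hp T k).1.1 := by
    change _ = ContinuousLinearMap.adjoint (p.S T) f - _
    rw [h.state_eq 0 h0, adjoint_S_eq hT]
    simp only [sub_zero]
    congr 1
    exact (measurementInit_eq T k.1).symm
  have e2 : ∫ t in Set.Ici (0 : ℝ), inner ℂ ((stateTest hp hT hf).2.1.1 t) (φ.2.1.1 t) =
      ∫ t in Set.Icc 0 T, inner ℂ (p.stateNoise T f t) (φ.2.1.1 t) :=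
    integral_inner_indicator T _ _
  have e3 : ∫ t in Set.Ici (0 : ℝ), inner ℂ ((measurementTest hp T k).2.1.1 t) (φ.2.1.1 t) =
      ∫ t in Set.Icc 0 T, inner ℂ (p.measurementNoise T k.1 t) (φ.2.1.1 t) :=
    integral_inner_indicator T _ _
  have e4 : ∫ t in Set.Ici (0 : ℝ), inner ℂ ((stateTest hp hT hf).2.2.1 t) (φ.2.2.1 t) = 0 := by
    refine (integral_congr_ae (ae_of_all _ fun t => ?_)).trans (integral_zero _ _)
    exact inner_zero_left _
  have e5 : ∫ t in Set.Ici (0 : ℝ), inner ℂ ((measurementTest hp T k).2.2.1 t) (φ.2.2.1 t) =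
      ∫ t in Set.Icc 0 T, inner ℂ (ContinuousLinearMap.adjoint p.G (k.1 t)) (φ.2.2.1 t) :=
    integral_inner_indicator T _ _
  have e6 : ∫ s in Set.Icc 0 T, inner ℂ (ContinuousLinearMap.adjoint p.B (z s)) (φ.2.1.1 s) =
      (∫ t in Set.Icc 0 T, inner ℂ (p.stateNoise T f t) (φ.2.1.1 t)) -
      ∫ t in Set.Icc 0 T, inner ℂ (p.measurementNoise T k.1 t) (φ.2.1.1 t) := by
    rw [← integral_sub
      (integrable_inner_of_memLp (hp.memLp_stateNoise T f) (φ.2.1.memLp_Icc T))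
      (integrable_inner_of_memLp (hp.memLp_measurementNoise T k) (φ.2.1.memLp_Icc T))]
    refine setIntegral_congr_fun measurableSet_Icc fun s hs => ?_
    rw [h.state_eq s hs, map_sub, inner_sub_left, ← stateNoise_eq hs, ← measurementNoise_eq]
  rw [e1, e2, e3, e4, e5, e6, inner_sub_left]
  ring

/-- Fubini collects the covariance of the error with a measurement `l` into the integral of ⟨Cy -
GG*k, l⟩, which vanishes by stationarity. The error is thus orthogonal to all observations. -/
lemma IsOptimalWeight.cov_measurementTest (h : p.IsOptimalWeight T f k z y) (hp : p.Admissible)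
    (hT : 0 ≤ T) (hf : star f = f) (l : RealSignal) :
    Inputs.cov (stateTest hp hT hf) (measurementTest hp T l) =
      Inputs.cov (measurementTest hp T k) (measurementTest hp T l) := by
  have hl := l.memLp_Icc T
  have hCl : MemLp (fun τ => ContinuousLinearMap.adjoint p.C (l.1 τ)) 2
      (volume.restrict (Set.Icc 0 T)) := (ContinuousLinearMap.adjoint p.C).comp_memLp' hl
  have hCi := integrable_adjoint_C (p := p) l T
  have hfl : Continuous fun τ => p.flow τ (z 0) :=
    hp.continuous_flow_apply.comp (by fun_prop : Continuous fun τ : ℝ => (τ, z 0))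
  have hu : Continuous fun s => p.B (ContinuousLinearMap.adjoint p.B (z s)) :=
    p.B.continuous.comp ((ContinuousLinearMap.adjoint p.B).continuous.comp h.continuous_state)
  rw [← sub_eq_zero, ← Complex.ofReal_eq_zero, Complex.ofReal_sub, h.cov_sub_cov hp hT hf,
    sub_eq_zero]
  have e1 : inner ℂ (z 0) (measurementTest hp T l).1.1 =
      ∫ τ in Set.Icc 0 T, inner ℂ (p.flow τ (z 0)) (ContinuousLinearMap.adjoint p.C (l.1 τ)) := by
    change inner ℂ (z 0) (∫ τ in Set.Icc 0 T, _) = _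
    rw [measurementInit_eq, ← integral_inner]
    · exact integral_congr_ae (ae_of_all _ fun τ => inner_dualFlow _ _ _)
    · exact hp.integrable_dualFlow_apply hCi
  have e2 : ∫ s in Set.Icc 0 T, inner ℂ (ContinuousLinearMap.adjoint p.B (z s))
        ((measurementTest hp T l).2.1.1 s) =
      ∫ τ in Set.Icc 0 T, inner ℂ (y τ - p.flow τ (z 0))
        (ContinuousLinearMap.adjoint p.C (l.1 τ)) := by
    refine (setIntegral_inner_indicator_right T _ _).trans ?_
    refine Eq.trans ?_ ((hp.integral_inner_backward hu hCi).trans ?_)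
    · refine integral_congr_ae (ae_of_all _ fun s => ?_)
      beta_reduce
      rw [measurementNoise_eq, ContinuousLinearMap.adjoint_inner_right]
    · refine setIntegral_congr_fun measurableSet_Icc fun τ hτ => ?_
      rw [h.costate_eq τ hτ, add_sub_cancel_left]
  have e3 : ∫ s in Set.Icc 0 T, inner ℂ (ContinuousLinearMap.adjoint p.G (k.1 s))
        ((measurementTest hp T l).2.2.1 s) =
      ∫ τ in Set.Icc 0 T, inner ℂ (y τ) (ContinuousLinearMap.adjoint p.C (l.1 τ)) := by
    refine (setIntegral_inner_indicator_right T _ _).trans ?_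
    refine setIntegral_congr_fun measurableSet_Icc fun τ hτ => ?_
    rw [ContinuousLinearMap.adjoint_inner_right, ContinuousLinearMap.adjoint_inner_right,
      h.weight_eq τ hτ]
  have hyz : Continuous fun τ => y τ - p.flow τ (z 0) := h.continuous_costate.sub hfl
  rw [e1, e2, e3, ← integral_add (integrable_inner_of_memLp (memLp_two_of_continuous hfl T) hCl)
    (integrable_inner_of_memLp (memLp_two_of_continuous hyz T) hCl)]
  refine integral_congr_ae (ae_of_all _ fun τ => ?_)
  beta_reduce
  rw [← inner_add_left, add_sub_cancel]

/-- Pairing the error with the state applies the forward evolution to z(0) and BB*z, which is the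
costate equation at the final time. -/
lemma IsOptimalWeight.cov_stateTest (h : p.IsOptimalWeight T f k z y) (hp : p.Admissible)
    (hT : 0 ≤ T) (hf : star f = f) :
    Inputs.cov (stateTest hp hT hf) (stateTest hp hT hf) -
      Inputs.cov (measurementTest hp T k) (stateTest hp hT hf) = (inner ℂ (y T) f).re := by
  have hT' : T ∈ Set.Icc 0 T := ⟨hT, le_rfl⟩
  have hu : Continuous fun s => p.flow (T - s) (p.B (ContinuousLinearMap.adjoint p.B (z s))) :=
    hp.continuous_flow_apply.comp ((by fun_prop : Continuous fun s => T - s).prodMk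
      (p.B.continuous.comp ((ContinuousLinearMap.adjoint p.B).continuous.comp h.continuous_state)))
  rw [← Complex.ofReal_re (Inputs.cov _ _ - Inputs.cov _ _), Complex.ofReal_sub,
    h.cov_sub_cov hp hT hf]
  congr 1
  have e1 : inner ℂ (z 0) (stateTest hp hT hf).1.1 = inner ℂ (p.flow T (z 0)) f := by
    change inner ℂ (z 0) (ContinuousLinearMap.adjoint (p.S T) f) = _
    rw [adjoint_S_eq hT, inner_dualFlow]
  have e2 : ∫ s in Set.Icc 0 T, inner ℂ (ContinuousLinearMap.adjoint p.B (z s))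
        ((stateTest hp hT hf).2.1.1 s) =
      inner ℂ (∫ s in Set.Icc 0 T,
        p.flow (T - s) (p.B (ContinuousLinearMap.adjoint p.B (z s)))) f := by
    refine (setIntegral_inner_indicator_right T _ _).trans ?_
    rw [← integral_inner_left hu.integrableOn_Icc]
    refine setIntegral_congr_fun measurableSet_Icc fun s hs => ?_
    rw [stateNoise_eq hs, ContinuousLinearMap.adjoint_inner_right, inner_dualFlow]
  have e3 : ∫ s in Set.Icc 0 T, inner ℂ (ContinuousLinearMap.adjoint p.G (k.1 s))
        ((stateTest hp hT hf).2.2.1 s) = 0 := by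
    refine (integral_congr_ae (ae_of_all _ fun t => ?_)).trans (integral_zero _ _)
    exact inner_zero_right _
  rw [e1, e2, e3, sub_zero, ← inner_add_left, ← h.costate_eq T hT']

variable {Ω : Type*} {N : Inputs Ω} [MeasurableSpace Ω] {μ : Measure Ω}

/-- The variance of the estimation error is the value of the costate at the final time. -/
lemma IsOptimalWeight.errorVariance_eq (h : p.IsOptimalWeight T f k z y) (hp : p.Admissible)
    (hN : N.IsWhite μ) (hT : 0 ≤ T) (hf : star f = f) :
    p.errorVariance μ N T f = (inner ℂ (y T) f).re := by
  have h1 : μ[p.state N T f | p.observations N T] =ᵐ[μ] N.total (measurementTest hp T k) :=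
    (condExp_congr_ae (state_ae_eq_total hp hN hT hf)).trans
      (hN.condExp_eq (measurementTest hp T) _ k fun l => h.cov_measurementTest hp hT hf l)
  have h2 : p.errorVariance μ N T f = ∫ ω, (N.total (stateTest hp hT hf) ω -
      N.total (measurementTest hp T k) ω) ^ 2 ∂μ := by
    refine integral_congr_ae ?_
    filter_upwards [h1, state_ae_eq_total hp hN hT hf] with ω e1 e2
    rw [e1, e2]
  rw [h2, hN.integral_total_sub_total_sq, ← h.cov_stateTest hp hT hf,
    ← h.cov_measurementTest hp hT hf k, Inputs.cov_comm (measurementTest hp T k)]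
  ring

end Plant

namespace Plant

variable {p : Plant}

/-! ### The Hamiltonian flow at one frequency -/

/-- The state component of the solution of the Hamiltonian system. -/
def hamState (p : Plant) (s x : ℝ) : ℝ := Real.cosh (p.decayRate x * s) +
  (p.quadCoeff x - (p.symA x).re) / p.decayRate x * Real.sinh (p.decayRate x * s)

/-- The costate component of the solution of the Hamiltonian system. -/
def hamCostate (p : Plant) (s x : ℝ) : ℝ := Real.cosh (p.decayRate x * s) +
  ((p.symA x).re + ‖p.symB x‖ ^ 2) / p.decayRate x * Real.sinh (p.decayRate x * s)

lemma hamState_zero (x : ℝ) : p.hamState 0 x = 1 := by simp [hamState]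

lemma hamCostate_zero (x : ℝ) : p.hamCostate 0 x = 1 := by simp [hamCostate]

lemma hasDerivAt_cosh_add_sinh (σ c s : ℝ) :
    HasDerivAt (fun s => Real.cosh (σ * s) + c * Real.sinh (σ * s))
      (σ * Real.sinh (σ * s) + c * (σ * Real.cosh (σ * s))) s := by
  have h0 : HasDerivAt (fun s => σ * s) σ s := by simpa using (hasDerivAt_id s).const_mul σ
  have h1 := h0.cosh.add (h0.sinh.const_mul c)
  convert! h1 using 1
  ring

/-- With the next lemma: the pair solves a linear system with matrix [[-α, q], [b², α]], whose
square is σ² times the identity. This accounts for cosh and sinh of σs, and the quotient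
costate/state solves the scalar Riccati differential equation. -/
lemma Admissible.hasDerivAt_hamState (hp : p.Admissible) (s x : ℝ) :
    HasDerivAt (fun s => p.hamState s x)
      (-(p.symA x).re * p.hamState s x + p.quadCoeff x * p.hamCostate s x) s := by
  have h0 := (hp.decayRate_pos x).ne'
  convert! hasDerivAt_cosh_add_sinh (p.decayRate x)
    ((p.quadCoeff x - (p.symA x).re) / p.decayRate x) s using 1
  simp only [hamState, hamCostate]
  field_simp
  linear_combination -Real.sinh (p.decayRate x * s) * hp.decayRate_sq x

lemma Admissible.hasDerivAt_hamCostate (hp : p.Admissible) (s x : ℝ) :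
    HasDerivAt (fun s => p.hamCostate s x)
      ((p.symA x).re * p.hamCostate s x + ‖p.symB x‖ ^ 2 * p.hamState s x) s := by
  have h0 := (hp.decayRate_pos x).ne'
  convert! hasDerivAt_cosh_add_sinh (p.decayRate x)
    (((p.symA x).re + ‖p.symB x‖ ^ 2) / p.decayRate x) s using 1
  simp only [hamState, hamCostate]
  field_simp
  linear_combination -Real.sinh (p.decayRate x * s) * hp.decayRate_sq x

lemma cosh_add_sinh_pos {c u : ℝ} (hc : -1 < c) (hu : 0 ≤ u) :
    0 < Real.cosh u + c * Real.sinh u := by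
  have h1 := Real.sinh_nonneg_iff.2 hu
  have h2 := Real.sinh_lt_cosh u
  nlinarith

/-- The coefficient of sinh exceeds -1 because α < σ and q > 0. Positivity permits the divisions by
`hamState`. -/
lemma Admissible.hamState_pos (hp : p.Admissible) {s : ℝ} (hs : 0 ≤ s) (x : ℝ) :
    0 < p.hamState s x := by
  have h0 := hp.decayRate_pos x
  have h1 := (abs_lt.1 (hp.abs_re_lt_decayRate x)).2
  refine cosh_add_sinh_pos ?_ (by positivity)
  rw [lt_div_iff₀ h0]
  linarith [hp.quadCoeff_pos x]

lemma Admissible.continuous_hamState (hp : p.Admissible) :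
    Continuous fun z : ℝ × ℝ => p.hamState z.1 z.2 := by
  have h1 := hp.continuous_symA
  have h2 := hp.continuous_decayRate
  have h3 := hp.continuous_quadCoeff
  have h4 : ∀ z : ℝ × ℝ, p.decayRate z.2 ≠ 0 := fun z => (hp.decayRate_pos z.2).ne'
  have h5 := Real.continuous_cosh
  have h6 := Real.continuous_sinh
  unfold hamState
  fun_prop (disch := assumption)

lemma Admissible.continuous_hamCostate (hp : p.Admissible) :
    Continuous fun z : ℝ × ℝ => p.hamCostate z.1 z.2 := by
  have h1 := hp.continuous_symA
  have h2 := hp.continuous_decayRate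
  have h3 := hp.continuous_symB
  have h4 : ∀ z : ℝ × ℝ, p.decayRate z.2 ≠ 0 := fun z => (hp.decayRate_pos z.2).ne'
  have h5 := Real.continuous_cosh
  have h6 := Real.continuous_sinh
  unfold hamCostate
  fun_prop (disch := assumption)

lemma Admissible.hamState_neg (hp : p.Admissible) (s x : ℝ) :
    p.hamState s (-x) = p.hamState s x := by
  simp only [hamState, hp.symA_neg, hp.decayRate_neg, hp.quadCoeff_neg, RCLike.star_def,
    Complex.conj_re]

lemma Admissible.hamCostate_neg (hp : p.Admissible) (s x : ℝ) :
    p.hamCostate s (-x) = p.hamCostate s x := by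
  simp only [hamCostate, hp.symA_neg, hp.decayRate_neg, hp.symB_neg, RCLike.star_def,
    RCLike.norm_conj, Complex.conj_re]

/-! ### Symbols of the optimal weight -/

/-- The common phase factor of the optimal state and costate. -/
def phase (p : Plant) (s x : ℝ) : ℂ := Complex.exp (-((s * (p.symA x).im : ℝ) * Complex.I))

lemma Admissible.continuous_phase (hp : p.Admissible) :
    Continuous fun z : ℝ × ℝ => p.phase z.1 z.2 := by
  have h1 := hp.continuous_symA
  unfold phase
  fun_prop

lemma Admissible.phase_neg (hp : p.Admissible) (s x : ℝ) : p.phase s (-x) = star (p.phase s x) := by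
  simp [phase, hp.symA_neg, ← Complex.exp_conj]

lemma hasDerivAt_phase (T s x : ℝ) : HasDerivAt (fun s => p.phase (T - s) x)
    ((p.symA x).im * Complex.I * p.phase (T - s) x) s := by
  have h1 : HasDerivAt (fun s : ℝ => -(((T - s) * (p.symA x).im : ℝ) * Complex.I : ℂ))
      ((p.symA x).im * Complex.I) s := by
    have h2 : HasDerivAt (fun s : ℝ => (T - s) * (p.symA x).im) (-1 * (p.symA x).im) s :=
      ((hasDerivAt_id s).const_sub T).mul_const _
    convert! (h2.ofReal_comp.mul_const Complex.I).neg using 1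
    push_cast
    ring
  convert! h1.cexp using 1
  rw [phase]
  ring

/-- The symbol of the optimal state. -/
def stateSymbol (p : Plant) (T s x : ℝ) : ℂ :=
  -- The normalization gives the value 1 at s = T, matching the terminal condition z(T) = f.
  p.phase (T - s) x * (p.hamState s x / p.hamState T x : ℝ)

/-- The symbol of the optimal costate. -/
def costateSymbol (p : Plant) (T s x : ℝ) : ℂ :=
  p.phase (T - s) x * (p.hamCostate s x / p.hamState T x : ℝ)

/-- The symbol of the optimal weight. -/
def weightSymbol (p : Plant) (T s x : ℝ) : ℂ :=
  p.symC x * ((‖p.symG x‖ ^ 2 : ℝ) : ℂ)⁻¹ * p.costateSymbol T s x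

variable {T : ℝ}

lemma Admissible.continuous_stateSymbol (hp : p.Admissible) (hT : 0 ≤ T) :
    Continuous fun z : ℝ × ℝ => p.stateSymbol T z.1 z.2 := by
  have h1 : Continuous fun z : ℝ × ℝ => p.phase (T - z.1) z.2 :=
    hp.continuous_phase.comp (by fun_prop : Continuous fun z : ℝ × ℝ => (T - z.1, z.2))
  have h2 : Continuous fun z : ℝ × ℝ => p.hamState T z.2 :=
    hp.continuous_hamState.comp (by fun_prop : Continuous fun z : ℝ × ℝ => (T, z.2))
  exact h1.mul (Complex.continuous_ofReal.comp
    (hp.continuous_hamState.div h2 fun z => (hp.hamState_pos hT z.2).ne'))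

lemma Admissible.continuous_costateSymbol (hp : p.Admissible) (hT : 0 ≤ T) :
    Continuous fun z : ℝ × ℝ => p.costateSymbol T z.1 z.2 := by
  have h1 : Continuous fun z : ℝ × ℝ => p.phase (T - z.1) z.2 :=
    hp.continuous_phase.comp (by fun_prop : Continuous fun z : ℝ × ℝ => (T - z.1, z.2))
  have h2 : Continuous fun z : ℝ × ℝ => p.hamState T z.2 :=
    hp.continuous_hamState.comp (by fun_prop : Continuous fun z : ℝ × ℝ => (T, z.2))
  exact h1.mul (Complex.continuous_ofReal.comp
    (hp.continuous_hamCostate.div h2 fun z => (hp.hamState_pos hT z.2).ne'))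

lemma Admissible.continuous_weightSymbol (hp : p.Admissible) (hT : 0 ≤ T) :
    Continuous fun z : ℝ × ℝ => p.weightSymbol T z.1 z.2 := by
  have h1 := hp.continuous_symC
  have h2 := hp.continuous_inv_normG_sq
  have h3 := hp.continuous_costateSymbol hT
  exact ((h1.comp continuous_snd).mul (h2.comp continuous_snd)).mul h3

lemma Admissible.weightSymbol_neg (hp : p.Admissible) (T s x : ℝ) :
    p.weightSymbol T s (-x) = star (p.weightSymbol T s x) := by
  simp only [weightSymbol, costateSymbol, hp.symC_neg, hp.symG_neg, hp.phase_neg,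
    hp.hamCostate_neg, hp.hamState_neg, RCLike.star_def, RCLike.norm_conj, map_mul, map_inv₀,
    Complex.conj_ofReal]

lemma phase_zero (x : ℝ) : p.phase 0 x = 1 := by simp [phase]

lemma symC_mul_star_weight (x : ℝ) : star (p.symC x) * (p.symC x * ((‖p.symG x‖ ^ 2 : ℝ) : ℂ)⁻¹) =
    (p.quadCoeff x : ℂ) := by
  rw [← mul_assoc, star_mul_eq, quadCoeff]
  push_cast
  rfl

/-- The evolution of the optimal state. -/
lemma Admissible.hasDerivAt_stateSymbol (hp : p.Admissible) (T s τ x : ℝ) :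
    HasDerivAt (fun τ : ℝ => Complex.exp ((τ - s : ℝ) * star (p.symA x)) * p.stateSymbol T τ x)
      (Complex.exp ((τ - s : ℝ) * star (p.symA x)) *
        (star (p.symC x) * p.weightSymbol T τ x)) τ := by
  have h1 : HasDerivAt (fun τ : ℝ => Complex.exp ((τ - s : ℝ) * star (p.symA x)))
      (Complex.exp ((τ - s : ℝ) * star (p.symA x)) * star (p.symA x)) τ := by
    have h2 : HasDerivAt (fun τ : ℝ => τ - s) 1 τ := (hasDerivAt_id τ).sub_const s
    have h3 := (h2.ofReal_comp.mul_const (star (p.symA x))).cexp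
    simpa using h3
  have h2 := ((hp.hasDerivAt_hamState τ x).div_const (p.hamState T x)).ofReal_comp
  have h3 := h1.mul ((hasDerivAt_phase (p := p) T τ x).mul h2)
  convert! h3 using 1
  have h4 : star (p.symA x) = (p.symA x).re - (p.symA x).im * Complex.I := by
    apply Complex.ext <;> simp
  have h5 : star (p.symC x) * p.weightSymbol T τ x = p.quadCoeff x * p.costateSymbol T τ x := by
    rw [weightSymbol, ← mul_assoc, symC_mul_star_weight]
  rw [h5, costateSymbol, h4]
  simp only [Pi.mul_apply]
  push_cast
  ring

/-- The evolution of the optimal costate. -/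
lemma Admissible.hasDerivAt_costateSymbol (hp : p.Admissible) (T τ s x : ℝ) :
    HasDerivAt (fun s : ℝ => Complex.exp ((τ - s : ℝ) * p.symA x) * p.costateSymbol T s x)
      (Complex.exp ((τ - s : ℝ) * p.symA x) *
        (p.symB x * (star (p.symB x) * p.stateSymbol T s x))) s := by
  have h1 : HasDerivAt (fun s : ℝ => Complex.exp ((τ - s : ℝ) * p.symA x))
      (Complex.exp ((τ - s : ℝ) * p.symA x) * -p.symA x) s := by
    have h2 : HasDerivAt (fun s : ℝ => τ - s) (-1) s := (hasDerivAt_id s).const_sub τ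
    have h3 := (h2.ofReal_comp.mul_const (p.symA x)).cexp
    simpa using h3
  have h2 := ((hp.hasDerivAt_hamCostate s x).div_const (p.hamState T x)).ofReal_comp
  have h3 := h1.mul ((hasDerivAt_phase (p := p) T s x).mul h2)
  convert! h3 using 1
  have h4 : p.symA x = (p.symA x).re + (p.symA x).im * Complex.I := (Complex.re_add_im _).symm
  have h5 : p.symB x * (star (p.symB x) * p.stateSymbol T s x) =
      ((‖p.symB x‖ ^ 2 : ℝ) : ℂ) * p.stateSymbol T s x := by
    rw [← mul_assoc, mul_star_eq]
  rw [h5, stateSymbol]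
  generalize Complex.exp ((τ - s : ℝ) * p.symA x) = e
  simp only [Pi.mul_apply]
  push_cast
  linear_combination (e * p.phase (T - s) x * (p.hamCostate s x / p.hamState T x)) * h4

end Plant

/-! ### The optimality system for band-limited fields -/

lemma BandLimited.star_bandMul {n : ℕ} {f : L2} (h : BandLimited n f) (hf : star f = f)
    {m : ℝ → ℂ} (hm : Continuous m) (hm' : ∀ x, m (-x) = star (m x)) :
    star (bandMul n m f) = bandMul n m f := by
  have h1 := (h.sym hm).star.congr (m' := m) fun x => by rw [hm', star_star]
  rw [hf] at h1
  exact h1.unique (h.sym hm)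

lemma setIntegral_Icc_bandMul_deriv (n : ℕ) {m m' : ℝ → ℝ → ℂ}
    (hd : ∀ s x, HasDerivAt (fun s => m s x) (m' s x) s) (hm : ∀ s, Continuous (m s))
    (hm' : Continuous fun p : ℝ × ℝ => m' p.1 p.2) (f : L2) {a b : ℝ} (hab : a ≤ b) :
    ∫ s in Set.Icc a b, bandMul n (m' s) f = bandMul n (m b) f - bandMul n (m a) f := by
  rw [integral_Icc_eq_integral_Ioc, ← intervalIntegral.integral_of_le hab]
  exact integral_bandMul_deriv n hd hm hm' f a b

namespace Plant

variable {p : Plant} {T : ℝ} {n : ℕ} {f : L2}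

/-- The optimal weight for a band-limited field. -/
def optimalWeight (hp : p.Admissible) (hT : 0 ≤ T) (hn : BandLimited n f) (hf : star f = f) :
    RealSignal :=
  indicatorSignal T (fun s => bandMul n (p.weightSymbol T s) f)
    (memLp_two_of_continuous (continuous_bandMul_apply n (hp.continuous_weightSymbol hT) f) T)
    fun s _ => hn.star_bandMul hf
      ((hp.continuous_weightSymbol hT).comp (by fun_prop : Continuous fun x : ℝ => (s, x)))
      (hp.weightSymbol_neg T s)

lemma optimalWeight_apply (hp : p.Admissible) (hT : 0 ≤ T) (hn : BandLimited n f)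
    (hf : star f = f) {s : ℝ} (hs : s ∈ Set.Icc 0 T) :
    (optimalWeight hp hT hn hf).1 s = bandMul n (p.weightSymbol T s) f :=
  Set.indicator_of_mem hs fun s => bandMul n (p.weightSymbol T s) f

lemma continuous_slice {X : Type*} [TopologicalSpace X] {m : ℝ × ℝ → X} (hm : Continuous m) (s : ℝ) :
    Continuous fun x => m (s, x) :=
  hm.comp (by fun_prop : Continuous fun x : ℝ => (s, x))

/-- Variation of constants: the integrand is the derivative of exp((τ - s) ā) times the state
symbol, integrated from s to T. -/
lemma state_optimalWeight (hp : p.Admissible) (hT : 0 ≤ T) (hn : BandLimited n f)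
    (hf : star f = f) {s : ℝ} (h : s ∈ Set.Icc 0 T) :
    bandMul n (p.stateSymbol T s) f = p.dualFlow (T - s) f - ∫ τ in Set.Icc s T,
      p.dualFlow (τ - s) (ContinuousLinearMap.adjoint p.C ((optimalWeight hp hT hn hf).1 τ)) := by
  have hX := hp.continuous_stateSymbol hT
  have hA := hp.continuous_symA
  have hC := hp.continuous_symC
  have hW := hp.continuous_weightSymbol hT
  have hE : Continuous fun z : ℝ × ℝ => Complex.exp ((z.1 - s : ℝ) * star (p.symA z.2)) := by
    fun_prop
  have hM : Continuous fun z : ℝ × ℝ =>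
      Complex.exp ((z.1 - s : ℝ) * star (p.symA z.2)) * p.stateSymbol T z.1 z.2 := hE.mul hX
  have hM' : Continuous fun z : ℝ × ℝ => Complex.exp ((z.1 - s : ℝ) * star (p.symA z.2)) *
      (star (p.symC z.2) * p.weightSymbol T z.1 z.2) :=
    hE.mul ((continuous_star.comp (hC.comp continuous_snd)).mul hW)
  have e1 : ∫ τ in Set.Icc s T, p.dualFlow (τ - s)
        (ContinuousLinearMap.adjoint p.C ((optimalWeight hp hT hn hf).1 τ)) =
      ∫ τ in Set.Icc s T, bandMul n (fun x => Complex.exp ((τ - s : ℝ) * star (p.symA x)) *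
        (star (p.symC x) * p.weightSymbol T τ x)) f := by
    refine setIntegral_congr_fun measurableSet_Icc fun τ hτ => ?_
    rw [optimalWeight_apply hp hT hn hf ⟨h.1.trans hτ.1, hτ.2⟩]
    exact ((hp.dualFlow_sym (sub_nonneg.2 hτ.1) _).comp
      ((hp.adjoint_C_sym _).comp (hn.sym (continuous_slice hW τ)))).unique
      (hn.sym (continuous_slice hM' τ))
  have e2 : bandMul n (fun x => Complex.exp ((T - s : ℝ) * star (p.symA x)) *
      p.stateSymbol T T x) f = p.dualFlow (T - s) f := by
    refine Sym.unique ?_ (hp.dualFlow_sym (sub_nonneg.2 h.2) f)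
    refine (hn.sym (continuous_slice hM T)).congr fun x => ?_
    simp only [stateSymbol, sub_self, phase_zero]
    rw [div_self (hp.hamState_pos hT x).ne']
    simp
  have e3 : bandMul n (fun x => Complex.exp ((s - s : ℝ) * star (p.symA x)) *
      p.stateSymbol T s x) f = bandMul n (p.stateSymbol T s) f :=
    congrArg (fun m => bandMul n m f) (funext fun x => by simp)
  rw [e1, setIntegral_Icc_bandMul_deriv n (fun τ x => hp.hasDerivAt_stateSymbol T s τ x)
    (continuous_slice hM) hM' f h.2, e2, e3, sub_sub_cancel]

lemma costate_optimalWeight (hp : p.Admissible) (hT : 0 ≤ T) (hn : BandLimited n f)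
    {τ : ℝ} (h : τ ∈ Set.Icc 0 T) :
    bandMul n (p.costateSymbol T τ) f = p.flow τ (bandMul n (p.stateSymbol T 0) f) +
      ∫ s in Set.Icc 0 τ, p.flow (τ - s)
        (p.B (ContinuousLinearMap.adjoint p.B (bandMul n (p.stateSymbol T s) f))) := by
  have hX := hp.continuous_stateSymbol hT
  have hY := hp.continuous_costateSymbol hT
  have hA := hp.continuous_symA
  have hB := hp.continuous_symB
  have hE : Continuous fun z : ℝ × ℝ => Complex.exp ((τ - z.1 : ℝ) * p.symA z.2) := by
    fun_prop
  have hM : Continuous fun z : ℝ × ℝ =>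
      Complex.exp ((τ - z.1 : ℝ) * p.symA z.2) * p.costateSymbol T z.1 z.2 := hE.mul hY
  have hM' : Continuous fun z : ℝ × ℝ => Complex.exp ((τ - z.1 : ℝ) * p.symA z.2) *
      (p.symB z.2 * (star (p.symB z.2) * p.stateSymbol T z.1 z.2)) :=
    hE.mul ((hB.comp continuous_snd).mul
      ((continuous_star.comp (hB.comp continuous_snd)).mul hX))
  have e1 : ∫ s in Set.Icc 0 τ, p.flow (τ - s)
        (p.B (ContinuousLinearMap.adjoint p.B (bandMul n (p.stateSymbol T s) f))) =
      ∫ s in Set.Icc 0 τ, bandMul n (fun x => Complex.exp ((τ - s : ℝ) * p.symA x) *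
        (p.symB x * (star (p.symB x) * p.stateSymbol T s x))) f :=
    setIntegral_congr_fun measurableSet_Icc fun s hs =>
      ((hp.flow_sym (sub_nonneg.2 hs.2) _).comp ((hp.B_sym _).comp
        ((hp.adjoint_B_sym _).comp (hn.sym (continuous_slice hX s))))).unique
        (hn.sym (continuous_slice hM' s))
  have e2 : bandMul n (fun x => Complex.exp ((τ - 0 : ℝ) * p.symA x) *
      p.costateSymbol T 0 x) f = p.flow τ (bandMul n (p.stateSymbol T 0) f) := by
    refine Sym.unique ?_ ((hp.flow_sym h.1 _).comp (hn.sym (continuous_slice hX 0)))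
    refine (hn.sym (continuous_slice hM 0)).congr fun x => ?_
    -- State and costate both start from 1, so they agree at time zero; this encodes the identity
    -- initial covariance.
    simp only [stateSymbol, costateSymbol, hamState_zero, hamCostate_zero, sub_zero]
  have e3 : bandMul n (fun x => Complex.exp ((τ - τ : ℝ) * p.symA x) *
      p.costateSymbol T τ x) f = bandMul n (p.costateSymbol T τ) f :=
    congrArg (fun m => bandMul n m f) (funext fun x => by simp)
  rw [e1, setIntegral_Icc_bandMul_deriv n (fun s x => hp.hasDerivAt_costateSymbol T τ s x)
    (continuous_slice hM) hM' f h.1, e2, e3, add_sub_cancel]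

lemma isOptimalWeight_optimalWeight (hp : p.Admissible) (hT : 0 ≤ T) (hn : BandLimited n f)
    (hf : star f = f) : p.IsOptimalWeight T f (optimalWeight hp hT hn hf)
      (fun s => bandMul n (p.stateSymbol T s) f) (fun s => bandMul n (p.costateSymbol T s) f) where
  continuous_state := continuous_bandMul_apply n (hp.continuous_stateSymbol hT) f
  continuous_costate := continuous_bandMul_apply n (hp.continuous_costateSymbol hT) f
  state_eq _ h := state_optimalWeight hp hT hn hf h
  costate_eq _ h := costate_optimalWeight hp hT hn h
  weight_eq τ h := by
    rw [optimalWeight_apply hp hT hn hf h]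
    refine ((hp.C_sym _).comp
      (hn.sym (continuous_slice (hp.continuous_costateSymbol hT) τ))).unique
      (((hp.G_sym _).comp ((hp.adjoint_G_sym _).comp
        (hn.sym (continuous_slice (hp.continuous_weightSymbol hT) τ)))).congr fun x => ?_)
    have h1 := hp.normG_sq_ne_zero x
    simp only [weightSymbol]
    rw [← mul_assoc, mul_star_eq]
    field_simp

end Plant

namespace Plant

variable {p : Plant} {T : ℝ} {f : L2}

/-! ### The covariance at a finite time -/

/-- The symbol of the error covariance at the time `T`. -/
def covarianceSymbol (p : Plant) (T x : ℝ) : ℝ := p.hamCostate T x / p.hamState T x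

/-- Writing X, Y for the state and costate components, u = Y - rX satisfies u' = -σu with u(0) = 1 -
r; dividing by X gives the exact deviation from the steady state. -/
lemma Admissible.covarianceSymbol_sub (hp : p.Admissible) (hT : 0 ≤ T) (x : ℝ) :
    p.covarianceSymbol T x - p.riccatiSymbol x =
      Real.exp (-(p.decayRate x * T)) * (1 - p.riccatiSymbol x) / p.hamState T x := by
  have h0 := (hp.decayRate_pos x).ne'
  have h1 := (hp.hamState_pos hT x).ne'
  have h2 := hp.quadCoeff_mul_riccatiSymbol x
  have h3 := hp.decayRate_sq x
  have h4 : ‖p.symB x‖ ^ 2 = p.riccatiSymbol x * (p.decayRate x - (p.symA x).re) := by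
    refine mul_left_cancel₀ (hp.quadCoeff_pos x).ne' ?_
    linear_combination (p.decayRate x - (p.symA x).re) * -h2 - h3
  rw [covarianceSymbol, eq_div_iff h1, sub_mul, div_mul_cancel₀ _ h1, ← Real.cosh_sub_sinh]
  simp only [hamState, hamCostate]
  rw [h4]
  field_simp
  linear_combination -Real.sinh (p.decayRate x * T) * h2

lemma Admissible.exp_le_hamState (hp : p.Admissible) (hT : 0 ≤ T) (x : ℝ) :
    Real.exp (-(p.decayRate x * T)) ≤ p.hamState T x := by
  have h0 := hp.decayRate_pos x
  have h1 := (abs_lt.1 (hp.abs_re_lt_decayRate x)).2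
  have h2 : 0 ≤ Real.sinh (p.decayRate x * T) := Real.sinh_nonneg_iff.2 (by positivity)
  have h3 : -1 ≤ (p.quadCoeff x - (p.symA x).re) / p.decayRate x := by
    rw [le_div_iff₀ h0]
    linarith [hp.quadCoeff_pos x]
  rw [← Real.cosh_sub_sinh, hamState]
  nlinarith

/-- As exp(-σT) ≤ `hamState`, the deviation is at most |1 - r|. With the upper bound on r this
dominates it uniformly in time and frequency. -/
lemma Admissible.abs_covarianceSymbol_sub_le (hp : p.Admissible) (hT : 0 ≤ T) (x : ℝ) :
    |p.covarianceSymbol T x - p.riccatiSymbol x| ≤ 1 + p.riccatiSymbol x := by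
  have h1 := hp.hamState_pos hT x
  have h2 := hp.riccatiSymbol_pos x
  rw [hp.covarianceSymbol_sub hT, mul_div_right_comm, abs_mul,
    abs_of_pos (div_pos (Real.exp_pos _) h1)]
  calc _ ≤ 1 * |1 - p.riccatiSymbol x| := by
        gcongr
        exact (div_le_one h1).2 (hp.exp_le_hamState hT x)
    _ ≤ _ := by
        rw [one_mul, abs_le]
        constructor <;> linarith

/-- With c > -1 the coefficient of sinh, X ≥ (1 + c) sinh(σT) ≥ (1 + c)σT, and the last expression
tends to infinity. -/
lemma Admissible.tendsto_hamState (hp : p.Admissible) (x : ℝ) :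
    Tendsto (fun T => p.hamState T x) atTop atTop := by
  have h0 := hp.decayRate_pos x
  have h1 := (abs_lt.1 (hp.abs_re_lt_decayRate x)).2
  set c := (p.quadCoeff x - (p.symA x).re) / p.decayRate x with hc
  have h2 : 0 < 1 + c := by
    have : -1 < c := by
      rw [hc, lt_div_iff₀ h0]
      linarith [hp.quadCoeff_pos x]
    linarith
  have h3 : Tendsto (fun T : ℝ => (1 + c) * (p.decayRate x * T)) atTop atTop :=
    (tendsto_id.const_mul_atTop h0).const_mul_atTop h2
  refine tendsto_atTop_mono' atTop ?_ h3
  filter_upwards [eventually_ge_atTop 0] with T hT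
  have h4 : 0 ≤ p.decayRate x * T := by positivity
  have h5 := Real.self_le_sinh_iff.2 h4
  have h6 := Real.sinh_lt_cosh (p.decayRate x * T)
  rw [hamState, ← hc]
  nlinarith

lemma Admissible.tendsto_covarianceSymbol (hp : p.Admissible) (x : ℝ) :
    Tendsto (fun T => p.covarianceSymbol T x) atTop (𝓝 (p.riccatiSymbol x)) := by
  rw [← tendsto_sub_nhds_zero_iff]
  have h1 : Tendsto (fun T => (1 + p.riccatiSymbol x) / p.hamState T x) atTop (𝓝 0) :=
    (hp.tendsto_hamState x).const_div_atTop _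
  refine squeeze_zero_norm' ?_ h1
  filter_upwards [eventually_ge_atTop 0] with T hT
  have h2 := hp.hamState_pos hT x
  have h3 := hp.riccatiSymbol_pos x
  have h4 : Real.exp (-(p.decayRate x * T)) ≤ 1 :=
    Real.exp_le_one_iff.2 (by have := hp.decayRate_pos x; nlinarith)
  have h5 : |1 - p.riccatiSymbol x| ≤ 1 + p.riccatiSymbol x :=
    abs_le.2 ⟨by linarith, by linarith⟩
  rw [hp.covarianceSymbol_sub hT, norm_div, norm_mul, Real.norm_eq_abs, Real.norm_eq_abs,
    Real.norm_eq_abs, abs_of_pos h2, Real.abs_exp]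
  gcongr
  calc _ ≤ 1 * (1 + p.riccatiSymbol x) := by gcongr
    _ = _ := one_mul _

lemma Admissible.continuous_covarianceSymbol (hp : p.Admissible) (hT : 0 ≤ T) :
    Continuous (p.covarianceSymbol T) := by
  have h1 : Continuous fun x => p.hamCostate T x := continuous_slice hp.continuous_hamCostate T
  have h2 : Continuous fun x => p.hamState T x := continuous_slice hp.continuous_hamState T
  exact h1.div h2 fun x => (hp.hamState_pos hT x).ne'

lemma Admissible.boundedSymbol_covariance (hp : p.Admissible) (hT : 0 ≤ T) :
    BoundedSymbol fun x => (p.covarianceSymbol T x : ℂ) := by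
  obtain ⟨δ, -, c, hc⟩ := hp.exists_decayRate_ge_and_riccatiSymbol_le
  refine ⟨(Complex.continuous_ofReal.comp (hp.continuous_covarianceSymbol hT)).measurable,
    1 + 2 * c, fun x => ?_⟩
  have h1 := abs_le.1 (hp.abs_covarianceSymbol_sub_le hT x)
  have h2 := hp.riccatiSymbol_pos x
  rw [Complex.norm_real, Real.norm_eq_abs, abs_le]
  constructor <;> linarith [(hc x).2]

/-- The error covariance operator at the time `T`. -/
def covarianceOp (p : Plant) (T : ℝ) : L2 →L[ℂ] L2 := mul fun x => (p.covarianceSymbol T x : ℂ)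

lemma Admissible.tendsto_covarianceOp (hp : p.Admissible) (f : L2) :
    Tendsto (fun T => p.covarianceOp T f) atTop (𝓝 (p.riccatiOp f)) := by
  obtain ⟨δ, -, c, hc⟩ := hp.exists_decayRate_ge_and_riccatiSymbol_le
  refine tendsto_of_symbols (M := fun T x => (p.covarianceSymbol T x : ℂ)) (d := fun _ => 1) ?_
    (hp.riccatiOp_sym f) (Sym.one f) (1 + c) ?_ fun x =>
      (Complex.continuous_ofReal.tendsto _).comp (hp.tendsto_covarianceSymbol x)
  · filter_upwards [eventually_ge_atTop 0] with T hT
    exact mul_sym (hp.boundedSymbol_covariance hT) f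
  · filter_upwards [eventually_ge_atTop 0] with T hT x
    rw [← Complex.ofReal_sub, Complex.norm_real, Real.norm_eq_abs, norm_one]
    linarith [hp.abs_covarianceSymbol_sub_le hT x, (hc x).2, hp.riccatiSymbol_pos x]

/-! ### The error variance of general real fields -/

variable {Ω : Type*} {N : Inputs Ω} [MeasurableSpace Ω] {μ : Measure Ω}

lemma errorVariance_of_bandLimited (hp : p.Admissible) (hN : N.IsWhite μ) (hT : 0 ≤ T) {n : ℕ}
    (hn : BandLimited n f) (hf : star f = f) :
    p.errorVariance μ N T f = (inner ℂ (p.covarianceOp T f) f).re := by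
  rw [(isOptimalWeight_optimalWeight hp hT hn hf).errorVariance_eq hp hN hT hf]
  congr 2
  refine ((hn.sym (continuous_slice (hp.continuous_costateSymbol hT) T)).congr fun x => ?_).unique
    (mul_sym (hp.boundedSymbol_covariance hT) f)
  rw [costateSymbol, sub_self, phase_zero, one_mul, covarianceSymbol]

lemma Admissible.exists_norm_stateNoise_sub_le (hp : p.Admissible) (T : ℝ) :
    ∃ c, ∀ s ∈ Set.Icc 0 T, ∀ f g : L2,
      ‖p.stateNoise T f s - p.stateNoise T g s‖ ≤ c * ‖f - g‖ := by
  obtain ⟨c, hc⟩ := hp.exists_norm_dualFlow_le T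
  refine ⟨‖ContinuousLinearMap.adjoint p.B‖ * c, fun s hs f g => ?_⟩
  rw [stateNoise_eq hs, stateNoise_eq hs, ← map_sub, ← map_sub, mul_assoc]
  refine (ContinuousLinearMap.le_opNorm _ _).trans ?_
  gcongr
  exact (p.dualFlow _).le_of_opNorm_le (hc _ (by linarith [hs.1])) _

lemma exists_cov_stateTest_sub_le (hp : p.Admissible) (hT : 0 ≤ T) :
    ∃ c, ∀ f g : L2, ∀ (hf : star f = f) (hg : star g = g),
      Inputs.cov (stateTest hp hT hf) (stateTest hp hT hf) -
        2 * Inputs.cov (stateTest hp hT hf) (stateTest hp hT hg) +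
        Inputs.cov (stateTest hp hT hg) (stateTest hp hT hg) ≤ c * ‖f - g‖ ^ 2 := by
  obtain ⟨c, hc⟩ := hp.exists_norm_stateNoise_sub_le T
  refine ⟨‖ContinuousLinearMap.adjoint (p.S T)‖ ^ 2 + T * c ^ 2, fun f g hf hg => ?_⟩
  rw [Inputs.cov_sub_sub]
  have e1 : ‖(stateTest hp hT hf).1.1 - (stateTest hp hT hg).1.1‖ ≤
      ‖ContinuousLinearMap.adjoint (p.S T)‖ * ‖f - g‖ := by
    change ‖ContinuousLinearMap.adjoint (p.S T) f - ContinuousLinearMap.adjoint (p.S T) g‖ ≤ _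
    rw [← map_sub]
    exact ContinuousLinearMap.le_opNorm _ _
  have e2 : ∫ t in Set.Ici (0 : ℝ),
      ‖(stateTest hp hT hf).2.1.1 t - (stateTest hp hT hg).2.1.1 t‖ ^ 2 ≤
      T * (c * ‖f - g‖) ^ 2 := by
    have e4 : ∫ t in Set.Ici (0 : ℝ), (Set.Icc 0 T).indicator (fun _ => (c * ‖f - g‖) ^ 2) t =
        T * (c * ‖f - g‖) ^ 2 := by
      rw [integral_indicator measurableSet_Icc, restrict_Ici_restrict_Icc, setIntegral_const,
        Real.volume_real_Icc_of_le hT, sub_zero, smul_eq_mul]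
    rw [← e4]
    refine integral_mono_of_nonneg (ae_of_all _ fun t => by positivity) ?_ (ae_of_all _ fun t => ?_)
    · rw [integrable_indicator_iff measurableSet_Icc, IntegrableOn, restrict_Ici_restrict_Icc]
      exact integrable_const _
    · change ‖(Set.Icc 0 T).indicator (p.stateNoise T f) t -
        (Set.Icc 0 T).indicator (p.stateNoise T g) t‖ ^ 2 ≤ _
      by_cases h : t ∈ Set.Icc 0 T
      · rw [Set.indicator_of_mem h, Set.indicator_of_mem h, Set.indicator_of_mem h]
        gcongr
        exact hc t h f g
      · rw [Set.indicator_of_notMem h, Set.indicator_of_notMem h, Set.indicator_of_notMem h,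
          sub_zero, norm_zero]
        norm_num
  have e3 : ∫ t in Set.Ici (0 : ℝ),
      ‖(stateTest hp hT hf).2.2.1 t - (stateTest hp hT hg).2.2.1 t‖ ^ 2 = 0 := by
    refine (integral_congr_ae (ae_of_all _ fun t => ?_)).trans (integral_zero _ _)
    change ‖(0 : L2) - 0‖ ^ 2 = 0
    simp
  rw [e3, add_zero]
  calc _ ≤ (‖ContinuousLinearMap.adjoint (p.S T)‖ * ‖f - g‖) ^ 2 + T * (c * ‖f - g‖) ^ 2 := by
        gcongr
    _ = _ := by ring

/-- The optimal weight is constructed for band-limited fields only. The observations do not depend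
on the field, and the state depends continuously on it in mean square, so the error variance passes
to the limit. -/
lemma tendsto_errorVariance_band (hp : p.Admissible) (hN : N.IsWhite μ) (hT : 0 ≤ T)
    (hf : star f = f) : Tendsto (fun n => p.errorVariance μ N T (band n f)) atTop
      (𝓝 (p.errorVariance μ N T f)) := by
  have := hN.isGaussianProcess_total.isProbabilityMeasure
  have hfn (n : ℕ) : star (band n f) = band n f := by rw [star_band, hf]
  have hmem {g : L2} (hg : star g = g) : MemLp (p.state N T g) 2 μ :=
    (hN.memLp_total _).ae_eq (state_ae_eq_total hp hN hT hg).symm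
  refine tendsto_integral_sub_condExp_sq (hmem hf) (fun n => hmem (hfn n)) ?_
  obtain ⟨c, hc⟩ := exists_cov_stateTest_sub_le hp hT
  have h1 (n : ℕ) : ∫ ω, (p.state N T (band n f) ω - p.state N T f ω) ^ 2 ∂μ ≤
      c * ‖band n f - f‖ ^ 2 := by
    refine le_of_eq_of_le ?_ (hc _ _ (hfn n) hf)
    rw [← hN.integral_total_sub_total_sq]
    refine integral_congr_ae ?_
    filter_upwards [state_ae_eq_total hp hN hT (hfn n), state_ae_eq_total hp hN hT hf] with ω e1 e2
    rw [e1, e2]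
  have h2 : Tendsto (fun n => c * ‖band n f - f‖ ^ 2) atTop (𝓝 0) := by
    have h3 := (tendsto_iff_norm_sub_tendsto_zero.1 (tendsto_band f)).pow 2
    simpa using h3.const_mul c
  exact squeeze_zero (fun n => integral_nonneg fun ω => sq_nonneg _) h1 h2

lemma errorVariance_eq (hp : p.Admissible) (hN : N.IsWhite μ) (hT : 0 ≤ T) (hf : star f = f) :
    p.errorVariance μ N T f = (inner ℂ (p.covarianceOp T f) f).re := by
  refine tendsto_nhds_unique (tendsto_errorVariance_band hp hN hT hf) ?_
  have h1 (n : ℕ) : p.errorVariance μ N T (band n f) =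
      (inner ℂ (p.covarianceOp T (band n f)) (band n f)).re :=
    errorVariance_of_bandLimited hp hN hT (bandLimited_band n f) (by rw [star_band, hf])
  simp_rw [h1]
  have h2 := tendsto_band f
  exact (Complex.continuous_re.tendsto _).comp
    ((((p.covarianceOp T).continuous.tendsto f).comp h2).inner h2)

/-! ### The steady state -/

lemma tendsto_errorVariance (hp : p.Admissible) (hN : N.IsWhite μ) (hf : star f = f) :
    Tendsto (fun T => p.errorVariance μ N T f) atTop (𝓝 (inner ℂ f (p.riccatiOp f)).re) := by
  have h1 : (inner ℂ f (p.riccatiOp f)).re = (inner ℂ (p.riccatiOp f) f).re :=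
    inner_re_symm (𝕜 := ℂ) _ _
  rw [h1]
  refine Tendsto.congr' ?_ ((Complex.continuous_re.tendsto _).comp
    ((hp.tendsto_covarianceOp f).inner tendsto_const_nhds))
  filter_upwards [eventually_ge_atTop 0] with T hT
  exact (errorVariance_eq hp hN hT hf).symm

lemma Admissible.star_riccatiOp (hp : p.Admissible) (f : L2) :
    p.riccatiOp (star f) = star (p.riccatiOp f) :=
  star_apply_of_hermitian hp.riccatiOp_sym (fun x => by simp [hp.riccatiSymbol_neg]) f

/-- A real self-adjoint operator is determined by its quadratic form on real fields. -/
lemma eq_zero_of_inner_self_real {D : L2 →L[ℂ] L2} (hD : IsSelfAdjoint D)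
    (hr : ∀ f, D (star f) = star (D f)) (h : ∀ f, star f = f → (inner ℂ f (D f)).re = 0) :
    D = 0 := by
  have h1 : ∀ g, star g = g → D g = 0 := fun g hg => by
    have hDg : star (D g) = D g := by rw [← hr, hg]
    -- The form vanishes at g, at Dg and at their sum; the cross terms contribute 2‖Dg‖².
    have h2 := h (g + D g) (by rw [star_add_L2, hg, hDg])
    rw [map_add, inner_add_left, inner_add_right, inner_add_right, Complex.add_re, Complex.add_re,
      Complex.add_re, h g hg, h _ hDg] at h2
    have h3 : inner ℂ g (D (D g)) = inner ℂ (D g) (D g) := by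
      rw [← ContinuousLinearMap.adjoint_inner_left, hD.adjoint_eq]
    have h4 : (inner ℂ (D g) (D g)).re = ‖D g‖ ^ 2 := inner_self_eq_norm_sq (𝕜 := ℂ) (D g)
    rw [h3, h4] at h2
    exact norm_eq_zero.1 (by nlinarith [norm_nonneg (D g)])
  ext1 f
  have h2 : D (f + star f) = 0 := h1 _ (by rw [star_add_L2, star_star, add_comm])
  -- Together with f + f*, this real field recovers `f`.
  have h3 : D (Complex.I • (f - star f)) = 0 := h1 _ (by
    rw [star_smul_L2, star_sub_L2, star_star, RCLike.star_def, Complex.conj_I, neg_smul,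
      ← smul_neg, neg_sub])
  rw [map_smul, smul_eq_zero_iff_right Complex.I_ne_zero] at h3
  have h4 : (2 : ℂ) • D f = 0 := by
    rw [two_smul]
    rw [map_add] at h2
    rw [map_sub] at h3
    calc D f + D f = (D f + D (star f)) + (D f - D (star f)) := by abel
      _ = 0 := by rw [h2, h3, add_zero]
  exact (smul_eq_zero_iff_right two_ne_zero).1 h4

/-- The limit determines the quadratic form on real fields, and that form determines a real
self-adjoint operator. -/
lemma isSteadyStateErrorCovariance_iff (hp : p.Admissible) (hN : N.IsWhite μ) (Q : L2 →L[ℂ] L2) :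
    p.IsSteadyStateErrorCovariance μ N Q ↔ Q = p.riccatiOp := by
  have hP := hp.solvesARE_riccatiOp.1
  constructor
  · rintro ⟨hQ, hr, hlim⟩
    rw [← sub_eq_zero]
    refine eq_zero_of_inner_self_real (hQ.sub hP) (fun f => ?_) fun f hf => ?_
    · obtain ⟨h, h'⟩ := hr ⟨f, trivial⟩
      have h1 : Q (star f) = star (Q f) := h'
      rw [sub_apply, sub_apply, h1, hp.star_riccatiOp, star_sub_L2]
    · have h1 := tendsto_nhds_unique (hlim f hf) (tendsto_errorVariance hp hN hf)
      rw [sub_apply, inner_sub_right, Complex.sub_re, h1, sub_self]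
  · rintro rfl
    exact ⟨hP, fun f => ⟨trivial, hp.star_riccatiOp f⟩, fun f hf => tendsto_errorVariance hp hN hf⟩

end Plant

end KalmanSIS

end

theorem theorem3 (p : KalmanSIS.Plant) (hp : p.Admissible) :
    ∃ P : KalmanSIS.L2 →L[ℂ] KalmanSIS.L2,
      -- `P` is the unique self-adjoint stabilizing solution of the Riccati equation
      (p.SolvesARE P ∧ p.IsStabilizing P) ∧
      (∀ Q : KalmanSIS.L2 →L[ℂ] KalmanSIS.L2, p.SolvesARE Q → p.IsStabilizing Q → Q = P) ∧
      -- `P` is the steady-state error covariance of the optimal filter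
      (∀ (Ω : Type*) [MeasurableSpace Ω] (μ : MeasureTheory.Measure Ω)
          [MeasureTheory.IsProbabilityMeasure μ] (N : KalmanSIS.Inputs Ω), N.IsWhite μ →
        ∀ Q : KalmanSIS.L2 →L[ℂ] KalmanSIS.L2,
          p.IsSteadyStateErrorCovariance μ N Q ↔ Q = P) ∧
      -- `P` is translation invariant
      KalmanSIS.TranslationInvariant (KalmanSIS.toPartial P) ∧
      -- the operator Riccati equation decouples into scalar equations
      (∀ (Q : KalmanSIS.L2 →L[ℂ] KalmanSIS.L2) (q : ℝ → ℝ),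
        KalmanSIS.HasFourierSymbol (KalmanSIS.toPartial Q) (fun x => (q x : ℂ)) →
          (p.SolvesARE Q ↔ ∀ᵐ x : ℝ, p.ScalarARE x (q x))) ∧
      -- the symbol of `P` is given by their nonnegative solutions
      ∃ r : ℝ → ℝ, Continuous r ∧
        KalmanSIS.HasFourierSymbol (KalmanSIS.toPartial P) (fun x => (r x : ℂ)) ∧
        (∀ x : ℝ, 0 ≤ r x ∧ p.ScalarARE x (r x)) ∧
        (∀ x s : ℝ, 0 ≤ s → p.ScalarARE x s → s = r x) ∧
        -- the Kalman gain is a spatial convolution, with the stated symbol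
        Dense ((p.gain P).domain : Set KalmanSIS.L2) ∧
        KalmanSIS.TranslationInvariant (p.gain P) ∧
        KalmanSIS.HasFourierSymbol (p.gain P)
          (fun x => (r x : ℂ) * star (p.symC x) / ((‖p.symG x‖ ^ 2 : ℝ) : ℂ)) ∧
        (∃ K : TemperedDistribution ℝ ℂ, KalmanSIS.IsSpatialConvolution (p.gain P) K ∧
          KalmanSIS.KernelHasSymbol K
            (fun x => (r x : ℂ) * star (p.symC x) / ((‖p.symG x‖ ^ 2 : ℝ) : ℂ))) ∧
        -- the Kalman filter is spatially invariant
        KalmanSIS.TranslationInvariant (p.closedLoop P) ∧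
        KalmanSIS.TranslationInvariant (p.closedLoop P).closure ∧
        KalmanSIS.HasFourierSymbol (p.closedLoop P).closure
          (fun x => p.symA x -
            (r x : ℂ) * star (p.symC x) / ((‖p.symG x‖ ^ 2 : ℝ) : ℂ) * p.symC x) ∧
        (∀ (z : ℝ) (y est : ℝ → KalmanSIS.L2), p.IsFilterTrajectory P y est →
          p.IsFilterTrajectory P (fun t => KalmanSIS.translation z (y t))
            (fun t => KalmanSIS.translation z (est t))) := by
  refine ⟨p.riccatiOp, ⟨hp.solvesARE_riccatiOp, hp.isStabilizing_riccatiOp⟩,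
    fun Q hQ hs => hp.eq_riccatiOp hQ hs,
    fun Ω _ μ _ N hN Q => KalmanSIS.Plant.isSteadyStateErrorCovariance_iff hp hN Q,
    KalmanSIS.translationInvariant_of_sym (fun f => hp.riccatiOp_sym f) (fun _ _ _ => trivial),
    fun Q q hQ => hp.solvesARE_iff hQ,
    p.riccatiSymbol, hp.continuous_riccatiSymbol, fun f => hp.riccatiOp_sym f,
    fun x => ⟨(hp.riccatiSymbol_pos x).le, hp.scalarARE_riccatiSymbol x⟩,
    fun x s hs h => hp.eq_riccatiSymbol hs h, hp.dense_gain_domain _,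
    hp.translationInvariant_gain, hp.gain_sym, hp.exists_convolution_kernel,
    hp.translationInvariant_closedLoop, hp.translationInvariant_closedLoop_closure,
    fun f => KalmanSIS.sym_of_eq_maxMul hp.closedLoop_closure.2 f,
    fun z y est h => hp.isFilterTrajectory_translation z h⟩
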